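/- Let $K/F$ be a Galois extension of fields of characteristic $\neq 2$ with $G=\operatorname{Gal}(K/F)\cong C_{2^n}$ cyclic of order $2^n$, $n\ge 3$. For $0\le i\le n$ let $C_{2^i}\le G$ be the subgroup of order $2^i$. The Burnside Tambara functor of $G$ assigns to $H\le G$ the Burnside ring $A(H)$, with restrictions, transfers $X\mapsto H\times_L X$, norms $X\mapsto \operatorname{Map}_L(H,X)$ (for $L\le H$; norms are extended to virtual sets polynomially), and conjugations. A Tambara ideal is a family of ideals $I(H)\subseteq A(H)$ stable under restriction, transfer and conjugation, with $N(I(L))\subseteq I(H)+N(0)$ for the norms $N$; and $\langle\!\langle S\rangle\!\rangle$ is the smallest Tambara ideal containing $S$. The trace ideal $TI$ of $K/F$ is the family of kernels of the Dress maps $A(H)\to GW(K^H)$, $[H/L]\mapsto \operatorname{tr}_{K^L/K^H}\langle 1\rangle$, where $GW$ is the Grothendieck–Witt ring and $\operatorname{tr}$ is the Scharlau transfer along the field trace. For $0\le j\le i\le n$ let $t_{2^i,2^j}=[C_{2^i}/C_{2^{i-j}}]\in A(C_{2^i})$. Put $E=K^{C_2}$ and $L=K^{C_4}$. One can write $E=L(\sqrt\Delta)$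 with $\Delta=a^2+b^2\in L^\times$, $a,b\in L$, and $K=E(\sqrt\delta)$ with $\delta=x(\Delta+a\sqrt\Delta)\in E$, $x\in L^\times$. For any such choice: 1. If $K/L$ embeds into a cyclic Galois extension of $L$ of degree $8$, then $TI=\langle\!\langle t_{4,4}-t_{4,2}-2\rangle\!\rangle$. 2. Let $\tau_E(\delta)$ be the least power of $2$ such that $\delta$ is a sum of that many squares in $E$, and $\tau_E(\delta)=0$ if $\delta$ is not a sum of squares in $E$. If $\tau_E(\delta)=0$, then $TI=\langle\!\langle t_{8,4}-t_{8,2}-2\rangle\!\rangle$. 3. Suppose that $K/L$ does not embed into a cyclic extension of degree $8$ and that $\tau_E(\delta)\ne 0$. For $1\le i\le n$ let $a_i$ be the additive order of $\operatorname{tr}_{K/K^{C_{2^i}}}\langle 1\rangle-2^i\langle 1\rangle$ in $GW(K^{C_{2^i}})$. Each $a_i$ is finite, is a power of $2$ and is $\neq 1$, and $a_{i+1}\mid a_i\mid 2a_{i+1}$ for $1\le i<n$. Let $m$ be the minimal index with $3\le m\le n$ such that $\operatorname{tr}_{L/K^{C_{2^m}}}\bigl(\langle\Delta,x,x\rangle-\langle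 2,2\Delta,1\rangle\bigr)=0$ in $GW(K^{C_{2^m}})$, if such an index exists. Then $TI$ is the Tambara ideal generated by (a) $t_{2^m,2^m}-t_{2^m,2^{m-1}}-2t_{2^m,2^{m-2}}$ (omitted if there is no such $m$), (b) $t_{8,4}-t_{8,2}-2$, (c) $a_i(t_{2^i,2^i}-2^i)$ for $1\le i\le n$. -/

import Mathlib

universe u v

namespace TraceIdeal

open Algebra

section Grothendieck

theorem grothendieck_exists_rep {M : Type u} [AddCommMonoid M] (z : GrothendieckAddGroup M) :
    ∃ x y : M, z = GrothendieckAddGroup.of x - GrothendieckAddGroup.of y := by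
  induction z using AddLocalization.induction_on with
  | _ p =>
    obtain ⟨x, y, hy⟩ := p
    refine ⟨x, y, ?_⟩
    change _ = AddLocalization.mk x 0 - AddLocalization.mk y 0
    rw [GrothendieckAddGroup.mk_sub_mk]
    congr 1
    · simp
    · ext; simp

theorem grothendieck_hom_ext {M : Type u} [AddCommMonoid M] {A : Type v} [AddCommGroup A]
    {f g : GrothendieckAddGroup M →+ A}
    (h : ∀ m : M, f (GrothendieckAddGroup.of m) = g (GrothendieckAddGroup.of m)) : f = g := by
  ext z
  obtain ⟨x, y, rfl⟩ := grothendieck_exists_rep z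
  rw [map_sub, map_sub, h, h]

theorem grothendieck_lift_of {M : Type u} [AddCommMonoid M] {A : Type v} [AddCommGroup A]
    (f : M →+ A) (m : M) :
    GrothendieckAddGroup.lift f (GrothendieckAddGroup.of m) = f m :=
  DFunLike.congr_fun (GrothendieckAddGroup.lift.symm_apply_apply f) m

variable (M : Type u) [CommSemiring M]

/-- The product on the Grothendieck group of the additive monoid of a commutative semiring,
extended biadditively from the product of the semiring. -/
noncomputable def grothendieckMul :
    GrothendieckAddGroup M →+ GrothendieckAddGroup M →+ GrothendieckAddGroup M :=
  GrothendieckAddGroup.lift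
    { toFun := fun m => GrothendieckAddGroup.lift
        (GrothendieckAddGroup.of.comp (AddMonoidHom.mulLeft m))
      map_zero' := grothendieck_hom_ext fun m => by
        rw [grothendieck_lift_of]; simp
      map_add' := fun a b => grothendieck_hom_ext fun m => by
        rw [AddMonoidHom.add_apply]
        simp only [grothendieck_lift_of, AddMonoidHom.comp_apply, AddMonoidHom.coe_mulLeft,
          add_mul, map_add] }

theorem grothendieckMul_of (a b : M) :
    grothendieckMul M (GrothendieckAddGroup.of a) (GrothendieckAddGroup.of b) =
      GrothendieckAddGroup.of (a * b) := by
  rw [grothendieckMul, grothendieck_lift_of]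
  change GrothendieckAddGroup.lift _ _ = _
  rw [grothendieck_lift_of]
  rfl

/-- The Grothendieck ring of a commutative semiring: formal differences of its elements. -/
@[reducible] noncomputable def grothendieckCommRing : CommRing (GrothendieckAddGroup M) :=
  { (inferInstance : AddCommGroup (GrothendieckAddGroup M)) with
    mul := fun a b => grothendieckMul M a b
    one := GrothendieckAddGroup.of 1
    left_distrib := fun a b c => map_add (grothendieckMul M a) b c
    right_distrib := fun a b c => by
      change grothendieckMul M (a + b) c = _
      rw [map_add]; rfl
    zero_mul := fun a => by
      change grothendieckMul M 0 a = 0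
      rw [map_zero]; rfl
    mul_zero := fun a => map_zero (grothendieckMul M a)
    mul_comm := fun a b => by
      change grothendieckMul M a b = grothendieckMul M b a
      obtain ⟨x, y, rfl⟩ := grothendieck_exists_rep a
      obtain ⟨z, t, rfl⟩ := grothendieck_exists_rep b
      simp only [map_sub, AddMonoidHom.sub_apply, grothendieckMul_of]
      rw [mul_comm z x, mul_comm z y, mul_comm t x, mul_comm t y]
      abel
    mul_assoc := fun a b c => by
      change grothendieckMul M (grothendieckMul M a b) c =
        grothendieckMul M a (grothendieckMul M b c)
      obtain ⟨x, y, rfl⟩ := grothendieck_exists_rep a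
      obtain ⟨z, t, rfl⟩ := grothendieck_exists_rep b
      obtain ⟨r, s, rfl⟩ := grothendieck_exists_rep c
      simp only [map_sub, AddMonoidHom.sub_apply, grothendieckMul_of, mul_assoc]
    one_mul := fun a => by
      change grothendieckMul M (GrothendieckAddGroup.of 1) a = a
      obtain ⟨x, y, rfl⟩ := grothendieck_exists_rep a
      simp only [map_sub, grothendieckMul_of, one_mul]
    mul_one := fun a => by
      change grothendieckMul M a (GrothendieckAddGroup.of 1) = a
      obtain ⟨x, y, rfl⟩ := grothendieck_exists_rep a
      simp only [map_sub, AddMonoidHom.sub_apply, grothendieckMul_of, mul_one] }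

end Grothendieck

section AlgebraicMaps

variable {M : Type u} [AddCommMonoid M] {A : Type v} [AddCommGroup A]

/-- The `D`-th iterated differences of `f` in every direction vanish, that is, `f` is
polynomial of degree less than `D` along every line. -/
def DiffVanish (D : ℕ) (f : M → A) : Prop :=
  ∀ x y : M, ∑ k ∈ Finset.range (D + 1), ((-1 : ℤ) ^ k * D.choose k) • f (x + k • y) = 0

/-- The value at the formal difference `x - y` of the polynomial extension of `f`. -/
def diffValue (D : ℕ) (f : M → A) (x y : M) : A :=
  ∑ k ∈ Finset.range D, ((-1 : ℤ) ^ k * D.choose (k + 1)) • f (x + k • y)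

theorem DiffVanish.diffValue_add {D : ℕ} {f : M → A} (hf : DiffVanish D f) (x y : M) :
    diffValue D f (x + y) y = f x := by
  have h := hf x y
  rw [Finset.sum_range_succ'] at h
  simp only [pow_zero, Nat.choose_zero_right, Nat.cast_one, mul_one, one_smul, zero_smul,
    add_zero] at h
  rw [diffValue, ← sub_eq_zero, ← neg_eq_zero, ← h, neg_sub, sub_eq_neg_add, ← Finset.sum_neg_distrib]
  congr 1
  refine Finset.sum_congr rfl fun k _ => ?_
  rw [← neg_smul, add_smul, one_smul, pow_succ, add_comm (k • y) y, add_assoc]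
  congr 1
  ring

theorem DiffVanish.diffValue {D : ℕ} {f : M → A} (hf : DiffVanish D f) (y : M) :
    DiffVanish D fun x => diffValue D f x y := by
  intro x z
  simp only [TraceIdeal.diffValue, Finset.smul_sum]
  rw [Finset.sum_comm]
  refine Finset.sum_eq_zero fun k _ => ?_
  have h := congrArg (fun a => ((-1 : ℤ) ^ k * D.choose (k + 1)) • a) (hf (x + k • y) z)
  simp only [smul_zero, Finset.smul_sum] at h
  rw [← h]
  refine Finset.sum_congr rfl fun j _ => ?_
  rw [smul_comm, add_right_comm]

theorem diffValue_comm (D : ℕ) (f : M → A) (x y z : M) :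
    diffValue D (fun t => diffValue D f t y) x z = diffValue D (fun t => diffValue D f t z) x y := by
  simp only [diffValue, Finset.smul_sum]
  rw [Finset.sum_comm]
  refine Finset.sum_congr rfl fun j _ => Finset.sum_congr rfl fun k _ => ?_
  rw [smul_comm, add_right_comm]

theorem DiffVanish.diffValue_eq {D : ℕ} {f : M → A} (hf : DiffVanish D f) {x y x' y' c : M}
    (h : c + (y' + x) = c + (y + x')) : TraceIdeal.diffValue D f x y = TraceIdeal.diffValue D f x' y' := by
  have e1 := (hf.diffValue y).diffValue_add x y'
  have e2 := (hf.diffValue y').diffValue_add x' y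
  have e3 := ((hf.diffValue y).diffValue y').diffValue_add (x + y') c
  have e4 := ((hf.diffValue y).diffValue y').diffValue_add (x' + y) c
  rw [← e1, ← e2, diffValue_comm D f (x' + y) y' y, ← e3, ← e4]
  congr 1
  rw [add_comm _ c, add_comm _ c, add_comm x, add_comm x', h]

/-- The extension to the Grothendieck group of a polynomial map `f` on a commutative monoid: the
only polynomial map on the Grothendieck group that restricts to `f`. By the vanishing of the
higher differences of such a map, its value at `x - y` has to be
`∑_{k < D} (-1) ^ k * (D choose (k + 1)) * f (x + k y)`. -/
def extendPolynomial (D : ℕ) (f : M → A) (hf : DiffVanish D f) (z : GrothendieckAddGroup M) : A :=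
  AddLocalization.liftOn z (fun x y => diffValue D f x y) fun {_ _ _ _} h => by
    obtain ⟨c, hc⟩ := AddLocalization.r_iff_exists.mp h
    exact hf.diffValue_eq hc

theorem extendPolynomial_sub {D : ℕ} {f : M → A} (hf : DiffVanish D f) (x y : M) :
    extendPolynomial D f hf (GrothendieckAddGroup.of x - GrothendieckAddGroup.of y) =
      diffValue D f x y := by
  have h : (GrothendieckAddGroup.of x - GrothendieckAddGroup.of y : GrothendieckAddGroup M) =
      AddLocalization.mk x ⟨y, AddSubmonoid.mem_top y⟩ := by
    change AddLocalization.mk x 0 - AddLocalization.mk y 0 = _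
    rw [GrothendieckAddGroup.mk_sub_mk]
    congr 1
    · simp
    · ext; simp
  rw [h]; rfl

theorem extendPolynomial_of {D : ℕ} {f : M → A} (hf : DiffVanish D f) (x : M) :
    extendPolynomial D f hf (GrothendieckAddGroup.of x) = f x := by
  have h := extendPolynomial_sub hf x 0
  rw [map_zero, sub_zero] at h
  rw [h]
  simpa using hf.diffValue_add x 0

end AlgebraicMaps

/-- Finite `G`-sets. -/
structure FinGSet (G : Type u) [Group G] : Type (u + 1) where
  (carrier : Type u)
  [action : MulAction G carrier]
  [finite : Finite carrier]

namespace FinGSet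

attribute [instance] FinGSet.action FinGSet.finite

instance (G : Type u) [Group G] : CoeSort (FinGSet G) (Type u) := ⟨FinGSet.carrier⟩

variable {G : Type u} [Group G]

/-- Isomorphism of `G`-sets: an equivariant bijection. -/
def Iso (X Y : FinGSet G) : Prop := ∃ e : X ≃ Y, ∀ (g : G) (x : X), e (g • x) = g • e x

instance setoid (G : Type u) [Group G] : Setoid (FinGSet G) where
  r := Iso
  iseqv :=
    { refl := fun X => ⟨Equiv.refl X, fun _ _ => rfl⟩
      symm := fun {X Y} ⟨e, he⟩ => ⟨e.symm, fun g y => by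
        rw [Equiv.symm_apply_eq, he, Equiv.apply_symm_apply]⟩
      trans := fun ⟨e, he⟩ ⟨f, hf⟩ => ⟨e.trans f, fun g x => by simp [he, hf]⟩ }

/-- The disjoint union of two `G`-sets. -/
def sum (X Y : FinGSet G) : FinGSet G := ⟨X ⊕ Y⟩

/-- The product of two `G`-sets, with the diagonal action. -/
def prod (X Y : FinGSet G) : FinGSet G := ⟨X × Y⟩

/-- A set with the trivial action. -/
def triv (G : Type u) [Group G] (S : Type u) [Finite S] : FinGSet G :=
  letI : MulAction G S := { smul := fun _ s => s, one_smul := fun _ => rfl, mul_smul := fun _ _ _ => rfl }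
  ⟨S⟩

/-- The transitive `G`-set `G / L`. -/
def quot [Finite G] (L : Subgroup G) : FinGSet G := ⟨G ⧸ L⟩

/-- The `G`-stable subset of `X` defined by an invariant predicate. -/
def sub (X : FinGSet G) (P : X → Prop) (hP : ∀ (g : G) (x : X), P x → P (g • x)) : FinGSet G :=
  letI : MulAction G {x : X // P x} :=
    { smul := fun g x => ⟨g • x.1, hP g x.1 x.2⟩
      one_smul := fun x => Subtype.ext (one_smul G x.1)
      mul_smul := fun g h x => Subtype.ext (mul_smul g h x.1) }
  ⟨{x : X // P x}⟩

end FinGSet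

/-- The semiring of isomorphism classes of finite `G`-sets. -/
def BurnsideSemiring (G : Type u) [Group G] : Type (u + 1) := Quotient (FinGSet.setoid G)

namespace BurnsideSemiring

variable {G : Type u} [Group G]

/-- The isomorphism class of a finite `G`-set. -/
def mk (X : FinGSet G) : BurnsideSemiring G := Quotient.mk _ X

theorem mk_eq {X Y : FinGSet G} (e : X ≃ Y) (he : ∀ (g : G) (x : X), e (g • x) = g • e x) :
    mk X = mk Y := Quotient.sound ⟨e, he⟩

instance : Add (BurnsideSemiring G) :=
  ⟨Quotient.map₂ FinGSet.sum fun _ _ ⟨e, he⟩ _ _ ⟨f, hf⟩ => ⟨Equiv.sumCongr e f, fun g x => by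
    rcases x with x | x
    · exact congrArg Sum.inl (he g x)
    · exact congrArg Sum.inr (hf g x)⟩⟩

instance : Mul (BurnsideSemiring G) :=
  ⟨Quotient.map₂ FinGSet.prod fun _ _ ⟨e, he⟩ _ _ ⟨f, hf⟩ => ⟨Equiv.prodCongr e f, fun g x =>
    Prod.ext (he g x.1) (hf g x.2)⟩⟩

instance : Zero (BurnsideSemiring G) := ⟨mk (FinGSet.triv G PEmpty)⟩

instance : One (BurnsideSemiring G) := ⟨mk (FinGSet.triv G PUnit)⟩

theorem mk_add (X Y : FinGSet G) : mk X + mk Y = mk (X.sum Y) := rfl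

theorem mk_mul (X Y : FinGSet G) : mk X * mk Y = mk (X.prod Y) := rfl

instance : CommSemiring (BurnsideSemiring G) where
  add_assoc a b c := by
    induction a using Quotient.inductionOn; induction b using Quotient.inductionOn
    induction c using Quotient.inductionOn
    refine mk_eq (Equiv.sumAssoc _ _ _) fun g x => ?_
    rcases x with (x | x) | x <;> rfl
  zero_add a := by
    induction a using Quotient.inductionOn
    refine mk_eq (Equiv.emptySum PEmpty _) fun g x => ?_
    rcases x with x | x
    · exact x.elim
    · rfl
  add_zero a := by
    induction a using Quotient.inductionOn
    refine mk_eq (Equiv.sumEmpty _ PEmpty) fun g x => ?_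
    rcases x with x | x
    · rfl
    · exact x.elim
  add_comm a b := by
    induction a using Quotient.inductionOn; induction b using Quotient.inductionOn
    refine mk_eq (Equiv.sumComm _ _) fun g x => ?_
    rcases x with x | x <;> rfl
  left_distrib a b c := by
    induction a using Quotient.inductionOn; induction b using Quotient.inductionOn
    induction c using Quotient.inductionOn
    refine mk_eq (Equiv.prodSumDistrib _ _ _) fun g x => ?_
    rcases x with ⟨x, y | y⟩ <;> rfl
  right_distrib a b c := by
    induction a using Quotient.inductionOn; induction b using Quotient.inductionOn
    induction c using Quotient.inductionOn
    refine mk_eq (Equiv.sumProdDistrib _ _ _) fun g x => ?_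
    rcases x with ⟨x | x, y⟩ <;> rfl
  zero_mul a := by
    induction a using Quotient.inductionOn
    exact mk_eq (Equiv.pemptyProd _) fun g x => x.1.elim
  mul_zero a := by
    induction a using Quotient.inductionOn
    exact mk_eq (Equiv.prodPEmpty _) fun g x => x.2.elim
  mul_assoc a b c := by
    induction a using Quotient.inductionOn; induction b using Quotient.inductionOn
    induction c using Quotient.inductionOn
    exact mk_eq (Equiv.prodAssoc _ _ _) fun g x => rfl
  one_mul a := by
    induction a using Quotient.inductionOn
    exact mk_eq (Equiv.punitProd _) fun g x => rfl
  mul_one a := by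
    induction a using Quotient.inductionOn
    exact mk_eq (Equiv.prodPUnit _) fun g x => rfl
  mul_comm a b := by
    induction a using Quotient.inductionOn; induction b using Quotient.inductionOn
    exact mk_eq (Equiv.prodComm _ _) fun g x => rfl
  nsmul := nsmulRec

theorem mk_sub_insert (X : FinGSet G) {ι : Type v} [DecidableEq ι] (p : X → ι)
    (hp : ∀ (g : G) (x : X), p (g • x) = p x) (s : Finset ι) :
    mk (X.sub (fun x => p x ∈ s) fun g x h => by rwa [hp]) =
      ∑ i ∈ s, mk (X.sub (fun x => p x = i) fun g x h => by rwa [hp]) := by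
  classical
  induction s using Finset.induction_on with
  | empty =>
    rw [Finset.sum_empty]
    have : IsEmpty (X.sub (fun x => p x ∈ (∅ : Finset ι)) fun g x h => by rwa [hp]) :=
      ⟨fun x => Finset.notMem_empty _ x.2⟩
    exact mk_eq (Y := FinGSet.triv G PEmpty) (Equiv.equivPEmpty _) fun g x => isEmptyElim x
  | insert a s ha ih =>
    rw [Finset.sum_insert ha, ← ih, mk_add]
    symm
    refine mk_eq (X := FinGSet.sum _ _) (Y := FinGSet.sub _ _ _) (Equiv.ofBijective 
      (Sum.elim (fun x => ⟨x.1, by simp [x.2]⟩) (fun x => ⟨x.1, by simp [x.2]⟩)) ⟨?_, ?_⟩) ?_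
    · rintro (⟨x, hx⟩ | ⟨x, hx⟩) (⟨y, hy⟩ | ⟨y, hy⟩) h <;>
        have h' : x = y := congrArg Subtype.val h
      · subst h'; rfl
      · subst h'; exact absurd (hx ▸ hy) ha
      · subst h'; exact absurd (hy ▸ hx) ha
      · subst h'; rfl
    · rintro ⟨x, hx⟩
      rcases Finset.mem_insert.mp hx with h | h
      · exact ⟨Sum.inl ⟨x, h⟩, rfl⟩
      · exact ⟨Sum.inr ⟨x, h⟩, rfl⟩
    · rintro g (x | x) <;> rfl

end BurnsideSemiring

/-- The Burnside ring of `G`: formal differences of isomorphism classes of finite `G`-sets. -/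
def Burnside (G : Type u) [Group G] : Type (u + 1) := GrothendieckAddGroup (BurnsideSemiring G)

namespace Burnside

variable {G : Type u} [Group G]

noncomputable instance : CommRing (Burnside G) := grothendieckCommRing (BurnsideSemiring G)

/-- The class of a finite `G`-set in the Burnside ring. -/
noncomputable def of (X : FinGSet G) : Burnside G := GrothendieckAddGroup.of (BurnsideSemiring.mk X)

end Burnside

section ChangeOfGroup

variable {L H : Type u} [Group L] [Group H] (φ : L →* H)

namespace FinGSet

/-- Pullback of the action along a group homomorphism. -/
def pull (Y : FinGSet H) : FinGSet L :=
  letI : MulAction L Y := MulAction.compHom Y φ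
  ⟨Y⟩

/-- The relation `(h φ(l), x) ~ (h, l x)` on `H × X`. -/
def indSetoid (X : FinGSet L) : Setoid (H × X) where
  r p q := ∃ l : L, q = (p.1 * (φ l)⁻¹, l • p.2)
  iseqv :=
    { refl := fun p => ⟨1, by simp⟩
      symm := fun {p q} ⟨l, hl⟩ => ⟨l⁻¹, by simp [hl]⟩
      trans := fun {p q r} ⟨l, hl⟩ ⟨m, hm⟩ => ⟨m * l, by simp [hl, hm, mul_assoc, mul_smul]⟩ }

/-- The induced set `H ×_L X`. -/
def ind [Finite H] (X : FinGSet L) : FinGSet H :=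
  letI : MulAction H (Quotient (indSetoid φ X)) :=
    { smul := fun h => Quotient.map (fun p => (h * p.1, p.2)) fun p q ⟨l, hl⟩ =>
        ⟨l, by simp [hl, mul_assoc]⟩
      one_smul := fun q => by
        induction q using Quotient.inductionOn with
        | _ p => exact congrArg (Quotient.mk _) (Prod.ext (one_mul p.1) rfl)
      mul_smul := fun g h q => by
        induction q using Quotient.inductionOn with
        | _ p => exact congrArg (Quotient.mk _) (Prod.ext (mul_assoc g h p.1) rfl) }
  ⟨Quotient (indSetoid φ X)⟩

/-- The coinduced set `Map_L(H, X)`, where `h` acts by `f ↦ f (· h)`. -/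
def coind [Finite H] (X : FinGSet L) : FinGSet H :=
  letI : MulAction H {f : H → X // ∀ (l : L) (h : H), f (φ l * h) = l • f h} :=
    { smul := fun k f => ⟨fun h => f.1 (h * k), fun l h => by
        change f.1 (φ l * h * k) = l • f.1 (h * k)
        rw [mul_assoc, f.2]⟩
      one_smul := fun f => Subtype.ext (funext fun h => congrArg f.1 (mul_one h))
      mul_smul := fun k m f => Subtype.ext (funext fun h => congrArg f.1 (mul_assoc h k m).symm) }
  ⟨{f : H → X // ∀ (l : L) (h : H), f (φ l * h) = l • f h}⟩

end FinGSet

namespace BurnsideSemiring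

/-- Pullback of actions, on isomorphism classes. -/
def pull : BurnsideSemiring H →+* BurnsideSemiring L where
  toFun := Quotient.map (FinGSet.pull φ) fun _ _ ⟨e, he⟩ => ⟨e, fun l x => he (φ l) x⟩
  map_zero' := rfl
  map_one' := rfl
  map_add' a b := by
    induction a using Quotient.inductionOn; induction b using Quotient.inductionOn
    refine mk_eq (Equiv.refl _) fun g x => ?_
    rcases x with x | x <;> rfl
  map_mul' a b := by
    induction a using Quotient.inductionOn; induction b using Quotient.inductionOn
    exact mk_eq (Equiv.refl _) fun g x => rfl

/-- Induction `X ↦ H ×_L X`, on isomorphism classes. -/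
def ind [Finite H] : BurnsideSemiring L →+ BurnsideSemiring H where
  toFun := Quotient.map (FinGSet.ind φ) fun X Y ⟨e, he⟩ =>
    ⟨Quotient.congr (Equiv.prodCongr (Equiv.refl H) e) fun p q => by
      constructor
      · rintro ⟨l, rfl⟩
        exact ⟨l, by simp [he]⟩
      · rintro ⟨l, hl⟩
        refine ⟨l, ?_⟩
        apply (Equiv.prodCongr (Equiv.refl H) e).injective
        rw [hl]; simp [he], fun h q => by
      induction q using Quotient.inductionOn; rfl⟩
  map_zero' := by
    have : IsEmpty (FinGSet.ind φ (FinGSet.triv L PEmpty.{u + 1})) :=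
      ⟨fun q => Quotient.inductionOn q fun p => p.2.elim⟩
    exact mk_eq (Y := FinGSet.triv H PEmpty) (Equiv.equivPEmpty _) fun g x => isEmptyElim x
  map_add' a b := by
    induction a using Quotient.inductionOn with | _ X
    induction b using Quotient.inductionOn with | _ Y
    symm
    refine mk_eq (X := FinGSet.sum _ _) (Y := FinGSet.ind φ (FinGSet.sum X Y)) (Equiv.ofBijective
      (Sum.elim
        (Quotient.map (fun p => (p.1, Sum.inl p.2)) fun p q ⟨l, hl⟩ => ⟨l, by rw [hl]; rfl⟩)
        (Quotient.map (fun p => (p.1, Sum.inr p.2)) fun p q ⟨l, hl⟩ => ⟨l, by rw [hl]; rfl⟩))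
      ⟨?_, ?_⟩) ?_
    · rintro (p | p) (q | q) h <;> induction p using Quotient.inductionOn with | _ p <;>
        induction q using Quotient.inductionOn with | _ q <;> obtain ⟨l, hl⟩ := Quotient.exact h
      · refine congrArg Sum.inl (Quotient.sound ⟨l, Prod.ext (congrArg Prod.fst hl :) ?_⟩)
        exact Sum.inl_injective (congrArg Prod.snd hl :)
      · exact absurd (congrArg Prod.snd hl) Sum.inr_ne_inl
      · exact absurd (congrArg Prod.snd hl) Sum.inl_ne_inr
      · refine congrArg Sum.inr (Quotient.sound ⟨l, Prod.ext (congrArg Prod.fst hl :) ?_⟩)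
        exact Sum.inr_injective (congrArg Prod.snd hl)
    · intro q
      induction q using Quotient.inductionOn with | _ p
      obtain ⟨h, x | x⟩ := p
      · exact ⟨Sum.inl (Quotient.mk _ (h, x)), rfl⟩
      · exact ⟨Sum.inr (Quotient.mk _ (h, x)), rfl⟩
    · rintro h (q | q) <;> induction q using Quotient.inductionOn <;> rfl

/-- Coinduction `X ↦ Map_L(H, X)`, on isomorphism classes. -/
def coind [Finite H] : BurnsideSemiring L → BurnsideSemiring H :=
  Quotient.map (FinGSet.coind φ) fun X Y ⟨e, he⟩ =>
    ⟨(Equiv.arrowCongr (Equiv.refl H) e).subtypeEquiv fun f => by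
      constructor
      · intro hf l h
        change e (f (φ l * h)) = l • e (f h)
        rw [hf, he]
      · intro hf l h
        apply e.injective
        rw [he]
        exact hf l h, fun k f => rfl⟩

theorem coind_mk_sub [Finite H] {ι : Type} [DecidableEq ι] (W : FinGSet L) (p : W → ι)
    (hp : ∀ (l : L) (w : W), p (l • w) = p w) :
    ∃ m : Finset ι → BurnsideSemiring H, (∀ T : Finset ι, Nat.card H < T.card → m T = 0) ∧
      ∀ s : Finset ι, coind φ (mk (W.sub (fun w => p w ∈ s) fun l w h => by rwa [hp])) =
        ∑ T ∈ s.powerset, m T := by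
  classical
  have := Fintype.ofFinite H
  let q : FinGSet.coind φ W → Finset ι := fun f => Finset.univ.image fun h => p (f.1 h)
  have hq : ∀ (k : H) (f : FinGSet.coind φ W), q (k • f) = q f := fun k f => by
    ext i
    simp only [q, Finset.mem_image, Finset.mem_univ, true_and]
    constructor
    · rintro ⟨h, rfl⟩
      exact ⟨h * k, rfl⟩
    · rintro ⟨h, rfl⟩
      refine ⟨h * k⁻¹, ?_⟩
      change p (f.1 (h * k⁻¹ * k)) = _
      rw [inv_mul_cancel_right]
  refine ⟨fun T => mk ((FinGSet.coind φ W).sub (fun f => q f = T) fun k f h => by rwa [hq]),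
    fun T hT => ?_, fun s => ?_⟩
  · have : IsEmpty ((FinGSet.coind φ W).sub (fun f => q f = T) fun k f h => by rwa [hq]) := by
      refine ⟨fun f => ?_⟩
      have h1 : q f.1 = T := f.2
      have h2 : (q f.1).card ≤ Nat.card H := by
        rw [Nat.card_eq_fintype_card]
        exact Finset.card_image_le
      rw [h1] at h2
      omega
    exact mk_eq (Y := FinGSet.triv H PEmpty) (Equiv.equivPEmpty _) fun g x => isEmptyElim x
  · rw [← mk_sub_insert (FinGSet.coind φ W) q hq s.powerset]
    have key : ∀ f : FinGSet.coind φ W, q f ∈ s.powerset ↔ ∀ h, p (f.1 h) ∈ s := fun f => by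
      simp [q, Finset.mem_powerset, Finset.image_subset_iff]
    exact mk_eq
      (X := FinGSet.coind φ (W.sub (fun w => p w ∈ s) fun l w h => by rwa [hp]))
      (Y := FinGSet.sub _ _ _)
      { toFun := fun f => ⟨⟨fun h => (f.1 h).1, fun l h => congrArg Subtype.val (f.2 l h)⟩,
          (key _).2 fun h => (f.1 h).2⟩
        invFun := fun f => ⟨fun h => ⟨f.1.1 h, (key f.1).1 f.2 h⟩,
          fun l h => Subtype.ext (f.1.2 l h)⟩
        left_inv := fun f => rfl
        right_inv := fun f => rfl } fun k f => rfl

theorem mk_labelled (X Y : FinGSet L) (D : ℕ) :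
    ∃ (W : FinGSet L) (p : W → Option (Fin D)) (hp : ∀ (l : L) (w : W), p (l • w) = p w),
      ∀ S : Finset (Fin D), mk X + S.card • mk Y =
        mk (W.sub (fun w => p w ∈ Finset.insertNone S) fun l w h => by rwa [hp]) := by
  classical
  let W := X.sum (Y.prod (FinGSet.triv L (ULift.{u} (Fin D))))
  let p : W → Option (Fin D) := Sum.elim (fun _ => none) fun y => some y.2.down
  have hp : ∀ (l : L) (w : W), p (l • w) = p w := by
    rintro l (w | w) <;> rfl
  refine ⟨W, p, hp, fun S => ?_⟩
  rw [mk_sub_insert W p hp, Finset.sum_insertNone, Finset.sum_congr rfl (g := fun _ => mk Y),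
    Finset.sum_const]
  · congr 1
    refine mk_eq (Y := FinGSet.sub _ _ _) (Equiv.ofBijective
      (fun x => ⟨Sum.inl x, rfl⟩) ⟨?_, ?_⟩) fun g x => rfl
    · intro x y h
      exact Sum.inl_injective (congrArg Subtype.val h)
    · rintro ⟨x | x, hx⟩
      · exact ⟨x, rfl⟩
      · exact absurd hx (Option.some_ne_none _)
  · intro i _
    symm
    refine mk_eq (Y := FinGSet.sub _ _ _) (Equiv.ofBijective
      (fun y => ⟨Sum.inr (y, ⟨i⟩), rfl⟩) ⟨?_, ?_⟩) fun g x => rfl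
    · intro x y h
      exact congrArg Prod.fst (Sum.inr_injective (congrArg Subtype.val h))
    · rintro ⟨x | ⟨x, ⟨j⟩⟩, hx⟩
      · exact absurd hx.symm (Option.some_ne_none _)
      · obtain rfl : j = i := Option.some_injective _ hx
        exact ⟨x, rfl⟩

end BurnsideSemiring

theorem coind_diffVanish [Finite H] : DiffVanish (Nat.card H + 1) fun x : BurnsideSemiring L =>
    (GrothendieckAddGroup.of (BurnsideSemiring.coind φ x) :
      GrothendieckAddGroup (BurnsideSemiring H)) := by
  classical
  intro x y
  induction x using Quotient.inductionOn with | _ X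
  induction y using Quotient.inductionOn with | _ Y
  set D := Nat.card H + 1 with hD
  obtain ⟨W, p, hp, hW⟩ := BurnsideSemiring.mk_labelled X Y D
  obtain ⟨m, hm0, hm⟩ := BurnsideSemiring.coind_mk_sub φ W p hp
  have h1 := Finset.sum_powerset_apply_card (x := (Finset.univ : Finset (Fin D)))
    (fun k => (-1 : ℤ) ^ k • (GrothendieckAddGroup.of (BurnsideSemiring.coind φ
      (BurnsideSemiring.mk X + k • BurnsideSemiring.mk Y)) :
        GrothendieckAddGroup (BurnsideSemiring H)))
  rw [Finset.card_univ, Fintype.card_fin] at h1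
  have h2 : ∀ k, ((-1 : ℤ) ^ k * D.choose k) • (GrothendieckAddGroup.of (BurnsideSemiring.coind φ
      (BurnsideSemiring.mk X + k • BurnsideSemiring.mk Y)) :
        GrothendieckAddGroup (BurnsideSemiring H)) = D.choose k • (-1 : ℤ) ^ k •
      (GrothendieckAddGroup.of (BurnsideSemiring.coind φ
      (BurnsideSemiring.mk X + k • BurnsideSemiring.mk Y)) :
        GrothendieckAddGroup (BurnsideSemiring H)) := fun k => by
    rw [← natCast_zsmul, smul_smul, mul_comm]
  refine (Finset.sum_congr rfl fun k _ => h2 k).trans (h1.symm.trans ?_)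
  have h3 : ∀ S : Finset (Fin D), (-1 : ℤ) ^ S.card • (GrothendieckAddGroup.of
      (BurnsideSemiring.coind φ (BurnsideSemiring.mk X + S.card • BurnsideSemiring.mk Y)) :
        GrothendieckAddGroup (BurnsideSemiring H)) =
      ∑ T : Finset (Option (Fin D)), (if T ⊆ Finset.insertNone S then (-1 : ℤ) ^ S.card else 0) •
        GrothendieckAddGroup.of (m T) := fun S => by
    rw [hW S, hm, map_sum, Finset.smul_sum]
    simp only [ite_smul, zero_smul]
    rw [← Finset.sum_filter]
    refine Finset.sum_congr ?_ fun _ _ => rfl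
    ext T; simp
  rw [Finset.sum_congr rfl fun S _ => h3 S, Finset.sum_comm]
  refine Finset.sum_eq_zero fun T _ => ?_
  rw [← Finset.sum_smul]
  by_cases hT : ∃ a : Fin D, some a ∉ T
  · obtain ⟨a, ha⟩ := hT
    convert zero_smul ℤ _
    have hiff : ∀ S : Finset (Fin D), a ∉ S →
        (T ⊆ Finset.insertNone (insert a S) ↔ T ⊆ Finset.insertNone S) := fun S hS => by
      constructor
      · intro h o ho
        have := h ho
        rcases o with _ | b
        · simp
        · simp only [Finset.some_mem_insertNone, Finset.mem_insert] at this ⊢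
          rcases this with rfl | h
          · exact absurd ho ha
          · exact h
      · exact fun h => h.trans (Finset.insertNone.monotone (Finset.subset_insert a S))
    have hu : (Finset.univ : Finset (Fin D)) = insert a (Finset.univ.erase a) := by simp
    rw [hu, Finset.sum_powerset_insert (Finset.notMem_erase a _), ← Finset.sum_add_distrib]
    refine Finset.sum_eq_zero fun S hS => ?_
    have haS : a ∉ S := fun h => Finset.notMem_erase a _ (Finset.mem_powerset.mp hS h)
    simp only [hiff S haS, Finset.card_insert_of_notMem haS, pow_succ]
    split_ifs <;> simp
  · push Not at hT
    rw [hm0 T, map_zero, smul_zero]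
    have hsub : (Finset.univ : Finset (Fin D)).map ⟨some, Option.some_injective _⟩ ⊆ T := by
      intro o ho
      obtain ⟨a, -, rfl⟩ := Finset.mem_map.mp ho
      exact hT a
    have := Finset.card_le_card hsub
    rw [Finset.card_map, Finset.card_univ, Fintype.card_fin] at this
    omega

namespace Burnside

/-- Pullback of actions along a group homomorphism, as a ring homomorphism of Burnside rings. -/
noncomputable def pull : Burnside H →+* Burnside L where
  toFun := GrothendieckAddGroup.lift
    (GrothendieckAddGroup.of.comp (BurnsideSemiring.pull φ).toAddMonoidHom)
  map_zero' := map_zero _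
  map_add' := map_add _
  map_one' := by
    refine (grothendieck_lift_of _ _).trans ?_
    exact congrArg GrothendieckAddGroup.of (map_one (BurnsideSemiring.pull φ))
  map_mul' a b := by
    obtain ⟨x, y, rfl⟩ := grothendieck_exists_rep a
    obtain ⟨z, t, rfl⟩ := grothendieck_exists_rep b
    change GrothendieckAddGroup.lift _ (grothendieckMul _ _ _) = grothendieckMul _ _ _
    simp only [map_sub, AddMonoidHom.sub_apply, grothendieckMul_of, grothendieck_lift_of,
      AddMonoidHom.comp_apply, RingHom.toAddMonoidHom_eq_coe, AddMonoidHom.coe_coe, map_mul]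

/-- Induction `X ↦ H ×_L X`, extended additively to virtual sets. -/
noncomputable def ind [Finite H] : Burnside L →+ Burnside H :=
  GrothendieckAddGroup.lift (GrothendieckAddGroup.of.comp (BurnsideSemiring.ind φ))

/-- Coinduction `X ↦ Map_L(H, X)`, extended to virtual sets as a polynomial map. -/
noncomputable def coind [Finite H] : Burnside L → Burnside H :=
  extendPolynomial (Nat.card H + 1) _ (coind_diffVanish φ)

end Burnside

end ChangeOfGroup

/-- Restriction from `H` to a subgroup `L`. -/
noncomputable def burnsideRes {G : Type u} [Group G] {L H : Subgroup G} (h : L ≤ H) :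
    Burnside H →+* Burnside L := Burnside.pull (Subgroup.inclusion h)

/-- Transfer `X ↦ H ×_L X` from a subgroup `L` to `H`. -/
noncomputable def burnsideTr {G : Type u} [Group G] [Finite G] {L H : Subgroup G} (h : L ≤ H) :
    Burnside L →+ Burnside H := Burnside.ind (Subgroup.inclusion h)

/-- Norm `X ↦ Map_L(H, X)` from a subgroup `L` to `H`. -/
noncomputable def burnsideNorm {G : Type u} [Group G] [Finite G] {L H : Subgroup G} (h : L ≤ H) :
    Burnside L → Burnside H := Burnside.coind (Subgroup.inclusion h)

/-- Conjugation: an `H`-set is regarded as a `g H g⁻¹`-set through `k ↦ g⁻¹ k g`. -/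
noncomputable def burnsideConj {G : Type u} [Group G] (g : G) (H : Subgroup G) :
    Burnside H →+* Burnside (H.map (MulAut.conj g).toMonoidHom) :=
  Burnside.pull ((MulAut.conj g).subgroupMap H).symm.toMonoidHom

/-- An ideal of the Burnside Tambara functor `H ↦ A(H)` of a finite group `G`. -/
structure TambaraIdeal (G : Type u) [Group G] [Finite G] where
  level : ∀ H : Subgroup G, Ideal (Burnside H)
  res_mem : ∀ {L H : Subgroup G} (h : L ≤ H) (a : Burnside H), a ∈ level H → burnsideRes h a ∈ level L
  tr_mem : ∀ {L H : Subgroup G} (h : L ≤ H) (a : Burnside L), a ∈ level L → burnsideTr h a ∈ level H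
  norm_mem : ∀ {L H : Subgroup G} (h : L ≤ H) (a : Burnside L), a ∈ level L →
    burnsideNorm h a - burnsideNorm h 0 ∈ level H
  conj_mem : ∀ (g : G) (H : Subgroup G) (a : Burnside H), a ∈ level H →
    burnsideConj g H a ∈ level (H.map (MulAut.conj g).toMonoidHom)

/-- The Tambara ideal generated by a set of elements of various levels: the intersection of all
Tambara ideals that contain the set. -/
noncomputable def TambaraIdeal.generated {G : Type u} [Group G] [Finite G]
    (S : Set (Σ H : Subgroup G, Burnside H)) : TambaraIdeal G where
  level H := ⨅ I : {I : TambaraIdeal G // ∀ s ∈ S, s.2 ∈ I.level s.1}, I.1.level H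
  res_mem h a ha := by
    simp only [Submodule.mem_iInf] at ha ⊢
    exact fun I => I.1.res_mem h a (ha I)
  tr_mem h a ha := by
    simp only [Submodule.mem_iInf] at ha ⊢
    exact fun I => I.1.tr_mem h a (ha I)
  norm_mem h a ha := by
    simp only [Submodule.mem_iInf] at ha ⊢
    exact fun I => I.1.norm_mem h a (ha I)
  conj_mem g H a ha := by
    simp only [Submodule.mem_iInf] at ha ⊢
    exact fun I => I.1.conj_mem g H a (ha I)

/-- Regular (nondegenerate) quadratic forms over `k`, on finite-dimensional vector spaces. -/
structure RegForm (k : Type u) [Field k] : Type (u + 1) where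
  (V : Type u)
  [addCommGroup : AddCommGroup V]
  [module : Module k V]
  [finite : FiniteDimensional k V]
  (form : QuadraticForm k V)
  (regular : ∀ v : V, (∀ w : V, QuadraticMap.polar form v w = 0) → v = 0)

namespace RegForm

attribute [instance] RegForm.addCommGroup RegForm.module RegForm.finite

/-- Isometry of quadratic forms. -/
instance setoid (k : Type u) [Field k] : Setoid (RegForm k) where
  r q r := q.form.Equivalent r.form
  iseqv := ⟨fun q => .refl q.form, fun h => h.symm, fun h h' => h.trans h'⟩

variable {k l : Type u} [Field k] [Field l]

/-- The zero form. -/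
def zero (k : Type u) [Field k] : RegForm k := ⟨PUnit, 0, fun _ _ => rfl⟩

/-- The orthogonal sum. -/
def sum (q r : RegForm k) : RegForm k where
  V := q.V × r.V
  form := q.form.prod r.form
  regular v hv := Prod.ext
    (q.regular v.1 fun w => by simpa using hv (w, 0))
    (r.regular v.2 fun w => by simpa using hv (0, w))

/-- The unary form `⟨a⟩ : x ↦ a x ^ 2`. -/
def unary [NeZero (2 : k)] (a : kˣ) : RegForm k where
  V := k
  form := (a : k) • QuadraticMap.sq
  regular v hv := by
    have h := hv 1
    have h2 : QuadraticMap.polar ((a : k) • QuadraticMap.sq : QuadraticForm k k) v 1 =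
        2 * (a * v) := by
      simp only [QuadraticMap.polar, _root_.smul_apply, QuadraticMap.sq_apply, smul_eq_mul]
      ring
    rw [h2] at h
    simpa [NeZero.ne] using h

/-- The Scharlau transfer `q ↦ tr_{l/k} ∘ q` along the field trace. -/
noncomputable def transfer (k : Type u) [Field k] [Algebra k l] [FiniteDimensional k l]
    [Algebra.IsSeparable k l] (q : RegForm l) : RegForm k :=
  letI : Module k q.V := Module.restrictScalars k l q.V
  haveI : IsScalarTower k l q.V := IsScalarTower.restrictScalars k l q.V
  { V := q.V
    finite := Module.Finite.trans (R := k) l q.V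
    form := (Algebra.trace k l).compQuadraticMap' q.form
    regular := fun v hv => by
      refine q.regular v fun w => ?_
      by_contra hc
      obtain ⟨z, hz⟩ := Algebra.trace_surjective k l 1
      have h := hv ((z / QuadraticMap.polar q.form v w) • w)
      rw [LinearMap.compQuadraticMap_polar, QuadraticMap.polar_smul_right, smul_eq_mul,
        div_mul_cancel₀ _ hc, hz] at h
      exact one_ne_zero h }

end RegForm

/-- The monoid of isometry classes of regular quadratic forms, under orthogonal sum. -/
def FormClasses (k : Type u) [Field k] : Type (u + 1) := Quotient (RegForm.setoid k)

namespace FormClasses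

variable {k l : Type u} [Field k] [Field l]

/-- The isometry class of a form. -/
def mk (q : RegForm k) : FormClasses k := Quotient.mk _ q

theorem mk_eq {q r : RegForm k} (e : q.form.IsometryEquiv r.form) : mk q = mk r :=
  Quotient.sound ⟨e⟩

instance : Add (FormClasses k) :=
  ⟨Quotient.map₂ RegForm.sum fun _ _ h _ _ h' => QuadraticMap.Equivalent.prod h h'⟩

instance : Zero (FormClasses k) := ⟨mk (RegForm.zero k)⟩

instance : AddCommMonoid (FormClasses k) where
  add_assoc a b c := by
    induction a using Quotient.inductionOn; induction b using Quotient.inductionOn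
    induction c using Quotient.inductionOn
    exact mk_eq { LinearEquiv.prodAssoc k _ _ _ with
      map_app' := fun x => (add_assoc _ _ _).symm }
  zero_add a := by
    induction a using Quotient.inductionOn with | _ q
    exact mk_eq (q := (RegForm.zero k).sum q) { (LinearEquiv.uniqueProd : (PUnit.{u + 1} × q.V) ≃ₗ[k] q.V) with
      map_app' := fun x => (zero_add _).symm }
  add_zero a := by
    induction a using Quotient.inductionOn with | _ q
    exact mk_eq (q := q.sum (RegForm.zero k)) { (LinearEquiv.prodUnique : (q.V × PUnit.{u + 1}) ≃ₗ[k] q.V) with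
      map_app' := fun x => (add_zero _).symm }
  add_comm a b := by
    induction a using Quotient.inductionOn; induction b using Quotient.inductionOn
    exact mk_eq (QuadraticMap.IsometryEquiv.prodComm _ _)
  nsmul := nsmulRec

/-- The Scharlau transfer on isometry classes. -/
noncomputable def transfer (k : Type u) {l : Type u} [Field k] [Field l] [Algebra k l]
    [FiniteDimensional k l] [Algebra.IsSeparable k l] : FormClasses l →+ FormClasses k where
  toFun := Quotient.map (RegForm.transfer k) fun q r ⟨e⟩ =>
    ⟨{ toFun := e
       invFun := e.symm
       left_inv := e.symm_apply_apply
       right_inv := e.apply_symm_apply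
       map_add' := map_add e.toLinearEquiv
       map_smul' := fun c (v : q.V) => map_smul e.toLinearEquiv (algebraMap k l c) v
       map_app' := fun v => congrArg (Algebra.trace k l) (e.map_app v) }⟩
  map_zero' := mk_eq (q := RegForm.transfer k (RegForm.zero l)) (r := RegForm.zero k)
    { toFun := id
      invFun := id
      left_inv := fun _ => rfl
      right_inv := fun _ => rfl
      map_add' := fun _ _ => rfl
      map_smul' := fun _ _ => rfl
      map_app' := fun v => (map_zero (Algebra.trace k l)).symm }
  map_add' a b := by
    induction a using Quotient.inductionOn with | _ q
    induction b using Quotient.inductionOn with | _ r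
    exact mk_eq (q := RegForm.transfer k (q.sum r))
      (r := (RegForm.transfer k q).sum (RegForm.transfer k r))
      { toFun := id
        invFun := id
        left_inv := fun _ => rfl
        right_inv := fun _ => rfl
        map_add' := fun _ _ => rfl
        map_smul' := fun _ _ => rfl
        map_app' := fun v => (map_add (Algebra.trace k l) (q.form v.1) (r.form v.2)).symm }

end FormClasses

/-- The (additive group of the) Grothendieck-Witt ring of `k`: formal differences of isometry
classes of regular quadratic forms. -/
abbrev GW (k : Type u) [Field k] : Type (u + 1) := GrothendieckAddGroup (FormClasses k)

namespace GW

/-- The class of the unary form `⟨a⟩`. -/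
def unary {k : Type u} [Field k] [NeZero (2 : k)] (a : kˣ) : GW k :=
  GrothendieckAddGroup.of (FormClasses.mk (RegForm.unary a))

/-- The Scharlau transfer along the field trace of `l / k`. -/
noncomputable def transfer (k : Type u) {l : Type u} [Field k] [Field l] [Algebra k l]
    [FiniteDimensional k l] [Algebra.IsSeparable k l] : GW l →+ GW k :=
  GrothendieckAddGroup.lift (GrothendieckAddGroup.of.comp (FormClasses.transfer k))

end GW

section Dress

variable {F : Type v} {K : Type u} [Field F] [Field K] [Algebra F K]

instance neZero_two [NeZero (2 : F)] (E : IntermediateField F K) : NeZero (2 : E) :=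
  ⟨fun h => NeZero.ne (2 : F) ((algebraMap F E).injective (by rw [map_ofNat, h, map_zero]))⟩

variable [FiniteDimensional F K] [IsGalois F K]

/-- The Scharlau transfer `GW(E') → GW(E)` for intermediate fields `E ≤ E'` of `K / F`. -/
noncomputable def fieldTransfer {E E' : IntermediateField F K} (h : E ≤ E') : GW E' →+ GW E :=
  letI : Algebra E E' := (IntermediateField.inclusion h).toRingHom.toAlgebra
  haveI : IsScalarTower F E E' := IsScalarTower.of_algebraMap_eq fun _ => rfl
  haveI : FiniteDimensional E E' := FiniteDimensional.right F E E'
  haveI : Algebra.IsSeparable E E' := Algebra.isSeparable_tower_top_of_isSeparable F E E'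
  GW.transfer E

theorem fieldTransfer_one_conj [NeZero (2 : F)] {B E E' : IntermediateField F K} (h : B ≤ E)
    (h' : B ≤ E') (σ : Gal(K/F)) (hB : ∀ b ∈ B, σ b = b) (hE : E.map (σ : K →ₐ[F] K) = E') :
    fieldTransfer h (GW.unary 1) = fieldTransfer h' (GW.unary 1) := by
  subst hE
  let _ : Algebra B E := (IntermediateField.inclusion h).toRingHom.toAlgebra
  let _ : Algebra B (E.map (σ : K →ₐ[F] K)) := (IntermediateField.inclusion h').toRingHom.toAlgebra
  have : IsScalarTower F B E := IsScalarTower.of_algebraMap_eq fun _ => rfl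
  have : IsScalarTower F B (E.map (σ : K →ₐ[F] K)) := IsScalarTower.of_algebraMap_eq fun _ => rfl
  have : FiniteDimensional B E := FiniteDimensional.right F B E
  have : FiniteDimensional B (E.map (σ : K →ₐ[F] K)) := FiniteDimensional.right F B _
  have : Algebra.IsSeparable B E := Algebra.isSeparable_tower_top_of_isSeparable F B E
  have : Algebra.IsSeparable B (E.map (σ : K →ₐ[F] K)) :=
    Algebra.isSeparable_tower_top_of_isSeparable F B _
  let e : E ≃ₐ[B] (E.map (σ : K →ₐ[F] K)) :=
    { IntermediateField.intermediateFieldMap σ E with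
      commutes' := fun b => Subtype.ext (hB b.1 b.2) }
  change GW.transfer B (l := E) (GW.unary 1) =
    GW.transfer B (l := (E.map (σ : K →ₐ[F] K))) (GW.unary 1)
  rw [GW.transfer, GW.transfer, GW.unary, GW.unary, grothendieck_lift_of, grothendieck_lift_of]
  refine congrArg GrothendieckAddGroup.of (FormClasses.mk_eq (q := RegForm.transfer B _)
    (r := RegForm.transfer B _)
    { toFun := e
      invFun := e.symm
      left_inv := e.symm_apply_apply
      right_inv := e.apply_symm_apply
      map_add' := map_add e
      map_smul' := fun c (v : E) => by
        have h1 : e (c • v : E) = c • e v := map_smul e c v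
        exact (congrArg e (Algebra.smul_def c (v : E))).symm.trans
          (h1.trans (Algebra.smul_def c (e v)))
      map_app' := fun (v : E) => ?_ })
  have h2 : ∀ (E₁ : IntermediateField F K) (w : E₁),
      (RegForm.unary (1 : E₁ˣ)).form w = w * w := fun E₁ w => one_mul (w * w)
  exact (congrArg (Algebra.trace B _) ((h2 _ (e v)).trans (map_mul e v v).symm)).trans
    ((Algebra.trace_eq_of_algEquiv e (v * v)).trans (congrArg (Algebra.trace B E) (h2 _ v).symm))

variable [NeZero (2 : F)]

/-- The trace form `tr_{K^L / K^H} ⟨1⟩` of `K^L` over `K^H`, for a subgroup `L` of `H`. -/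
noncomputable def levelTraceForm (H : Subgroup Gal(K/F)) (L : Subgroup H) :
    GW (IntermediateField.fixedField H) :=
  fieldTransfer (IntermediateField.fixedField_le (Subgroup.map_subtype_le L)) (GW.unary 1)

theorem levelTraceForm_conj (H : Subgroup Gal(K/F)) (L : Subgroup H) (g : H) :
    levelTraceForm H (L.map (MulAut.conj g).toMonoidHom) = levelTraceForm H L := by
  symm
  refine fieldTransfer_one_conj _ _ (g : Gal(K/F)) (fun b hb => ?_) ?_
  · exact (IntermediateField.mem_fixedField_iff _ _).1 hb g.1 g.2
  · ext x
    rw [IntermediateField.mem_map, IntermediateField.mem_fixedField_iff]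
    constructor
    · rintro ⟨y, hy, rfl⟩ f hf
      rw [IntermediateField.mem_fixedField_iff] at hy
      obtain ⟨_, ⟨l, hl, rfl⟩, rfl⟩ := hf
      have := hy l.1 ⟨l, hl, rfl⟩
      simp [AlgEquiv.mul_apply, this]
    · intro hx
      refine ⟨(g : Gal(K/F)).symm x, ?_, by simp⟩
      rw [IntermediateField.mem_fixedField_iff]
      rintro _ ⟨l, hl, rfl⟩
      have := hx _ ⟨_, ⟨l, hl, rfl⟩, rfl⟩
      have h1 : (g : Gal(K/F)) ((l : Gal(K/F)) ((g : Gal(K/F)).symm x)) = x := this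
      exact (AlgEquiv.eq_symm_apply _).2 h1

theorem levelTraceForm_stabilizer (H : Subgroup Gal(K/F)) (X : FinGSet H) {x y : X}
    (h : MulAction.orbitRel H X x y) :
    levelTraceForm H (MulAction.stabilizer H x) = levelTraceForm H (MulAction.stabilizer H y) := by
  obtain ⟨g, rfl⟩ := h
  rw [MulAction.stabilizer_smul_eq_stabilizer_map_conj]
  exact levelTraceForm_conj H _ g

/-- The Dress map on finite `H`-sets: the sum over the orbits `H / L` of the trace forms
`tr_{K^L / K^H} ⟨1⟩`. -/
noncomputable def dressSet (H : Subgroup Gal(K/F)) (X : FinGSet H) :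
    GW (IntermediateField.fixedField H) :=
  ∑ᶠ ω : MulAction.orbitRel.Quotient H X, levelTraceForm H (MulAction.stabilizer H ω.out)

theorem dressSet_eq (H : Subgroup Gal(K/F)) (X : FinGSet H) {ι : Type u} [Finite ι] (s : ι → X)
    (hs : Function.Bijective fun i => (Quotient.mk (MulAction.orbitRel H X) (s i))) :
    dressSet H X = ∑ᶠ i, levelTraceForm H (MulAction.stabilizer H (s i)) := by
  rw [dressSet, ← finsum_comp_equiv (Equiv.ofBijective _ hs)]
  refine finsum_congr fun i => levelTraceForm_stabilizer H X ?_
  exact Quotient.exact (Quotient.out_eq _)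

theorem dressSet_congr (H : Subgroup Gal(K/F)) {X Y : FinGSet H} (e : X ≃ Y)
    (he : ∀ (g : H) (x : X), e (g • x) = g • e x) : dressSet H X = dressSet H Y := by
  rw [dressSet_eq H Y (fun ω : MulAction.orbitRel.Quotient H X => e ω.out) ⟨?_, ?_⟩, dressSet]
  · refine finsum_congr fun ω => ?_
    congr 1
    ext g
    rw [MulAction.mem_stabilizer_iff, MulAction.mem_stabilizer_iff, ← he, e.apply_eq_iff_eq]
  · intro a b h
    obtain ⟨g, hg⟩ := Quotient.exact h
    have h1 : g • b.out = a.out := e.injective ((he _ _).trans hg)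
    rw [← Quotient.out_eq a, ← Quotient.out_eq b]
    exact Quotient.sound ⟨g, h1⟩
  · intro y
    induction y using Quotient.inductionOn with | _ y
    refine ⟨Quotient.mk _ (e.symm y), Quotient.sound ?_⟩
    obtain ⟨g, hg⟩ := Quotient.exact
      (Quotient.out_eq (Quotient.mk (MulAction.orbitRel H X) (e.symm y)))
    refine ⟨g, ?_⟩
    have h1 : g • e.symm y = _ := hg
    change g • y = e _
    rw [← h1, he, e.apply_symm_apply]

theorem dressSet_sum (H : Subgroup Gal(K/F)) (X Y : FinGSet H) :
    dressSet H (X.sum Y) = dressSet H X + dressSet H Y := by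
  classical
  let s : MulAction.orbitRel.Quotient H X ⊕ MulAction.orbitRel.Quotient H Y → X.sum Y :=
    Sum.map Quotient.out Quotient.out
  rw [dressSet_eq H (X.sum Y) s ⟨?_, ?_⟩, dressSet, dressSet]
  · have := Fintype.ofFinite (MulAction.orbitRel.Quotient H X)
    have := Fintype.ofFinite (MulAction.orbitRel.Quotient H Y)
    rw [finsum_eq_sum_of_fintype, finsum_eq_sum_of_fintype, finsum_eq_sum_of_fintype,
      Fintype.sum_sum_type]
    congr 1
    · refine Finset.sum_congr rfl fun ω _ => ?_
      congr 1
      ext g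
      exact Sum.inl_injective.eq_iff
    · refine Finset.sum_congr rfl fun ω _ => ?_
      congr 1
      ext g
      exact Sum.inr_injective.eq_iff
  · rintro (a | a) (b | b) h <;> obtain ⟨g, hg⟩ := Quotient.exact h
    · congr 1
      rw [← Quotient.out_eq a, ← Quotient.out_eq b]
      exact Quotient.sound ⟨g, Sum.inl_injective hg⟩
    · exact absurd hg Sum.inr_ne_inl
    · exact absurd hg Sum.inl_ne_inr
    · congr 1
      rw [← Quotient.out_eq a, ← Quotient.out_eq b]
      exact Quotient.sound ⟨g, Sum.inr_injective hg⟩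
  · intro z
    induction z using Quotient.inductionOn with | _ z
    rcases z with x | y
    · refine ⟨Sum.inl (Quotient.mk _ x), Quotient.sound ?_⟩
      obtain ⟨g, hg⟩ := Quotient.exact (Quotient.out_eq (Quotient.mk (MulAction.orbitRel H X) x))
      exact ⟨g, congrArg Sum.inl hg⟩
    · refine ⟨Sum.inr (Quotient.mk _ y), Quotient.sound ?_⟩
      obtain ⟨g, hg⟩ := Quotient.exact (Quotient.out_eq (Quotient.mk (MulAction.orbitRel H Y) y))
      exact ⟨g, congrArg Sum.inr hg⟩

/-- The Dress map `A(H) → GW(K^H)`: the additive extension to virtual sets of the map that sends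
the transitive set `H / L` to the trace form of `K^L` over `K^H`. -/
noncomputable def dress (H : Subgroup Gal(K/F)) :
    Burnside H →+ GW (IntermediateField.fixedField H) :=
  GrothendieckAddGroup.lift
    { toFun := Quotient.lift (dressSet H) fun _ _ ⟨e, he⟩ => dressSet_congr H e he
      map_zero' := by
        have : IsEmpty (MulAction.orbitRel.Quotient H (FinGSet.triv H PEmpty.{u + 1})) :=
          ⟨fun ω => ω.out.elim⟩
        exact finsum_of_isEmpty _
      map_add' := fun a b => by
        induction a using Quotient.inductionOn with | _ X
        induction b using Quotient.inductionOn with | _ Y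
        exact dressSet_sum H X Y }

theorem dress_quot (H : Subgroup Gal(K/F)) (L : Subgroup H) :
    dress H (Burnside.of (FinGSet.quot L)) = levelTraceForm H L := by
  refine (grothendieck_lift_of _ _).trans ?_
  change dressSet H (FinGSet.quot L) = _
  rw [dressSet_eq H (FinGSet.quot L) (fun _ : PUnit.{u + 1} => ((1 : H) : H ⧸ L)) ⟨?_, ?_⟩]
  · rw [finsum_unique]
    congr 1
    exact MulAction.stabilizer_quotient L
  · intro a b _; rfl
  · intro y
    induction y using Quotient.inductionOn with | _ y
    obtain ⟨g, hg⟩ := MulAction.exists_smul_eq H (α := H ⧸ L) y ((1 : H) : H ⧸ L)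
    exact ⟨PUnit.unit, Quotient.sound ⟨g, hg⟩⟩

variable (F K) in
/-- The trace ideal: the kernel of the Dress map, level by level. -/
def traceIdeal (H : Subgroup Gal(K/F)) : Set (Burnside H) := {a | dress H a = 0}

end Dress

/-- In a cyclic group of order `2 ^ n`, the subgroup `C_{2^i}` of order `2 ^ i` (for `i ≤ n`). -/
def cyc (G : Type u) [Group G] (i : ℕ) : Subgroup G := Subgroup.closure {g : G | g ^ 2 ^ i = 1}

theorem cyc_mono (G : Type u) [Group G] {i j : ℕ} (h : i ≤ j) : cyc G i ≤ cyc G j :=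
  Subgroup.closure_mono fun g (hg : g ^ 2 ^ i = 1) => by
    obtain ⟨c, hc⟩ := pow_dvd_pow 2 h
    change g ^ 2 ^ j = 1
    rw [hc, pow_mul, hg, one_pow]

/-- The element `t_{2^i, 2^j}` of `A(C_{2^i})`, for `j ≤ i`: the class of the transitive
`C_{2^i}`-set `C_{2^i} / C_{2^{i-j}}` of cardinality `2 ^ j`. -/
noncomputable def tset {G : Type u} [Group G] [Finite G] (i j : ℕ) : Burnside (cyc G i) :=
  Burnside.of (FinGSet.quot ((cyc G (i - j)).subgroupOf (cyc G i)))

/-- `α` is a sum of `m` squares in `k`. -/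
def IsSumOfSquares {k : Type u} [Field k] (m : ℕ) (α : k) : Prop :=
  ∃ v : Fin m → k, α = ∑ i, v i ^ 2

open Classical in
/-- The least power of `2` such that `α` is a sum of that many squares in `k`, and `0` if `α` is
not a sum of squares. -/
noncomputable def tau {k : Type u} [Field k] (α : k) : ℕ :=
  if h : ∃ r : ℕ, IsSumOfSquares (2 ^ r) α then 2 ^ Nat.find h else 0

/-- The extension `l / k` embeds into a cyclic Galois extension of `k` of degree `d`. -/
def EmbedsInCyclic (k l : Type u) [Field k] [Field l] [Algebra k l] (d : ℕ) : Prop :=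
  ∃ (M : Type u) (_ : Field M) (_ : Algebra k M) (_ : Algebra l M) (_ : IsScalarTower k l M),
    IsGalois k M ∧ IsCyclic Gal(M/k) ∧ Module.finrank k M = d

section

variable (F : Type v) (K : Type u) [Field F] [Field K] [Algebra F K]

/-- The fixed field of `C_{2^i}`. -/
abbrev levelField (i : ℕ) : IntermediateField F K := IntermediateField.fixedField (cyc Gal(K/F) i)

theorem levelField_anti {i j : ℕ} (h : i ≤ j) : levelField F K j ≤ levelField F K i :=
  IntermediateField.fixedField_le (cyc_mono _ h)

/-- With `E = K^{C_2}` and `L = K^{C_4}`: a presentation `E = L(√Δ)` with `Δ = a ^ 2 + b ^ 2` in `L`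
and `K = E(√δ)` with `δ = x (Δ + a √Δ)` for some `x` in `L`. -/
structure QuarticPresentation where
  (a b : levelField F K 2)
  (Δ x : (levelField F K 2)ˣ)
  (sqrtΔ : K)
  (δ : levelField F K 1)
  (sqrtδ : K)
  Δ_eq : (Δ : levelField F K 2) = a ^ 2 + b ^ 2
  sqrtΔ_sq : sqrtΔ ^ 2 = ((Δ : levelField F K 2) : K)
  E_eq : levelField F K 1 = levelField F K 2 ⊔ IntermediateField.adjoin F {sqrtΔ}
  δ_eq : (δ : K) = ((x : levelField F K 2) : K) * (((Δ : levelField F K 2) : K) + (a : K) * sqrtΔ)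
  sqrtδ_sq : sqrtδ ^ 2 = (δ : K)
  K_eq : ⊤ = levelField F K 1 ⊔ IntermediateField.adjoin F {sqrtδ}

variable [FiniteDimensional F K] [IsGalois F K] [NeZero (2 : F)]

/-- The trace ideal of `K / F` is the Tambara ideal generated by `S`. -/
def TraceIdealGeneratedBy (S : Set (Σ H : Subgroup Gal(K/F), Burnside H)) : Prop :=
  ∀ H : Subgroup Gal(K/F), traceIdeal F K H = ((TambaraIdeal.generated S).level H : Set (Burnside H))

/-- The additive order (`0` if infinite) of `tr_{K / K^{C_{2^i}}} ⟨1⟩ - 2 ^ i ⟨1⟩`. -/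
noncomputable def traceOrder (i : ℕ) : ℕ :=
  haveI : NeZero (2 : K) :=
    ⟨fun h => NeZero.ne (2 : F) ((algebraMap F K).injective (by rw [map_ofNat, h, map_zero]))⟩
  addOrderOf (GW.transfer (levelField F K i) (GW.unary (1 : Kˣ)) -
    2 ^ i • GW.unary (1 : (levelField F K i)ˣ))

variable {F K} in
/-- `tr_{L / K^{C_{2^m}}} (⟨Δ, x, x⟩ - ⟨2, 2Δ, 1⟩) = 0` in `GW(K^{C_{2^m}})`, where `L = K^{C_4}`
and `2 ≤ m`. -/
def QuarticPresentation.TransferVanishes (P : QuarticPresentation F K) (m : ℕ) : Prop :=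
  let two : (levelField F K 2)ˣ := Units.mk0 2 (NeZero.ne 2)
  ∃ h : 2 ≤ m, fieldTransfer (levelField_anti F K h)
    ((GW.unary P.Δ + GW.unary P.x + GW.unary P.x) -
      (GW.unary two + GW.unary (two * P.Δ) + GW.unary 1)) = 0

end


end TraceIdeal

open TraceIdeal

/-!
# The trace ideal of a cyclic `2`-extension

The Dress maps commute with restrictions and transfers, so the matter is to find additive
generators of their kernels and to express them through each other by norms, transfers and
restrictions.

*Trace forms.* Let `C` be the subgroup of order `2 ^ k` and `B` its fixed field. The quartic level
over `B` is generated by `√Δ` and `√(x (Δ + a √Δ))`, where `Δ = a ^ 2 + b ^ 2`, and the trace forms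
of the quadratic and of the quartic level are `T₁ = ⟨2⟩ + ⟨2Δ⟩` and `T₂ = ⟨1⟩ + ⟨Δ⟩ + 2⟨x⟩`. If the
quartic extension lies in a cyclic octic one, generated by some `η` such that a generator `ρ`
satisfies `ρ ^ 4 η = -η`, then the norm of `η ^ 2 + (ρ ^ 2 η) ^ 2` down to `B` is represented by
`⟨2, 2Δ⟩`, `⟨1, -Δ⟩` and `⟨x, x⟩`, which gives `T₂ = T₁ + 2⟨1⟩`
(`GW.quartic_eq_of_neg_eigenvector`). Conversely, by Witt cancellation this equality provides a
common value of these forms, hence `ε` and `y` with `ρ ε = y ^ 2 ε` and `y` of norm `-1`, and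
adjoining `√ε` gives a cyclic octic extension (`exists_of_quartic_eq`,
`embedsInCyclic_of_apply_eq`). So `[C / C_{2^i}] - [C / C_{2^(i+1)}] - 2`, for `k = i + 2`, is in
the trace ideal for all `i ≥ 1`, and for `i = 0` exactly if `K` embeds into a cyclic octic
extension. As `2` and `Δ` are sums of two squares, `2 T₁ = 4⟨1⟩` as well.

*Orders.* The discriminant of the trace form of `K` over `B` is not a square, because the
determinant of the conjugates of a basis is negated by a generator of the group
(`GW.discr_transfer_unary_one_ne_zero`); thus the order of its difference with `2 ^ k ⟨1⟩` is not
`1`. Over `K^{C_2}` the form is `⟨2⟩ + ⟨2δ⟩`. If `δ` is a sum of `2 ^ r` squares, then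
`2 ^ r ⟨δ⟩ = 2 ^ r ⟨1⟩`, as sums of `2 ^ r` squares are similarity factors of `2 ^ r ⟨1⟩`;
conversely, a multiple of the difference vanishes only if `δ` is a value of some `m⟨1⟩`
(`isSumSq_of_nsmul_eq`). Transfer and base change compare the orders at neighbouring levels.

*Kernels.* By rank and discriminant, the kernel of the Dress map of `C` is spanned by the transfers
of the quartic relations, by `2 [C / C_{2^(k-1)}] - 4`, by the multiple of `[C / 1] - 2 ^ k` given
by the order of the trace form, and by `[C / 1] - [C / C_{2^(k-1)}] - 2 ^ k + 2` when it is in the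
kernel (`mem_of_dress_eq_zero`). A virtual set is determined by its marks, and for each spanning
element the norm to the next level is computed by marks to be a combination of elements of the
kernel, such as `norm_quarticRel`. Since norms of index `2` are quadratic with the transfer of the
product as cross term, the kernels form a Tambara ideal (`dress_norm_eq_zero`).

*Generators.* Norms of the first quartic relation give all the later ones, and its restriction and
the transfers of that give `2 [C / C_{2^(k-1)}] - 4`. Modulo these,
`[C / 1] - [C / C_{2^(k-1)}] - 2 ^ k + 2` agrees with `[C / 1] - [C / C_2] - 2 [C / C_4]`
(`regularRel_sub_bottomRel_mem_level`), a transfer from `C_4` whose image under the Dress map is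
the transfer of `⟨Δ, x, x⟩ - ⟨2, 2Δ, 1⟩`. This leaves the three cases: the relation holds already
at `C_4`, and everything follows from it; `δ` is not a sum of squares, and neither this relation
nor a nonzero multiple of `[C / 1] - 2 ^ k` is ever in the kernel; or the relation enters at its
own level, along with the orders of the trace forms (`traceIdealGeneratedBy_of_forall`).
-/

namespace TraceIdeal
open Algebra

/-! ### Classes of quadratic forms -/

section Forms

variable {k : Type u} [Field k]

theorem RegForm.sum_form_apply (q r : RegForm k) (z : (q.sum r).V) :
    (q.sum r).form z = q.form z.1 + r.form z.2 := rfl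

theorem GW.of_mk_add (q r : RegForm k) :
    (GrothendieckAddGroup.of (FormClasses.mk (q.sum r)) : GW k) =
      GrothendieckAddGroup.of (FormClasses.mk q) + GrothendieckAddGroup.of (FormClasses.mk r) :=
  map_add GrothendieckAddGroup.of (FormClasses.mk q) (FormClasses.mk r)

/-- The diagonal form `⟨w₀, …, wₙ₋₁⟩`. -/
def RegForm.diag [NeZero (2 : k)] {n : ℕ} (w : Fin n → kˣ) : RegForm k where
  V := Fin n → k
  form := QuadraticMap.weightedSumSquares k w
  regular v hv := by
    funext i
    have h := hv (Pi.single i 1)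
    have h2 : QuadraticMap.polar (QuadraticMap.weightedSumSquares k w) v (Pi.single i 1) =
        2 * (w i * v i) := by
      simp only [QuadraticMap.polar, QuadraticMap.weightedSumSquares_apply]
      rw [← Finset.sum_sub_distrib, ← Finset.sum_sub_distrib, Finset.sum_eq_single i]
      · simp only [Pi.add_apply, Pi.single_eq_same, Units.smul_def, smul_eq_mul]; ring
      · intro j _ hj
        simp [Pi.single_eq_of_ne hj]
      · simp
    rw [h2] at h
    simpa [NeZero.ne] using h

theorem RegForm.diag_form_apply [NeZero (2 : k)] {n : ℕ} (w : Fin n → kˣ) (v : Fin n → k) :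
    (RegForm.diag w).form v = ∑ i, (w i : k) * (v i * v i) :=
  QuadraticMap.weightedSumSquares_apply w v

theorem FormClasses.mk_diag [NeZero (2 : k)] {n : ℕ} (w : Fin n → kˣ) :
    FormClasses.mk (RegForm.diag w) = ∑ i, FormClasses.mk (RegForm.unary (w i)) := by
  induction n with
  | zero =>
    rw [Fin.sum_univ_zero]
    exact FormClasses.mk_eq (q := RegForm.diag w) (r := RegForm.zero k)
      { toFun := fun _ => PUnit.unit
        invFun := fun _ => 0
        left_inv := fun _ => Subsingleton.elim (α := Fin 0 → k) _ _
        right_inv := fun _ => rfl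
        map_add' := fun _ _ => rfl
        map_smul' := fun _ _ => rfl
        map_app' := fun v => ((RegForm.diag_form_apply w v).trans (Fin.sum_univ_zero _)).symm }
  | succ n ih =>
    rw [Fin.sum_univ_succ, ← ih fun i => w i.succ]
    exact FormClasses.mk_eq (q := RegForm.diag w)
      (r := (RegForm.unary (w 0)).sum (RegForm.diag fun i => w i.succ))
      { (Fin.consLinearEquiv k fun _ : Fin (n + 1) => k).symm with
        map_app' := fun v => (congrArg (fun z => (w 0 : k) * (v 0 * v 0) + z)
          (RegForm.diag_form_apply (fun i => w (Fin.succ i)) fun i => v (Fin.succ i))).trans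
            ((RegForm.diag_form_apply w v).trans (Fin.sum_univ_succ _)).symm }

/-- A form with an orthogonal basis is the sum of the unary forms of its values on the basis. -/
theorem FormClasses.mk_eq_sum_of_basis [NeZero (2 : k)] (q : RegForm k) {n : ℕ}
    (b : Module.Basis (Fin n) k q.V) (w : Fin n → kˣ)
    (hb : ∀ i j, i ≠ j → QuadraticMap.polar q.form (b i) (b j) = 0)
    (hw : ∀ i, q.form (b i) = w i) :
    FormClasses.mk q = ∑ i, FormClasses.mk (RegForm.unary (w i)) := by
  rw [← FormClasses.mk_diag]
  refine FormClasses.mk_eq (r := RegForm.diag w) { b.equivFun with map_app' := fun v => ?_ }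
  refine (RegForm.diag_form_apply w (b.equivFun v)).trans ?_
  conv_rhs => rw [← b.sum_equivFun v]
  rw [QuadraticMap.map_sum]
  rw [Finset.sum_eq_zero (s := Finset.filter _ _), add_zero]
  · refine Finset.sum_congr rfl fun i _ => ?_
    rw [QuadraticMap.map_smul, hw, smul_eq_mul, mul_comm]
  · intro ij hij
    rw [Finset.mem_filter] at hij
    induction ij using Sym2.ind with | _ i j
    have hne : i ≠ j := fun h => hij.2 (by simp [h])
    change QuadraticMap.polar q.form (b.equivFun v i • b i) (b.equivFun v j • b j) = 0
    rw [QuadraticMap.polar_smul_left, QuadraticMap.polar_smul_right, hb i j hne, smul_zero,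
      smul_zero]

theorem RegForm.exists_orthogonal_basis [NeZero (2 : k)] (q : RegForm k) :
    ∃ (n : ℕ) (b : Module.Basis (Fin n) k q.V) (w : Fin n → kˣ),
      (∀ i j, i ≠ j → QuadraticMap.polar q.form (b i) (b j) = 0) ∧ ∀ i, q.form (b i) = w i := by
  let _ : Invertible (2 : k) := invertibleOfNonzero (NeZero.ne 2)
  have hp : ∀ x y, QuadraticMap.polar q.form x y =
      2 * (QuadraticMap.associated (R := k) q.form) x y := fun x y => by
    rw [QuadraticMap.associated_apply]
    simp only [QuadraticMap.polar, Module.End.smul_def, QuadraticMap.half_moduleEnd_apply_eq_half_smul,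
      smul_eq_mul, invOf_eq_inv]
    rw [mul_inv_cancel_left₀ (NeZero.ne 2)]
  have hQ : (QuadraticMap.associated (R := k) q.form).SeparatingLeft := fun x hx =>
    q.regular x fun y => by rw [hp, hx, mul_zero]
  obtain ⟨b, hb⟩ := LinearMap.BilinForm.exists_orthogonal_basis
    (QuadraticForm.associated_isSymm k q.form)
  have hb2 := hb.not_isOrtho_basis_self_of_separatingLeft hQ
  simp_rw [QuadraticMap.associated_eq_self_apply] at hb2
  refine ⟨_, b, fun i => Units.mk0 _ (hb2 i), fun i j hij => ?_, fun i => rfl⟩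
  rw [hp, hb hij, mul_zero]

theorem FormClasses.exists_eq_sum_unary [NeZero (2 : k)] (x : FormClasses k) :
    ∃ (n : ℕ) (w : Fin n → kˣ), x = ∑ i, FormClasses.mk (RegForm.unary (w i)) := by
  induction x using Quotient.inductionOn with | _ q
  obtain ⟨n, b, w, hb, hw⟩ := q.exists_orthogonal_basis
  exact ⟨n, w, FormClasses.mk_eq_sum_of_basis q b w hb hw⟩

theorem GW.of_mk_eq_sum_of_basis [NeZero (2 : k)] (q : RegForm k) {n : ℕ}
    (b : Module.Basis (Fin n) k q.V) (w : Fin n → kˣ)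
    (hb : ∀ i j, i ≠ j → QuadraticMap.polar q.form (b i) (b j) = 0)
    (hw : ∀ i, q.form (b i) = w i) :
    (GrothendieckAddGroup.of (FormClasses.mk q) : GW k) = ∑ i, GW.unary (w i) := by
  rw [FormClasses.mk_eq_sum_of_basis q b w hb hw, map_sum]
  rfl

/-- A binary form with two orthogonal anisotropic vectors. -/
theorem GW.of_mk_eq_of_pair [NeZero (2 : k)] (q : RegForm k) (hq : Module.finrank k q.V = 2)
    (v₁ v₂ : q.V) (a b : kˣ) (ha : q.form v₁ = a) (hb : q.form v₂ = b)
    (hab : QuadraticMap.polar q.form v₁ v₂ = 0) :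
    (GrothendieckAddGroup.of (FormClasses.mk q) : GW k) = GW.unary a + GW.unary b := by
  have h1 : QuadraticMap.polar q.form v₁ v₁ ≠ 0 := by
    rw [QuadraticMap.polar_self, ha, two_nsmul, ← two_mul]
    exact mul_ne_zero (NeZero.ne 2) a.ne_zero
  have h2 : QuadraticMap.polar q.form v₂ v₂ ≠ 0 := by
    rw [QuadraticMap.polar_self, hb, two_nsmul, ← two_mul]
    exact mul_ne_zero (NeZero.ne 2) b.ne_zero
  have hli : LinearIndependent k ![v₁, v₂] := by
    rw [LinearIndependent.pair_iff]
    intro s t hst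
    have e1 := congrArg (QuadraticMap.polar q.form v₁) hst
    have e2 := congrArg (QuadraticMap.polar q.form v₂) hst
    simp only [QuadraticMap.polar_add_right, QuadraticMap.polar_smul_right, hab,
      QuadraticMap.polar_comm q.form v₂ v₁, smul_eq_mul, mul_zero, add_zero, zero_add,
      QuadraticMap.polar_zero_right, mul_eq_zero, h1, h2, or_false] at e1 e2
    exact ⟨e1, e2⟩
  let B := basisOfLinearIndependentOfCardEqFinrank hli (by simp [hq])
  have hB : ∀ i, B i = ![v₁, v₂] i := fun i => by
    simp [B]
  rw [GW.of_mk_eq_sum_of_basis q B ![a, b], Fin.sum_univ_two]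
  · rfl
  · intro i j hij
    rw [hB, hB]
    fin_cases i <;> fin_cases j
    · exact absurd rfl hij
    · exact hab
    · rw [QuadraticMap.polar_comm]; exact hab
    · exact absurd rfl hij
  · intro i
    rw [hB]
    fin_cases i
    · exact ha
    · exact hb

section Unary

variable [NeZero (2 : k)]

theorem GW.unary_eq_of_sq {a b : kˣ} (c : kˣ) (h : (a : k) = b * c ^ 2) :
    GW.unary a = GW.unary b := by
  refine congrArg GrothendieckAddGroup.of (FormClasses.mk_eq (q := RegForm.unary a)
    (r := RegForm.unary b)
    { LinearEquiv.smulOfUnit c with map_app' := fun v => ?_ })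
  have key : ∀ z : k, (b : k) * ((c * z) * (c * z)) = a * (z * z) := fun z => by rw [h]; ring
  exact key v

/-- The relation `⟨a⟩ + ⟨b⟩ = ⟨a x² + b y²⟩ + ⟨a b (a x² + b y²)⟩`. -/
theorem GW.unary_add_unary {a b c : kˣ} (x y : k) (h : (c : k) = a * x ^ 2 + b * y ^ 2) :
    GW.unary a + GW.unary b = GW.unary c + GW.unary (a * b * c) := by
  refine (GW.of_mk_add _ _).symm.trans ?_
  refine GW.of_mk_eq_of_pair ((RegForm.unary a).sum (RegForm.unary b)) ?_
    ((x, y) : k × k) ((-(b * y), a * x) : k × k) _ _ ?_ ?_ ?_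
  · change Module.finrank k (k × k) = 2
    simp
  · change (a : k) * (x * x) + b * (y * y) = c
    rw [h]; ring
  · change (a : k) * (-(b * y) * -(b * y)) + b * (a * x * (a * x)) = ↑(a * b * c)
    push_cast
    rw [h]; ring
  · change ((a : k) * ((x + -(b * y)) * (x + -(b * y))) + b * ((y + a * x) * (y + a * x))) -
      (a * (x * x) + b * (y * y)) - (a * (-(b * y) * -(b * y)) + b * (a * x * (a * x))) = 0
    ring

/-- `⟨c, c⟩ = ⟨c d, c d⟩` for a nonzero sum `d` of two squares. -/
theorem GW.two_unary_mul {d : kˣ} (x y : k) (h : (d : k) = x ^ 2 + y ^ 2) (c : kˣ) :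
    GW.unary c + GW.unary c = GW.unary (c * d) + GW.unary (c * d) := by
  rw [GW.unary_add_unary (c := c * d) x y (by push_cast; rw [h]; ring)]
  congr 1
  exact GW.unary_eq_of_sq c (by push_cast; ring)

/-- If `d` is a sum of `2 ^ r` squares, then the form `2 ^ r ⟨1⟩` is similar to itself with
factor `d`. -/
theorem GW.two_pow_smul_unary_mul (r : ℕ) : ∀ (d : kˣ), IsSumOfSquares (2 ^ r) (d : k) →
    ∀ c : kˣ, 2 ^ r • GW.unary (c * d) = 2 ^ r • GW.unary c := by
  induction r with
  | zero =>
    rintro d ⟨v, hv⟩ c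
    have h : (d : k) = v 0 ^ 2 := by simpa using hv
    have h0 : v 0 ≠ 0 := fun h0 => d.ne_zero (by rw [h, h0]; simp)
    rw [GW.unary_eq_of_sq (a := c * d) (b := c) (Units.mk0 _ h0) (by push_cast; rw [h]; rfl)]
  | succ r ih =>
    rintro d ⟨v, hv⟩ c
    have e : 2 ^ (r + 1) = 2 ^ r + 2 ^ r := by ring
    let v' : Fin (2 ^ r + 2 ^ r) → k := fun i => v (Fin.cast e.symm i)
    have hv' : (d : k) = (∑ i, v' (Fin.castAdd _ i) ^ 2) + ∑ i, v' (Fin.natAdd _ i) ^ 2 := by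
      rw [hv, ← Fin.sum_univ_add fun i => v' i ^ 2]
      exact (Equiv.sum_comp (finCongr e.symm) fun i => v i ^ 2).symm
    set α := ∑ i, v' (Fin.castAdd (2 ^ r) i) ^ 2 with hα
    set β := ∑ i, v' (Fin.natAdd (2 ^ r) i) ^ 2 with hβ
    have key : ∀ (α β : k), (d : k) = α + β → IsSumOfSquares (2 ^ r) α → β = 0 →
        2 ^ (r + 1) • GW.unary (c * d) = 2 ^ (r + 1) • GW.unary c := by
      intro α β hd hα hβ
      rw [hβ, add_zero] at hd
      rw [pow_succ, mul_nsmul, mul_nsmul, ih d (hd ▸ hα) c]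
    by_cases hβ0 : β = 0
    · exact key α β hv' ⟨_, hα⟩ hβ0
    by_cases hα0 : α = 0
    · exact key β α (by rw [add_comm]; exact hv') ⟨_, hβ⟩ hα0
    have iα := fun c => ih (Units.mk0 α hα0) ⟨_, hα⟩ c
    have iβ := fun c => ih (Units.mk0 β hβ0) ⟨_, hβ⟩ c
    have h := GW.unary_add_unary (a := c * Units.mk0 α hα0) (b := c * Units.mk0 β hβ0) (c := c * d)
      1 1 (by push_cast; rw [hv']; simp; ring)
    have h' : GW.unary (c * Units.mk0 α hα0 * (c * Units.mk0 β hβ0) * (c * d)) =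
        GW.unary (c * d * Units.mk0 α hα0 * Units.mk0 β hβ0) :=
      GW.unary_eq_of_sq c (by push_cast; ring)
    rw [h'] at h
    have h2 := congrArg (fun z => 2 ^ r • z) h
    simp only [smul_add, iα, iβ] at h2
    rw [e, add_smul, add_smul, ← h2]

end Unary

end Forms

/-! ### Witt cancellation -/

section Witt

variable {k : Type u} [Field k]

/-- The reflection along an anisotropic vector is an isometry. -/
theorem exists_reflection {W : Type v} [AddCommGroup W] [Module k W] (Q : QuadraticForm k W) (v : W)
    (hv : Q v ≠ 0) : ∃ τ : W ≃ₗ[k] W, (∀ x, Q (τ x) = Q x) ∧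
      ∀ x, τ x = x - ((Q v)⁻¹ * QuadraticMap.polar Q v x) • v := by
  let f : Module.Dual k W := (Q v)⁻¹ • QuadraticMap.polarBilin Q v
  have hf : ∀ x, f x = (Q v)⁻¹ * QuadraticMap.polar Q v x := fun x => rfl
  have h2 : f v = 2 := by
    rw [hf, QuadraticMap.polar_self, two_nsmul, ← two_mul, mul_comm, mul_assoc, mul_inv_cancel₀ hv,
      mul_one]
  refine ⟨Module.reflection h2, fun x => ?_, fun x => by rw [Module.reflection_apply, hf]⟩
  rw [Module.reflection_apply]
  have h3 : Q (x - f x • v) = Q x + Q (-(f x • v)) + QuadraticMap.polar Q x (-(f x • v)) := by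
    rw [QuadraticMap.polar, sub_eq_add_neg]; ring
  rw [h3, QuadraticMap.map_neg, QuadraticMap.map_smul, QuadraticMap.polar_neg_right,
    QuadraticMap.polar_smul_right, QuadraticMap.polar_comm, smul_eq_mul, smul_eq_mul, hf]
  field_simp
  ring

/-- Vectors with the same nonzero value are exchanged by an isometry: the reflection in `u - w`, or
the negative of the reflection in `u + w`, depending on which of the two vectors is anisotropic. -/
theorem exists_isometry_of_map_eq [NeZero (2 : k)] {W : Type v} [AddCommGroup W] [Module k W]
    (Q : QuadraticForm k W) {u w : W} (h : Q u = Q w) (hw : Q w ≠ 0) :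
    ∃ τ : W ≃ₗ[k] W, (∀ x, Q (τ x) = Q x) ∧ τ u = w := by
  have hs : Q (u - w) = 2 * Q w - QuadraticMap.polar Q u w := by
    have := QuadraticMap.polar_neg_right Q u w
    rw [QuadraticMap.polar, QuadraticMap.map_neg, ← sub_eq_add_neg] at this
    linear_combination this + h
  have ha : Q (u + w) = 2 * Q w + QuadraticMap.polar Q u w := by
    rw [QuadraticMap.polar]
    linear_combination h
  have hu : QuadraticMap.polar Q u u = 2 * Q w := by
    rw [QuadraticMap.polar_self, two_nsmul, h, two_mul]
  by_cases h0 : Q (u - w) = 0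
  · have h1 : Q (u + w) ≠ 0 := by
      have : Q (u + w) = 2 * (2 * Q w) := by linear_combination ha + hs - h0
      rw [this]
      exact mul_ne_zero (NeZero.ne 2) (mul_ne_zero (NeZero.ne 2) hw)
    obtain ⟨τ, hτ, hτ'⟩ := exists_reflection Q (u + w) h1
    refine ⟨τ.trans (LinearEquiv.neg k), fun x => ?_, ?_⟩
    · change Q (-(τ x)) = Q x
      rw [QuadraticMap.map_neg, hτ]
    · change -(τ u) = w
      rw [hτ', QuadraticMap.polar_add_left, QuadraticMap.polar_comm Q w, hu, ← ha,
        inv_mul_cancel₀ h1, one_smul]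
      abel
  · obtain ⟨τ, hτ, hτ'⟩ := exists_reflection Q (u - w) h0
    refine ⟨τ, hτ, ?_⟩
    rw [hτ', QuadraticMap.polar_sub_left, QuadraticMap.polar_comm Q w, hu, ← hs,
      inv_mul_cancel₀ h0, one_smul]
    abel

theorem isometryEquiv_polar {V W : Type*} [AddCommGroup V] [Module k V] [AddCommGroup W] [Module k W]
    {Q : QuadraticForm k V} {Q' : QuadraticForm k W} (e : Q.IsometryEquiv Q') (x y : V) :
    QuadraticMap.polar Q' (e x) (e y) = QuadraticMap.polar Q x y := by
  have h : e (x + y) = e x + e y := map_add e.toLinearEquiv x y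
  rw [QuadraticMap.polar, ← h, e.map_app, e.map_app, e.map_app, QuadraticMap.polar]

/-- An isometry that fixes the first basis vector preserves its orthogonal complement. -/
theorem RegForm.sum_unary_cancel_aux [NeZero (2 : k)] (a : kˣ) (q r : RegForm k)
    (e : ((RegForm.unary a).sum q).form.IsometryEquiv ((RegForm.unary a).sum r).form)
    (he : e ((1, 0) : k × q.V) = ((1, 0) : k × r.V)) (v : q.V) :
    e ((0, v) : k × q.V) = ((0, (e ((0, v) : k × q.V)).2) : k × r.V) := by
  have hp : QuadraticMap.polar ((RegForm.unary a).sum r).form (e ((1, 0) : k × q.V))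
      (e ((0, v) : k × q.V)) = 0 := by
    have h1 : QuadraticMap.polar ((RegForm.unary a).sum q).form ((1, 0) : k × q.V)
        ((0, v) : k × q.V) = 0 := by
      have h2 := QuadraticMap.polar_prod (RegForm.unary a).form q.form ((1, 0) : k × q.V)
        ((0, v) : k × q.V)
      refine h2.trans ?_
      change QuadraticMap.polar (RegForm.unary a).form (1 : k) (0 : k) +
        QuadraticMap.polar q.form 0 v = 0
      rw [QuadraticMap.polar_zero_left]
      refine (add_zero _).trans ?_
      exact QuadraticMap.polar_zero_right _ _
    exact (isometryEquiv_polar e _ _).trans h1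
  rw [he] at hp
  set z := e ((0, v) : k × q.V) with hz
  have h2 := (QuadraticMap.polar_prod (RegForm.unary a).form r.form ((1, 0) : k × r.V) z).symm.trans hp
  have h3 : QuadraticMap.polar r.form ((1, 0) : k × r.V).2 z.2 = 0 :=
    QuadraticMap.polar_zero_left r.form _
  rw [h3, add_zero] at h2
  have h4 : ∀ s : k, QuadraticMap.polar (RegForm.unary a).form (1 : k) s = 2 * (a * s) := fun s => by
    change (a : k) * ((1 + s) * (1 + s)) - a * (1 * 1) - a * (s * s) = _
    ring
  have h5 := (h4 z.1).symm.trans h2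
  have h6 : (z.1 : k) = 0 := by
    rcases mul_eq_zero.1 h5 with h | h
    · exact absurd h (NeZero.ne 2)
    · exact (mul_eq_zero.1 h).resolve_left a.ne_zero
  exact Prod.ext h6 rfl

/-- Witt cancellation of a form of rank one: after a reflection, the isometry fixes the vector that
spans the summand. -/
theorem RegForm.sum_unary_cancel [NeZero (2 : k)] (a : kˣ) (q r : RegForm k)
    (h : ((RegForm.unary a).sum q).form.Equivalent ((RegForm.unary a).sum r).form) :
    q.form.Equivalent r.form := by
  obtain ⟨e₀⟩ := h
  have h1 : ∀ q : RegForm k, ((RegForm.unary a).sum q).form ((1, 0) : k × q.V) = a := fun q => by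
    change (a : k) * (1 * 1) + q.form 0 = a
    rw [QuadraticMap.map_zero]; ring
  obtain ⟨τ, hτ, hτ1⟩ := exists_isometry_of_map_eq ((RegForm.unary a).sum r).form
    (u := e₀ ((1, 0) : k × q.V)) (w := ((1, 0) : k × r.V))
    ((e₀.map_app _).trans ((h1 q).trans (h1 r).symm)) (by rw [h1]; exact a.ne_zero)
  let e : ((RegForm.unary a).sum q).form.IsometryEquiv ((RegForm.unary a).sum r).form :=
    { e₀.toLinearEquiv.trans τ with map_app' := fun v => (hτ _).trans (e₀.map_app v) }
  have he : e ((1, 0) : k × q.V) = ((1, 0) : k × r.V) := hτ1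
  have he' : e.symm ((1, 0) : k × r.V) = ((1, 0) : k × q.V) := by
    rw [← he]; exact e.symm_apply_apply _
  have k1 := RegForm.sum_unary_cancel_aux a q r e he
  have k2 := RegForm.sum_unary_cancel_aux a r q e.symm he'
  let e' : (k × q.V) ≃ₗ[k] k × r.V := e.toLinearEquiv
  let f : q.V →ₗ[k] r.V := LinearMap.snd k k r.V ∘ₗ e'.toLinearMap ∘ₗ LinearMap.inr k k q.V
  let g : r.V →ₗ[k] q.V := LinearMap.snd k k q.V ∘ₗ e'.symm.toLinearMap ∘ₗ LinearMap.inr k k r.V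
  have hfg : ∀ v, f (g v) = v := fun v => by
    change (e ((0, (e.symm ((0, v) : k × r.V)).2) : k × q.V)).2 = v
    rw [← k2 v]
    exact congrArg Prod.snd (e.apply_symm_apply ((0, v) : k × r.V))
  have hgf : ∀ v, g (f v) = v := fun v => by
    change (e.symm ((0, (e ((0, v) : k × q.V)).2) : k × r.V)).2 = v
    rw [← k1 v]
    exact congrArg Prod.snd (e.symm_apply_apply ((0, v) : k × q.V))
  refine ⟨{ f with
    invFun := g
    left_inv := hgf
    right_inv := hfg
    map_app' := fun v => ?_ }⟩
  have h3 := e.map_app ((0, v) : k × q.V)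
  rw [k1 v] at h3
  have h4 : ∀ (q : RegForm k) (v : q.V), ((RegForm.unary a).sum q).form ((0, v) : k × q.V) =
      q.form v := fun q v => by
    change (a : k) * (0 * 0) + q.form v = _
    ring
  rw [h4] at h3
  exact h3.trans (h4 q v)

/-- Witt cancellation. It makes the map from classes of forms to `GW k` injective. -/
theorem FormClasses.add_left_cancel [NeZero (2 : k)] (c x y : FormClasses k) (h : c + x = c + y) :
    x = y := by
  obtain ⟨n, w, rfl⟩ := FormClasses.exists_eq_sum_unary c
  induction n with
  | zero => simpa using h
  | succ n ih =>
    rw [Fin.sum_univ_succ, add_assoc, add_assoc] at h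
    refine ih (fun i => w i.succ) ?_
    revert h
    generalize (∑ i : Fin n, mk (RegForm.unary (w i.succ))) + x = x'
    generalize (∑ i : Fin n, mk (RegForm.unary (w i.succ))) + y = y'
    induction x' using Quotient.inductionOn with | _ q
    induction y' using Quotient.inductionOn with | _ r
    intro h
    exact Quotient.sound (RegForm.sum_unary_cancel _ _ _ (Quotient.exact h))

instance [NeZero (2 : k)] : IsCancelAdd (FormClasses k) :=
  haveI : IsLeftCancelAdd (FormClasses k) := ⟨fun c _ _ h => FormClasses.add_left_cancel c _ _ h⟩
  AddCommMagma.IsLeftCancelAdd.toIsCancelAdd (FormClasses k)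

/-- Witt's cancellation theorem: forms with the same class in the Grothendieck-Witt group are
isometric. -/
theorem GW.equivalent_of_eq [NeZero (2 : k)] {q r : RegForm k}
    (h : (GrothendieckAddGroup.of (FormClasses.mk q) : GW k) =
      GrothendieckAddGroup.of (FormClasses.mk r)) : q.form.Equivalent r.form :=
  Quotient.exact (GrothendieckAddGroup.of_injective (M := FormClasses k) h)

/-- The rank of a form, as a homomorphism. -/
noncomputable def GW.rank (k : Type u) [Field k] : GW k →+ ℤ :=
  GrothendieckAddGroup.lift
    { toFun := Quotient.lift (fun q => (Module.finrank k q.V : ℤ)) fun _ _ ⟨e⟩ =>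
        congrArg Nat.cast e.toLinearEquiv.finrank_eq
      map_zero' := by
        change ((Module.finrank k PUnit.{u + 1} : ℕ) : ℤ) = 0
        rw [Module.finrank_zero_of_subsingleton]
        rfl
      map_add' := fun a b => by
        induction a using Quotient.inductionOn with | _ q
        induction b using Quotient.inductionOn with | _ r
        change ((Module.finrank k (q.V × r.V) : ℕ) : ℤ) = Module.finrank k q.V + Module.finrank k r.V
        rw [Module.finrank_prod]; push_cast; rfl }

theorem GW.rank_of_mk (q : RegForm k) :
    GW.rank k (GrothendieckAddGroup.of (FormClasses.mk q)) = Module.finrank k q.V :=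
  grothendieck_lift_of _ _

theorem GW.rank_unary [NeZero (2 : k)] (a : kˣ) : GW.rank k (GW.unary a) = 1 := by
  refine (GW.rank_of_mk _).trans ?_
  change ((Module.finrank k k : ℕ) : ℤ) = 1
  simp

end Witt

/-! ### The discriminant -/

section Discriminant

variable {k : Type u} [Field k]

/-- The Gram matrix of the polar form of `q` in a basis. -/
noncomputable def RegForm.gram (q : RegForm k) {ι : Type*} [Fintype ι] [DecidableEq ι]
    (b : Module.Basis ι k q.V) : Matrix ι ι k :=
  LinearMap.BilinForm.toMatrix b (QuadraticMap.polarBilin q.form)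

theorem RegForm.gram_apply (q : RegForm k) {ι : Type*} [Fintype ι] [DecidableEq ι]
    (b : Module.Basis ι k q.V) (i j : ι) :
    q.gram b i j = QuadraticMap.polar q.form (b i) (b j) :=
  LinearMap.BilinForm.toMatrix_apply _ _ _ _

theorem RegForm.gram_det_ne_zero (q : RegForm k) {ι : Type*} [Fintype ι] [DecidableEq ι]
    (b : Module.Basis ι k q.V) : (q.gram b).det ≠ 0 := by
  rw [RegForm.gram, ← LinearMap.BilinForm.nondegenerate_iff_det_ne_zero]
  have h1 : (QuadraticMap.polarBilin q.form).SeparatingLeft := fun v hv => q.regular v hv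
  refine ⟨h1, fun v hv => q.regular v fun w => ?_⟩
  rw [QuadraticMap.polar_comm]
  exact hv w

/-- The group of square classes of `k`, written additively. -/
def SquareClasses (k : Type u) [Field k] : Type u :=
  Additive (kˣ ⧸ (powMonoidHom 2 : kˣ →* kˣ).range)

instance : AddCommGroup (SquareClasses k) :=
  inferInstanceAs (AddCommGroup (Additive (kˣ ⧸ (powMonoidHom 2 : kˣ →* kˣ).range)))

/-- The square class of a unit. -/
def squareClass (a : kˣ) : SquareClasses k :=
  Additive.ofMul (QuotientGroup.mk a)

theorem squareClass_mul (a b : kˣ) : squareClass (a * b) = squareClass a + squareClass b := rfl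

theorem squareClass_eq_of_sq {a b : kˣ} (c : k) (h : (a : k) = b * c ^ 2) :
    squareClass a = squareClass b := by
  have hc : c ≠ 0 := fun hc => a.ne_zero (by rw [h, hc]; ring)
  have h2 : a = b * Units.mk0 c hc ^ 2 := Units.ext (by push_cast; exact h)
  rw [h2]
  refine congrArg Additive.ofMul (QuotientGroup.eq.2 ?_)
  refine ⟨(Units.mk0 c hc)⁻¹, ?_⟩
  simp only [powMonoidHom_apply, mul_inv_rev, inv_pow]
  rw [mul_assoc, inv_mul_cancel, mul_one]

theorem squareClass_eq_zero_iff {a : kˣ} : squareClass a = 0 ↔ IsSquare (a : k) := by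
  constructor
  · intro h
    have h1 : (QuotientGroup.mk a : kˣ ⧸ (powMonoidHom 2 : kˣ →* kˣ).range) = 1 := h
    rw [QuotientGroup.eq_one_iff] at h1
    obtain ⟨c, hc⟩ := h1
    exact ⟨c, by rw [← hc]; simp [pow_two]⟩
  · rintro ⟨c, hc⟩
    exact squareClass_eq_of_sq (b := 1) c (by rw [hc]; push_cast; ring)

theorem two_nsmul_squareClasses (x : SquareClasses k) : 2 • x = 0 := by
  obtain ⟨a, rfl⟩ : ∃ a, squareClass a = x :=
    QuotientGroup.mk_surjective (s := (powMonoidHom 2 : kˣ →* kˣ).range) x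
  rw [two_nsmul, ← squareClass_mul, squareClass_eq_zero_iff]
  exact ⟨a, by push_cast; rfl⟩

/-- The square class of the determinant of the Gram matrix. -/
noncomputable def RegForm.discr (q : RegForm k) : SquareClasses k :=
  squareClass (Units.mk0 _ (q.gram_det_ne_zero (Module.finBasis k q.V)))

theorem RegForm.discr_eq (q : RegForm k) {ι : Type*} [Fintype ι] [DecidableEq ι]
    (b : Module.Basis ι k q.V) :
    q.discr = squareClass (Units.mk0 _ (q.gram_det_ne_zero b)) := by
  let e : Fin (Module.finrank k q.V) ≃ ι := (Module.finBasis k q.V).indexEquiv b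
  let b' := b.reindex e.symm
  have h1 : (q.gram b').det = (q.gram b).det := by
    rw [← Matrix.det_submatrix_equiv_self e (q.gram b)]
    congr 1
    ext i j
    rw [RegForm.gram_apply, Matrix.submatrix_apply, RegForm.gram_apply]
    simp [b']
  have h2 := LinearMap.BilinForm.toMatrix_mul_basis_toMatrix b' (Module.finBasis k q.V)
    (QuadraticMap.polarBilin q.form)
  refine squareClass_eq_of_sq (b'.toMatrix (Module.finBasis k q.V)).det ?_
  change (q.gram (Module.finBasis k q.V)).det = (q.gram b).det * _
  rw [← h1, RegForm.gram, ← h2, Matrix.det_mul, Matrix.det_mul, Matrix.det_transpose]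
  rw [RegForm.gram]
  ring

theorem RegForm.discr_congr {q r : RegForm k} (e : q.form.IsometryEquiv r.form) :
    q.discr = r.discr := by
  rw [RegForm.discr, r.discr_eq ((Module.finBasis k q.V).map e.toLinearEquiv)]
  have h : q.gram (Module.finBasis k q.V) =
      r.gram ((Module.finBasis k q.V).map e.toLinearEquiv) := by
    ext i j
    rw [RegForm.gram_apply, RegForm.gram_apply, ← isometryEquiv_polar e]
    rfl
  congr 1
  ext
  rw [Units.val_mk0, Units.val_mk0, h]

/-- The (unsigned) discriminant, as a homomorphism to the square classes. -/
noncomputable def GW.discr (k : Type u) [Field k] : GW k →+ SquareClasses k :=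
  GrothendieckAddGroup.lift 
    { toFun := Quotient.lift RegForm.discr fun _ _ ⟨e⟩ => RegForm.discr_congr e
      map_zero' := by
        change RegForm.discr (RegForm.zero k) = 0
        rw [(RegForm.zero k).discr_eq (Module.Basis.empty (ι := Empty) (M := PUnit.{u + 1})),
          squareClass_eq_zero_iff]
        refine ⟨1, ?_⟩
        rw [Units.val_mk0, Matrix.det_isEmpty, one_mul]
      map_add' := fun a b => by
        induction a using Quotient.inductionOn with | _ q
        induction b using Quotient.inductionOn with | _ r
        change RegForm.discr (q.sum r) = q.discr + r.discr
        let B : Module.Basis _ k (q.sum r).V :=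
          (Module.finBasis k q.V).prod (Module.finBasis k r.V)
        rw [(q.sum r).discr_eq B, RegForm.discr, RegForm.discr, ← squareClass_mul]
        congr 1
        ext
        rw [Units.val_mul, Units.val_mk0, Units.val_mk0, Units.val_mk0,
          ← Matrix.det_fromBlocks_zero₂₁ _ 0]
        congr 1
        have hp : ∀ x y : q.V × r.V, QuadraticMap.polar (q.sum r).form x y =
            QuadraticMap.polar q.form x.1 y.1 + QuadraticMap.polar r.form x.2 y.2 :=
          QuadraticMap.polar_prod _ _
        have hl : ∀ i, B (Sum.inl i) = ((Module.finBasis k q.V i, 0) : q.V × r.V) := fun i =>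
          Prod.ext (Module.Basis.prod_apply_inl_fst _ _ _) (Module.Basis.prod_apply_inl_snd _ _ _)
        have hr : ∀ i, B (Sum.inr i) = ((0, Module.finBasis k r.V i) : q.V × r.V) := fun i =>
          Prod.ext (Module.Basis.prod_apply_inr_fst _ _ _) (Module.Basis.prod_apply_inr_snd _ _ _)
        ext (i | i) (j | j)
        all_goals
          rw [RegForm.gram_apply]
          refine (hp _ _).trans ?_
          simp [RegForm.gram_apply, hl, hr] }

theorem GW.discr_of_mk (q : RegForm k) {ι : Type*} [Fintype ι] [DecidableEq ι]
    (b : Module.Basis ι k q.V) :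
    GW.discr k (GrothendieckAddGroup.of (FormClasses.mk q)) =
      squareClass (Units.mk0 _ (q.gram_det_ne_zero b)) :=
  (grothendieck_lift_of _ (FormClasses.mk q)).trans (q.discr_eq b)

theorem GW.discr_unary [NeZero (2 : k)] (a : kˣ) :
    GW.discr k (GW.unary a) = squareClass (Units.mk0 2 (NeZero.ne 2)) + squareClass a := by
  let B : Module.Basis Unit k (RegForm.unary a).V := Module.Basis.singleton Unit k
  have hB : ∀ i, B i = (1 : k) := Module.Basis.singleton_apply Unit k
  refine (GW.discr_of_mk (RegForm.unary a) B).trans ?_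
  rw [← squareClass_mul]
  congr 1
  ext
  rw [Units.val_mk0, Matrix.det_unique, RegForm.gram_apply, hB]
  change (a : k) * ((1 + 1) * (1 + 1)) - a * (1 * 1) - a * (1 * 1) = 2 * a
  ring

end Discriminant

/-! ### Base change -/

section BaseChange

open TensorProduct

variable {k l : Type u} [Field k] [Field l] [NeZero (2 : k)] [Algebra k l]

/-- The extension of scalars of a form along `k → l`. -/
noncomputable def RegForm.baseChange (l : Type u) [Field l] [Algebra k l] (q : RegForm k) :
    RegForm l :=
  letI : Invertible (2 : k) := invertibleOfNonzero (NeZero.ne 2)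
  haveI : NeZero (2 : l) :=
    ⟨fun h => NeZero.ne (2 : k) ((algebraMap k l).injective (by rw [map_ofNat, h, map_zero]))⟩
  letI : Invertible (2 : l) := invertibleOfNonzero (NeZero.ne 2)
  { V := l ⊗[k] q.V
    form := q.form.baseChange l
    regular := fun z hz => by
      have hB : (QuadraticMap.polarBilin q.form).Nondegenerate :=
        ⟨fun v hv => q.regular v hv, fun v hv => q.regular v fun w => by
          rw [QuadraticMap.polar_comm]; exact hv w⟩
      let b := Module.finBasis k q.V
      let b' := LinearMap.BilinForm.dualBasis (QuadraticMap.polarBilin q.form) hB b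
      have h1 : ∀ i, (b'.baseChange l).repr z i = 0 := fun i => by
        have h2 := hz (1 ⊗ₜ b i)
        rw [← QuadraticMap.polarBilin_apply_apply, QuadraticForm.polarBilin_baseChange] at h2
        rw [← (b'.baseChange l).sum_repr z, map_sum, LinearMap.sum_apply,
          Finset.sum_eq_single i] at h2
        · simp only [map_smul, LinearMap.smul_apply, Module.Basis.baseChange_apply,
            LinearMap.BilinForm.baseChange_tmul, b',
            LinearMap.BilinForm.apply_dualBasis_left] at h2
          simpa using h2
        · intro j _ hj
          simp only [map_smul, LinearMap.smul_apply, Module.Basis.baseChange_apply,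
            LinearMap.BilinForm.baseChange_tmul, b',
            LinearMap.BilinForm.apply_dualBasis_left, if_neg hj.symm]
          simp
        · simp
      refine (b'.baseChange l).repr.injective ?_
      rw [map_zero]
      exact Finsupp.ext h1 }

theorem RegForm.baseChange_form_tmul (q : RegForm k) (a : l) (v : q.V) :
    (q.baseChange l).form (a ⊗ₜ[k] v) = algebraMap k l (q.form v) * (a * a) := by
  let _ : Invertible (2 : k) := invertibleOfNonzero (NeZero.ne 2)
  refine (QuadraticForm.baseChange_tmul (A := l) q.form a v).trans ?_
  rw [Algebra.smul_def]

/-- To identify the extension of scalars of `q` it suffices to find a form over `l` of the same rank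
that is generated by a copy of `q`. -/
theorem FormClasses.mk_baseChange_eq (q : RegForm k) (r : RegForm l) (φ : q.V →+ r.V)
    (hφ : ∀ (c : k) (v : q.V), φ (c • v) = algebraMap k l c • φ v)
    (hform : ∀ v, r.form (φ v) = algebraMap k l (q.form v))
    (hspan : Submodule.span l (Set.range φ) = ⊤)
    (hrank : Module.finrank k q.V = Module.finrank l r.V) :
    FormClasses.mk (q.baseChange l) = FormClasses.mk r := by
  let _ : Module k r.V := Module.restrictScalars k l r.V
  have : IsScalarTower k l r.V := IsScalarTower.restrictScalars k l r.V
  let φ' : q.V →ₗ[k] r.V := { φ with map_smul' := fun c v => hφ c v }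
  let Φ : l ⊗[k] q.V →ₗ[l] r.V := TensorProduct.AlgebraTensorModule.lift
    { toFun := fun a : l => a • φ'
      map_add' := fun a b => by ext; simp [add_smul]
      map_smul' := fun a b => by ext; simp [mul_smul] }
  have hΦ : ∀ (a : l) (v : q.V), Φ (a ⊗ₜ v) = a • φ v := fun a v => rfl
  have hsurj : Function.Surjective Φ := by
    rw [← LinearMap.range_eq_top, ← top_le_iff, ← hspan, Submodule.span_le]
    rintro _ ⟨v, rfl⟩
    exact ⟨1 ⊗ₜ v, by rw [hΦ, one_smul]⟩
  have hinj : Function.Injective Φ := by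
    rw [LinearMap.injective_iff_surjective_of_finrank_eq_finrank]
    · exact hsurj
    · rw [Module.finrank_baseChange, hrank]
  let e : (l ⊗[k] q.V) ≃ₗ[l] r.V := LinearEquiv.ofBijective Φ ⟨hinj, hsurj⟩
  refine FormClasses.mk_eq (q := q.baseChange l) { e with map_app' := ?_ }
  have key : r.form.comp Φ = (q.baseChange l).form := by
    refine baseChange_ext fun v => ?_
    refine Eq.trans ?_ (q.baseChange_form_tmul 1 v).symm
    rw [QuadraticMap.comp_apply, hΦ, one_smul, hform, mul_one, mul_one]
  exact fun z => congrArg (fun Q : QuadraticForm l (l ⊗[k] q.V) => Q z) key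

theorem RegForm.finrank_baseChange (q : RegForm k) :
    Module.finrank l (q.baseChange l).V = Module.finrank k q.V :=
  Module.finrank_baseChange (R := l) (S := k) (M' := q.V)

theorem RegForm.span_one_tmul_eq_top (q : RegForm k) {X : Type*} (φ : X → (q.baseChange l).V)
    (h : ∀ v : q.V, ∃ x, φ x = (1 : l) ⊗ₜ[k] v) :
    Submodule.span l (Set.range φ) = ⊤ := by
  rw [← top_le_iff]
  rintro z -
  have key : ∀ z : l ⊗[k] q.V, (z : (q.baseChange l).V) ∈ Submodule.span l (Set.range φ) := by
    intro z
    induction z with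
    | zero => exact Submodule.zero_mem _
    | add x y hx hy => exact Submodule.add_mem _ hx hy
    | tmul a v =>
      obtain ⟨x, hx⟩ := h v
      have h1 := Submodule.smul_mem _ a (Submodule.subset_span (R := l) (Set.mem_range_self (f := φ) x))
      rw [hx] at h1
      have h2 : a • ((1 : l) ⊗ₜ[k] v) = a ⊗ₜ[k] v := by
        rw [smul_tmul', smul_eq_mul, mul_one]
      exact h2 ▸ h1
  exact key z

/-- Extension of scalars of Grothendieck-Witt groups. -/
noncomputable def GW.baseChange (l : Type u) [Field l] [Algebra k l] : GW k →+ GW l :=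
  GrothendieckAddGroup.lift (GrothendieckAddGroup.of.comp
    { toFun := Quotient.lift (fun q => FormClasses.mk (RegForm.baseChange l q)) fun q r ⟨e⟩ =>
        FormClasses.mk_baseChange_eq q (r.baseChange l)
          { toFun := fun v => (1 : l) ⊗ₜ[k] e v
            map_zero' := (congrArg _ (map_zero e.toLinearEquiv)).trans (tmul_zero _ _)
            map_add' := fun v w => (congrArg _ (map_add e.toLinearEquiv v w)).trans (tmul_add _ _ _) }
          (fun c v => (congrArg _ (map_smul e.toLinearEquiv c v)).trans (by
            change (1 : l) ⊗ₜ[k] (c • e v) = algebraMap k l c • ((1 : l) ⊗ₜ[k] e v)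
            rw [tmul_smul, algebraMap_smul]))
          (fun v => (r.baseChange_form_tmul 1 (e v)).trans (by
            rw [e.map_app, mul_one, mul_one]))
          (RegForm.span_one_tmul_eq_top r _ fun v => ⟨e.symm v, by
            change (1 : l) ⊗ₜ[k] e (e.symm v) = _
            rw [e.apply_symm_apply]⟩)
          (e.toLinearEquiv.finrank_eq.trans r.finrank_baseChange.symm)
      map_zero' := 
        FormClasses.mk_baseChange_eq (RegForm.zero k) (RegForm.zero l) 0 (fun _ _ => rfl)
          (fun _ => (map_zero _).symm) (Subsingleton.elim (α := Submodule l PUnit.{u + 1}) _ _)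
          ((Module.finrank_zero_of_subsingleton (R := k) (M := PUnit.{u + 1})).trans
            (Module.finrank_zero_of_subsingleton (R := l) (M := PUnit.{u + 1})).symm)
      map_add' := fun a b => by
        induction a using Quotient.inductionOn with | _ q
        induction b using Quotient.inductionOn with | _ r
        refine FormClasses.mk_baseChange_eq (q.sum r) ((q.baseChange l).sum (r.baseChange l))
          { toFun := fun v => ((1 : l) ⊗ₜ[k] v.1, (1 : l) ⊗ₜ[k] v.2)
            map_zero' := Prod.ext (tmul_zero _ _) (tmul_zero _ _)
            map_add' := fun v w => Prod.ext (tmul_add _ _ _) (tmul_add _ _ _) } ?_ ?_ ?_ ?_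
        · intro c v
          refine Prod.ext ?_ ?_
          · change (1 : l) ⊗ₜ[k] (c • v.1) = algebraMap k l c • ((1 : l) ⊗ₜ[k] v.1)
            rw [tmul_smul, algebraMap_smul]
          · change (1 : l) ⊗ₜ[k] (c • v.2) = algebraMap k l c • ((1 : l) ⊗ₜ[k] v.2)
            rw [tmul_smul, algebraMap_smul]
        · intro v
          refine (congrArg₂ (· + ·) (q.baseChange_form_tmul (1 : l) v.1)
            (r.baseChange_form_tmul (1 : l) v.2)).trans ?_
          rw [RegForm.sum_form_apply, map_add, mul_one, mul_one, mul_one]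
        · rw [← top_le_iff]
          have h1 : ∀ v : (q.baseChange l).V, ((v, 0) : (q.baseChange l).V × (r.baseChange l).V) ∈
              Submodule.span l (Set.range fun v : q.V × r.V =>
                (((1 : l) ⊗ₜ[k] v.1, (1 : l) ⊗ₜ[k] v.2) :
                  (q.baseChange l).V × (r.baseChange l).V)) := fun v => by
            have h2 := Submodule.map_mono (f := LinearMap.inl l _ (r.baseChange l).V)
              (RegForm.span_one_tmul_eq_top (l := l) q (fun v => (1 : l) ⊗ₜ[k] v)
                fun v => ⟨v, rfl⟩).ge
            rw [Submodule.map_span] at h2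
            refine Submodule.span_mono ?_ (h2 ⟨v, trivial, rfl⟩)
            rintro _ ⟨_, ⟨v, rfl⟩, rfl⟩
            exact ⟨(v, 0), Prod.ext rfl (tmul_zero _ _)⟩
          have h3 : ∀ v : (r.baseChange l).V, ((0, v) : (q.baseChange l).V × (r.baseChange l).V) ∈
              Submodule.span l (Set.range fun v : q.V × r.V =>
                (((1 : l) ⊗ₜ[k] v.1, (1 : l) ⊗ₜ[k] v.2) :
                  (q.baseChange l).V × (r.baseChange l).V)) := fun v => by
            have h2 := Submodule.map_mono (f := LinearMap.inr l (q.baseChange l).V _)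
              (RegForm.span_one_tmul_eq_top (l := l) r (fun v => (1 : l) ⊗ₜ[k] v)
                fun v => ⟨v, rfl⟩).ge
            rw [Submodule.map_span] at h2
            refine Submodule.span_mono ?_ (h2 ⟨v, trivial, rfl⟩)
            rintro _ ⟨_, ⟨v, rfl⟩, rfl⟩
            exact ⟨(0, v), Prod.ext (tmul_zero _ _) rfl⟩
          rintro ⟨v, w⟩ -
          have h4 := Submodule.add_mem _ (h1 v) (h3 w)
          rw [Prod.mk_add_mk, add_zero, zero_add] at h4
          exact h4
        · refine (Module.finrank_prod (R := k) (M := q.V) (M' := r.V)).trans ?_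
          refine (congrArg₂ (· + ·) (q.finrank_baseChange (l := l)).symm
            (r.finrank_baseChange (l := l)).symm).trans ?_
          exact (Module.finrank_prod (R := l) (M := (q.baseChange l).V)
            (M' := (r.baseChange l).V)).symm })

theorem GW.baseChange_of_mk (q : RegForm k) :
    GW.baseChange l (GrothendieckAddGroup.of (FormClasses.mk q)) =
      GrothendieckAddGroup.of (FormClasses.mk (q.baseChange l)) :=
  grothendieck_lift_of _ _

end BaseChange

/-! ### Transfers of trace forms -/

section Transfer

variable {k l m : Type u} [Field k] [Field l] [Field m] [Algebra k l] [Algebra l m] [Algebra k m]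
  [IsScalarTower k l m] [FiniteDimensional k l] [FiniteDimensional l m] [FiniteDimensional k m]
  [Algebra.IsSeparable k l] [Algebra.IsSeparable l m] [Algebra.IsSeparable k m]

theorem GW.transfer_of_mk (q : RegForm l) :
    GW.transfer k (GrothendieckAddGroup.of (FormClasses.mk q)) =
      GrothendieckAddGroup.of (FormClasses.mk (RegForm.transfer k q)) :=
  grothendieck_lift_of _ _

/-- Transitivity of the Scharlau transfer. -/
theorem GW.transfer_transfer (z : GW m) :
    GW.transfer k (GW.transfer l z) = GW.transfer k z := by
  have h : (GW.transfer k).comp (GW.transfer (l := m) l) = GW.transfer (l := m) k := by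
    refine grothendieck_hom_ext fun x => ?_
    induction x using Quotient.inductionOn with | _ q
    refine (congrArg (GW.transfer k) (GW.transfer_of_mk (k := l) q)).trans
      ((GW.transfer_of_mk _).trans ((GW.transfer_of_mk (k := k) q).trans ?_).symm)
    refine congrArg GrothendieckAddGroup.of (FormClasses.mk_eq (q := RegForm.transfer k q)
      (r := RegForm.transfer k (RegForm.transfer l q))
      { toFun := fun v => v
        invFun := fun v => v
        left_inv := fun _ => rfl
        right_inv := fun _ => rfl
        map_add' := fun _ _ => rfl
        map_smul' := fun c (v : q.V) => ?_
        map_app' := fun (v : q.V) => ?_ })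
    · exact congrArg (fun a : m => a • v) (IsScalarTower.algebraMap_apply k l m c)
    · exact Algebra.trace_trace (R := k) (S := l) (q.form v)
  exact DFunLike.congr_fun h z

theorem RegForm.finrank_transfer (q : RegForm l) :
    Module.finrank k (RegForm.transfer k q).V = Module.finrank k l * Module.finrank l q.V := by
  let _ : Module k q.V := Module.restrictScalars k l q.V
  have : IsScalarTower k l q.V := IsScalarTower.restrictScalars k l q.V
  exact (Module.finrank_mul_finrank k l q.V).symm

theorem RegForm.finrank_transfer_unary [NeZero (2 : l)] (a : lˣ) :
    Module.finrank k (RegForm.transfer k (RegForm.unary a)).V = Module.finrank k l :=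
  (RegForm.finrank_transfer _).trans
    ((congrArg _ (Module.finrank_self l)).trans (mul_one _))

theorem GW.rank_transfer (z : GW l) :
    GW.rank k (GW.transfer k z) = Module.finrank k l * GW.rank l z := by
  have h : (GW.rank k).comp (GW.transfer (l := l) k) =
      (AddMonoidHom.mulLeft (Module.finrank k l : ℤ)).comp (GW.rank l) := by
    refine grothendieck_hom_ext fun x => ?_
    induction x using Quotient.inductionOn with | _ q
    refine (congrArg (GW.rank k) (GW.transfer_of_mk q)).trans ((GW.rank_of_mk _).trans ?_)
    refine Eq.trans ?_ (congrArg (fun z => (Module.finrank k l : ℤ) * z) (GW.rank_of_mk q)).symm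
    exact_mod_cast RegForm.finrank_transfer q
  exact DFunLike.congr_fun h z

omit [Algebra l m] [IsScalarTower k l m] [FiniteDimensional l m] [Algebra.IsSeparable l m] in
theorem GW.transfer_unary_one_congr [NeZero (2 : l)] [NeZero (2 : m)] (e : l ≃ₐ[k] m) :
    GW.transfer k (GW.unary (1 : lˣ)) = GW.transfer k (GW.unary (1 : mˣ)) := by
  refine (GW.transfer_of_mk _).trans (Eq.trans ?_ (GW.transfer_of_mk _).symm)
  refine congrArg GrothendieckAddGroup.of (FormClasses.mk_eq
    (q := RegForm.transfer k (RegForm.unary (1 : lˣ)))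
    (r := RegForm.transfer k (RegForm.unary (1 : mˣ)))
    { toFun := e
      invFun := e.symm
      left_inv := e.symm_apply_apply
      right_inv := e.apply_symm_apply
      map_add' := map_add e
      map_smul' := fun c (v : l) => ?_
      map_app' := fun (v : l) => ?_ })
  · change e (algebraMap k l c * v) = algebraMap k m c * e v
    rw [map_mul, e.commutes]
  · change Algebra.trace k m (((1 : mˣ) : m) * (e v * e v)) =
      Algebra.trace k l (((1 : lˣ) : l) * (v * v))
    rw [Units.val_one, Units.val_one, one_mul, one_mul, ← map_mul, Algebra.trace_eq_of_algEquiv]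

section Quadratic

variable [NeZero (2 : k)] (hkl : Module.finrank k l = 2) (τ : l ≃ₐ[k] l) {s : l} (hs : τ s = -s)
  (hs0 : s ≠ 0)

include hkl hs hs0

omit [FiniteDimensional k l] [Algebra.IsSeparable k l] in
theorem exists_eq_add_mul_of_finrank_two (t : l) :
    ∃ a b : k, t = algebraMap k l a + algebraMap k l b * s := by
  have h2 : (2 : l) ≠ 0 := fun h => NeZero.ne (2 : k)
    ((algebraMap k l).injective (by rw [map_ofNat, h, map_zero]))
  have hli : LinearIndependent k ![1, s] := by
    rw [LinearIndependent.pair_iff]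
    intro a b hab
    rw [Algebra.smul_def, Algebra.smul_def, mul_one] at hab
    have h3 := congrArg τ hab
    rw [map_add, map_mul, τ.commutes, τ.commutes, hs, map_zero] at h3
    have ha : algebraMap k l a = 0 := by
      refine (mul_eq_zero.1 (?_ : 2 * algebraMap k l a = 0)).resolve_left h2
      linear_combination hab + h3
    rw [ha, zero_add] at hab
    refine ⟨(map_eq_zero _).1 ha, ?_⟩
    exact (map_eq_zero _).1 ((mul_eq_zero.1 hab).resolve_right hs0)
  have : FiniteDimensional k l := Module.finite_of_finrank_pos (by rw [hkl]; norm_num)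
  have hspan := hli.span_eq_top_of_card_eq_finrank' (by simp [hkl])
  have ht : t ∈ Submodule.span k (Set.range ![1, s]) := hspan ▸ Submodule.mem_top
  rw [Matrix.range_cons, Matrix.range_cons, Matrix.range_empty, Set.union_empty] at ht
  obtain ⟨a, b, h⟩ := Submodule.mem_span_pair.1 ht
  exact ⟨a, b, by rw [← h, Algebra.smul_def, Algebra.smul_def, mul_one]⟩

omit hs0 [FiniteDimensional k l] [Algebra.IsSeparable k l] in
theorem trace_add_mul_of_finrank_two (a b : k) :
    Algebra.trace k l (algebraMap k l a + algebraMap k l b * s) = 2 * a := by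
  have hs1 : Algebra.trace k l s = 0 := by
    have h1 := Algebra.trace_eq_of_algEquiv τ s
    rw [hs, map_neg] at h1
    refine (mul_eq_zero.1 (?_ : 2 * Algebra.trace k l s = 0)).resolve_left (NeZero.ne 2)
    linear_combination -h1
  rw [map_add, Algebra.trace_algebraMap, ← Algebra.smul_def, map_smul, hs1, hkl, smul_zero, add_zero,
    two_nsmul, two_mul]

omit [FiniteDimensional k l] [Algebra.IsSeparable k l] in
theorem algebraMap_trace_of_finrank_two (t : l) :
    algebraMap k l (Algebra.trace k l t) = t + τ t := by
  obtain ⟨a, b, rfl⟩ := exists_eq_add_mul_of_finrank_two hkl τ hs hs0 t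
  rw [trace_add_mul_of_finrank_two hkl τ hs, map_add, map_mul, map_mul, τ.commutes,
    τ.commutes, hs, map_ofNat]
  ring

omit hs0 in
/-- The transfer of `⟨c⟩` from `l = k(√d)`, for `c` in `k`, is `⟨2c⟩ + ⟨2cd⟩`: the basis `1, √d` is
orthogonal. -/
theorem GW.transfer_unary_algebraMap_of_finrank_two [NeZero (2 : l)] {d : kˣ}
    (hd : s ^ 2 = algebraMap k l d) (c : kˣ) {c' : lˣ} (hc : (c' : l) = algebraMap k l c) :
    GW.transfer k (GW.unary c') =
      GW.unary (Units.mk0 2 (NeZero.ne 2) * c) + GW.unary (Units.mk0 2 (NeZero.ne 2) * c * d) := by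
  have htr := trace_add_mul_of_finrank_two hkl τ hs
  refine (GW.transfer_of_mk _).trans ?_
  have hf : ∀ v : l, (RegForm.transfer k (RegForm.unary c')).form v =
      Algebra.trace k l (c' * (v * v)) := fun v => rfl
  refine GW.of_mk_eq_of_pair _ ((RegForm.finrank_transfer_unary c').trans hkl) (1 : l) s _ _
    ((hf _).trans ?_) ((hf _).trans ?_) ?_
  · have := htr c 0
    rw [map_zero, zero_mul, add_zero] at this
    rw [mul_one, mul_one, hc, this]
    rfl
  · have := htr (c * d) 0
    rw [map_zero, zero_mul, add_zero] at this
    rw [← pow_two, hd, hc, ← map_mul, this]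
    push_cast
    rw [Units.val_mk0]; ring
  · have h1 : ∀ v w : l, QuadraticMap.polar (RegForm.transfer k (RegForm.unary c')).form v w =
        Algebra.trace k l (c' * (2 * (v * w))) := fun v w => by
      have : c' * (2 * (v * w)) = c' * ((v + w) * (v + w)) - c' * (v * v) - c' * (w * w) := by ring
      rw [this, map_sub, map_sub]
      rfl
    refine (h1 1 s).trans ?_
    have := htr 0 (2 * c)
    rw [map_zero, zero_add, mul_zero] at this
    refine Eq.trans (congrArg _ ?_) this
    rw [hc, map_mul (algebraMap k l), map_ofNat]
    ring

omit hs0 in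
/-- The transfer of `⟨2 δ⟩` for `δ = x (Δ + a √Δ)`, where `Δ = a ^ 2 + b ^ 2`. -/
theorem GW.transfer_unary_of_finrank_two [NeZero (2 : l)] {Δ x : kˣ} {a b : k}
    (hΔ : s ^ 2 = algebraMap k l Δ) (hab : (Δ : k) = a ^ 2 + b ^ 2) (hb : b ≠ 0) {δ : lˣ}
    (hδ : (δ : l) = 2 * (algebraMap k l x * (algebraMap k l Δ + algebraMap k l a * s))) :
    GW.transfer k (GW.unary δ) = GW.unary x + GW.unary x := by
  have htr := trace_add_mul_of_finrank_two hkl τ hs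
  have hΔ' : algebraMap k l Δ = algebraMap k l a ^ 2 + algebraMap k l b ^ 2 := by
    rw [hab, map_add, map_pow, map_pow]
  have hs2 : s ^ 2 = algebraMap k l a ^ 2 + algebraMap k l b ^ 2 := hΔ.trans hΔ'
  refine (GW.transfer_of_mk _).trans ?_
  have hf : ∀ v : l, (RegForm.transfer k (RegForm.unary δ)).form v =
      Algebra.trace k l (δ * (v * v)) := fun v => rfl
  have h4 : (4 : k) ≠ 0 := by
    have : (4 : k) = 2 * 2 := by norm_num
    rw [this]
    exact mul_ne_zero (NeZero.ne 2) (NeZero.ne 2)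
  have key := GW.of_mk_eq_of_pair (RegForm.transfer k (RegForm.unary δ))
    ((RegForm.finrank_transfer_unary δ).trans hkl) (1 : l) (s - algebraMap k l a)
    (Units.mk0 4 h4 * x * Δ) (Units.mk0 4 h4 * x * Δ * Units.mk0 b hb ^ 2)
    ((hf _).trans ?_) ((hf _).trans ?_) ?_
  · rw [key, GW.two_unary_mul a b hab x,
      GW.unary_eq_of_sq (a := Units.mk0 4 h4 * x * Δ) (b := x * Δ) (Units.mk0 2 (NeZero.ne 2))
        (by push_cast; rw [Units.val_mk0, Units.val_mk0]; ring),
      GW.unary_eq_of_sq (a := Units.mk0 4 h4 * x * Δ * Units.mk0 b hb ^ 2) (b := x * Δ)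
        (Units.mk0 2 (NeZero.ne 2) * Units.mk0 b hb)
        (by push_cast; rw [Units.val_mk0, Units.val_mk0, Units.val_mk0]; ring)]
  · have := htr (2 * x * Δ) (2 * x * a)
    rw [mul_one, mul_one, hδ]
    push_cast
    rw [Units.val_mk0]
    refine Eq.trans (congrArg _ ?_) (this.trans ?_)
    · simp only [map_mul, map_ofNat]; ring
    · ring
  · have := htr (2 * x * Δ * b ^ 2) (-(2 * x * a * b ^ 2))
    rw [hδ]
    push_cast
    rw [Units.val_mk0, Units.val_mk0]
    refine Eq.trans (congrArg _ ?_) (this.trans ?_)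
    · simp only [map_mul, map_ofNat, map_neg, map_pow, hΔ']
      linear_combination (2 * algebraMap k l x * (algebraMap k l b ^ 2 - algebraMap k l a ^ 2 +
        algebraMap k l a * s)) * hs2
    · ring
  · have h1 : ∀ v w : l, QuadraticMap.polar (RegForm.transfer k (RegForm.unary δ)).form v w =
        Algebra.trace k l (δ * (2 * (v * w))) := fun v w => by
      have : δ * (2 * (v * w)) = δ * ((v + w) * (v + w)) - δ * (v * v) - δ * (w * w) := by ring
      rw [this, map_sub, map_sub]
      rfl
    refine (h1 _ _).trans ?_
    have := htr 0 (4 * x * b ^ 2)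
    rw [hδ]
    refine Eq.trans (congrArg _ ?_) (this.trans (mul_zero _))
    simp only [map_mul, map_ofNat, map_pow, map_zero, hΔ']
    linear_combination (4 * algebraMap k l x * algebraMap k l a) * hs2

/-- If `l / k` is a quadratic subextension of `m / k`, then the trace form of `m / k` becomes twice
the trace form of `m / l` over `l`, since `l ⊗ m` is the product of two copies of `m`, one
of them twisted by an automorphism. -/
theorem GW.baseChange_transfer_unary_one [NeZero (2 : m)] (g : m ≃ₐ[k] m)
    (hg : ∀ t, g (algebraMap l m t) = algebraMap l m (τ t)) :
    GW.baseChange l (GW.transfer k (GW.unary (1 : mˣ))) =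
      GW.transfer l (GW.unary (1 : mˣ)) + GW.transfer l (GW.unary (1 : mˣ)) := by
  have h2 : (2 : m) ≠ 0 := NeZero.ne 2
  have hs' : algebraMap l m s ≠ 0 := (map_ne_zero _).2 hs0
  have e1 : GW.transfer k (GW.unary (1 : mˣ)) = _ := GW.transfer_of_mk (RegForm.unary (1 : mˣ))
  have e2 : GW.transfer l (GW.unary (1 : mˣ)) = _ := GW.transfer_of_mk (RegForm.unary (1 : mˣ))
  rw [e1, e2, ← GW.of_mk_add, GW.baseChange_of_mk]
  refine congrArg GrothendieckAddGroup.of (FormClasses.mk_baseChange_eq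
    (RegForm.transfer k (RegForm.unary (1 : mˣ)))
    ((RegForm.transfer l (RegForm.unary (1 : mˣ))).sum (RegForm.transfer l (RegForm.unary (1 : mˣ))))
    { toFun := fun v : m => ((v, g v) : m × m)
      map_zero' := Prod.ext rfl (map_zero g)
      map_add' := fun v w => Prod.ext rfl (map_add g v w) } ?_ ?_ ?_ ?_)
  · intro c (v : m)
    have h : algebraMap k m c = algebraMap l m (algebraMap k l c) :=
      IsScalarTower.algebraMap_apply k l m c
    refine Prod.ext (congrArg (· * v) h) ?_
    change g (algebraMap k m c * v) = algebraMap l m (algebraMap k l c) * g v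
    rw [map_mul, g.commutes, h]
  · intro (v : m)
    change Algebra.trace l m (((1 : mˣ) : m) * (v * v)) +
      Algebra.trace l m (((1 : mˣ) : m) * (g v * g v)) =
      algebraMap k l (Algebra.trace k m (((1 : mˣ) : m) * (v * v)))
    rw [Units.val_one, one_mul, one_mul, ← Algebra.trace_trace (R := k) (S := l) (T := m),
      algebraMap_trace_of_finrank_two hkl τ hs hs0, ← map_mul]
    congr 1
    refine (τ.symm_apply_eq.1 (Algebra.trace_eq_of_equiv_equiv τ.toRingEquiv g.toRingEquiv ?_
      (v * v)).symm)
    exact RingHom.ext fun t => (hg t).symm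
  · rw [← top_le_iff]
    rintro ⟨(v : m), (w : m)⟩ -
    -- `s (v, g v) - (s v, g (s v))` is a multiple of `(0, g v)`.
    let W : RegForm l := (RegForm.transfer l (RegForm.unary (1 : mˣ))).sum
      (RegForm.transfer l (RegForm.unary (1 : mˣ)))
    let φ : m → W.V := fun v => ((v, g v) : m × m)
    change (((v, w) : m × m) : W.V) ∈ Submodule.span l (Set.range φ)
    have hφ : ∀ v, φ v ∈ Submodule.span l (Set.range φ) := fun v =>
      Submodule.subset_span (Set.mem_range_self v)
    have hs'' : g (algebraMap l m s) = -algebraMap l m s := by rw [hg, hs, map_neg]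
    have h1 : ∀ w : m, (((0, w) : m × m) : W.V) ∈ Submodule.span l (Set.range φ) := fun w => by
      obtain ⟨v, rfl⟩ : ∃ v : m, w = 2 * algebraMap l m s * g v :=
        ⟨g.symm ((2 * algebraMap l m s)⁻¹ * w), by
          rw [g.apply_symm_apply, mul_inv_cancel_left₀ (mul_ne_zero h2 hs')]⟩
      have h3 := Submodule.sub_mem _ (Submodule.smul_mem _ s (hφ v)) (hφ (algebraMap l m s * v))
      have h4 : (s • φ v - φ (algebraMap l m s * v) : W.V) =
          ((0, 2 * algebraMap l m s * g v) : m × m) := by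
        refine Prod.ext ?_ ?_
        · change algebraMap l m s * v - algebraMap l m s * v = 0
          rw [sub_self]
        · change algebraMap l m s * g v - g (algebraMap l m s * v) = _
          rw [map_mul, hs'']; ring
      rwa [h4] at h3
    have h3 := Submodule.add_mem _ (hφ v) (h1 ((w : m) - g v))
    let z : W.V := ((0, (w : m) - g v) : m × m)
    have h4 : φ v + z = (((v, w) : m × m) : W.V) :=
      Prod.ext (add_zero (v : m)) (add_sub_cancel (g v) (w : m))
    exact h4 ▸ h3
  · refine (RegForm.finrank_transfer_unary (1 : mˣ)).trans ?_
    refine Eq.trans ?_ (Module.finrank_prod (R := l)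
      (M := (RegForm.transfer l (RegForm.unary (1 : mˣ))).V)
      (M' := (RegForm.transfer l (RegForm.unary (1 : mˣ))).V)).symm
    rw [RegForm.finrank_transfer_unary, ← Module.finrank_mul_finrank k l m, hkl, two_mul]

end Quadratic

end Transfer

/-! ### Marks of virtual sets -/

section DiffVanish

variable {M : Type u} [AddCommMonoid M] {A : Type v} [AddCommGroup A]

theorem diffVanish_sq {D : ℕ} (hD : 3 ≤ D) : DiffVanish D fun z : ℤ => z ^ 2 := by
  intro x y
  have h := congrFun (Polynomial.fwdDiff_iter_eq_zero_of_degree_lt (n := D)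
    (P := (Polynomial.C x + Polynomial.C y * Polynomial.X : Polynomial ℤ) ^ 2)
    (lt_of_le_of_lt (by compute_degree) (show 2 < D by omega))) 0
  rw [fwdDiff_iter_eq_sum_shift] at h
  have h2 := congrArg (fun z => (-1 : ℤ) ^ D * z) h
  simp only [Pi.zero_apply, mul_zero, Finset.mul_sum] at h2
  rw [← h2]
  refine Finset.sum_congr rfl fun k hk => ?_
  have hk' : k ≤ D := by simpa [Nat.lt_succ_iff] using hk
  have e : (-1 : ℤ) ^ D * (-1) ^ (D - k) = (-1) ^ k := by
    rw [← pow_add, show D + (D - k) = 2 * (D - k) + k by omega, pow_add, pow_mul]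
    simp
  simp only [smul_eq_mul, nsmul_eq_mul, ← e, Polynomial.eval_pow, Polynomial.eval_add,
    Polynomial.eval_mul, Polynomial.eval_C, Polynomial.eval_X]
  ring

/-- The value of a polynomial map at a formal difference can be computed after composing with an
additive map to a group, as soon as the polynomial map factors through it. -/
theorem map_diffValue {B : Type*} [AddCommGroup B] {C : Type*} [AddCommGroup C] {D : ℕ} (f : M → A)
    (φ : A →+ B) (ψ : M →+ C) (q : C → B) (hq : DiffVanish D q) (h : ∀ m, φ (f m) = q (ψ m))
    (x y : M) : φ (diffValue D f x y) = q (ψ x - ψ y) := by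
  rw [← hq.diffValue_add, sub_add_cancel, diffValue, diffValue, map_sum]
  refine Finset.sum_congr rfl fun k _ => ?_
  rw [map_zsmul, h, map_add, map_nsmul]

/-- A polynomial map that respects a congruence on genuine elements respects it on formal
differences of congruent elements. -/
theorem diffValue_sub_mem {D : ℕ} {f : M → A} (hf : DiffVanish D f) (I : AddSubgroup A) (x y : M)
    (h : ∀ k : ℕ, f (x + k • y) - f (y + k • y) ∈ I) : diffValue D f x y - f 0 ∈ I := by
  have h0 := hf.diffValue_add 0 y
  rw [zero_add] at h0
  rw [← h0, diffValue, diffValue, ← Finset.sum_sub_distrib]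
  refine sum_mem fun k _ => ?_
  rw [← smul_sub]
  exact I.zsmul_mem (h k) _

theorem diffVanish_addMonoidHom (φ : M →+ A) {D : ℕ} (hD : 2 ≤ D) : DiffVanish D φ := by
  intro x y
  obtain ⟨D, rfl⟩ := Nat.exists_eq_add_of_le hD
  have h0 := Int.alternating_sum_range_choose_of_ne (n := 2 + D) (by omega)
  have h1 : ∑ k ∈ Finset.range (2 + D + 1), ((-1 : ℤ) ^ k * (2 + D).choose k) * k = 0 := by
    rw [Finset.sum_range_succ', Nat.cast_zero, mul_zero, add_zero]
    have h2 := Int.alternating_sum_range_choose_of_ne (n := 1 + D) (by omega)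
    rw [← mul_zero (-(2 + D : ℤ)), ← h2, Finset.mul_sum, show 2 + D = 1 + D + 1 by omega]
    refine Finset.sum_congr rfl fun k _ => ?_
    have := congrArg (Nat.cast : ℕ → ℤ) (Nat.add_one_mul_choose_eq (1 + D) k)
    push_cast at this ⊢
    rw [pow_succ]
    linear_combination (-1 : ℤ) ^ k * this
  simp only [map_add, map_nsmul, smul_add, Finset.sum_add_distrib, ← natCast_zsmul, smul_smul,
    ← Finset.sum_smul, h0, h1, zero_smul, add_zero]

end DiffVanish

section Marks

variable {H : Type u} [Group H]

/-- The number of fixed points of an element, on isomorphism classes of finite sets. -/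
noncomputable def BurnsideSemiring.mark (h : H) : BurnsideSemiring H →+* ℤ where
  toFun := Quotient.lift (fun X : FinGSet H => (Nat.card {x : X // h • x = x} : ℤ))
    fun X Y ⟨e, he⟩ => congrArg Nat.cast (Nat.card_congr (e.subtypeEquiv fun x => by
      rw [← he, e.apply_eq_iff_eq]))
  map_zero' := by
    have : IsEmpty {x : FinGSet.triv H PEmpty.{u + 1} // h • x = x} := ⟨fun x => x.1.elim⟩
    exact congrArg Nat.cast Nat.card_of_isEmpty
  map_one' := by
    have : Unique {x : FinGSet.triv H PUnit.{u + 1} // h • x = x} :=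
      ⟨⟨⟨PUnit.unit, rfl⟩⟩, fun x => rfl⟩
    exact congrArg Nat.cast Nat.card_unique
  map_add' a b := by
    induction a using Quotient.inductionOn with | _ X
    induction b using Quotient.inductionOn with | _ Y
    refine (congrArg Nat.cast ?_).trans (Nat.cast_add (Nat.card {x : X // h • x = x})
      (Nat.card {y : Y // h • y = y}))
    rw [← Nat.card_sum]
    refine Nat.card_congr (Equiv.ofBijective (Sum.elim (fun x => ⟨Sum.inl x.1, congrArg Sum.inl x.2⟩)
      (fun y => ⟨Sum.inr y.1, congrArg Sum.inr y.2⟩)) ⟨?_, ?_⟩).symm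
    · rintro (x | x) (y | y) hxy <;> have h' := congrArg Subtype.val hxy
      · exact congrArg Sum.inl (Subtype.ext (Sum.inl_injective h'))
      · exact absurd h' Sum.inl_ne_inr
      · exact absurd h' Sum.inr_ne_inl
      · exact congrArg Sum.inr (Subtype.ext (Sum.inr_injective h'))
    · rintro ⟨x | y, hx⟩
      · exact ⟨Sum.inl ⟨x, Sum.inl_injective hx⟩, rfl⟩
      · exact ⟨Sum.inr ⟨y, Sum.inr_injective hx⟩, rfl⟩
  map_mul' a b := by
    induction a using Quotient.inductionOn with | _ X
    induction b using Quotient.inductionOn with | _ Y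
    refine (congrArg Nat.cast ?_).trans (Nat.cast_mul (Nat.card {x : X // h • x = x})
      (Nat.card {y : Y // h • y = y}))
    rw [← Nat.card_prod]
    exact Nat.card_congr
      { toFun := fun z => (⟨z.1.1, congrArg Prod.fst z.2⟩, ⟨z.1.2, congrArg Prod.snd z.2⟩)
        invFun := fun z => ⟨(z.1.1, z.2.1), Prod.ext z.1.2 z.2.2⟩
        left_inv := fun _ => rfl
        right_inv := fun _ => rfl }

namespace Burnside

/-- The mark of a virtual set at `h`: the number of fixed points of `h`. -/
noncomputable def mark (h : H) : Burnside H →+* ℤ where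
  toFun := GrothendieckAddGroup.lift (BurnsideSemiring.mark h).toAddMonoidHom
  map_zero' := map_zero _
  map_add' := map_add _
  map_one' := (grothendieck_lift_of _ _).trans (map_one (BurnsideSemiring.mark h))
  map_mul' a b := by
    obtain ⟨x, y, rfl⟩ := grothendieck_exists_rep a
    obtain ⟨z, t, rfl⟩ := grothendieck_exists_rep b
    change GrothendieckAddGroup.lift _ (grothendieckMul _ _ _) = _
    simp only [map_sub, AddMonoidHom.sub_apply, grothendieckMul_of, grothendieck_lift_of,
      RingHom.toAddMonoidHom_eq_coe, AddMonoidHom.coe_coe, map_mul]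
    ring

theorem mark_of_eq (h : H) (x : BurnsideSemiring H) :
    mark h (GrothendieckAddGroup.of x) = BurnsideSemiring.mark h x :=
  grothendieck_lift_of _ _

theorem mark_of (h : H) (X : FinGSet H) : mark h (of X) = Nat.card {x : X // h • x = x} :=
  mark_of_eq h _

theorem exists_rep (z : Burnside H) : ∃ x y : BurnsideSemiring H,
    z = GrothendieckAddGroup.of x - GrothendieckAddGroup.of y := grothendieck_exists_rep z

theorem map_sub_of {A : Type*} [AddCommGroup A] (f : Burnside H →+ A) (x y : BurnsideSemiring H) :
    f (GrothendieckAddGroup.of x - GrothendieckAddGroup.of y) =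
      f (GrothendieckAddGroup.of x) - f (GrothendieckAddGroup.of y) :=
  map_sub f _ _

theorem addHom_ext {A : Type*} [AddCommGroup A] {f g : Burnside H →+ A}
    (h : ∀ X : FinGSet H, f (of X) = g (of X)) : f = g := by
  refine grothendieck_hom_ext fun m => ?_
  induction m using Quotient.inductionOn
  exact h _

variable {L : Type u} [Group L] (φ : L →* H)

theorem mark_pull (l : L) (a : Burnside H) : mark l (pull φ a) = mark (φ l) a := by
  refine DFunLike.congr_fun (addHom_ext (f := (mark l).toAddMonoidHom.comp (pull φ).toAddMonoidHom)
    (g := (mark (φ l)).toAddMonoidHom) fun X => ?_) a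
  refine (congrArg (mark l) (grothendieck_lift_of _ _)).trans ?_
  exact (mark_of l (X.pull φ)).trans (mark_of (φ l) X).symm

theorem mark_quot [Finite H] [IsMulCommutative H] (h : H) (M : Subgroup H) [Decidable (h ∈ M)] :
    mark h (of (FinGSet.quot M)) = if h ∈ M then (M.index : ℤ) else 0 := by
  rw [mark_of]
  have key : ∀ x : H ⧸ M, h • x = x ↔ h ∈ M := fun x => by
    induction x using Quotient.inductionOn with | _ x
    change ((h * x : H) : H ⧸ M) = (x : H ⧸ M) ↔ _
    rw [eq_comm, QuotientGroup.eq, mul_comm' h x, inv_mul_cancel_left]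
  split_ifs with hM
  · rw [Subgroup.index]
    exact congrArg Nat.cast (Nat.card_congr (Equiv.subtypeUnivEquiv fun x => (key x).2 hM))
  · have : IsEmpty {x : FinGSet.quot M // h • x = x} := ⟨fun x => hM ((key x.1).1 x.2)⟩
    exact congrArg Nat.cast Nat.card_of_isEmpty

end Burnside
end Marks

/-! ### Fixed points of induced and coinduced sets -/

section ChangeOfGroup

variable {L H : Type u} [Group L] [Group H] [Finite H] [IsMulCommutative H] {φ : L →* H}

namespace FinGSet

variable (φ) in
/-- The class of `(h, x)` in `H ×_L X`. -/
def indMk (X : FinGSet L) (p : H × X) : ind φ X := Quotient.mk (indSetoid φ X) p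

omit [IsMulCommutative H] in
theorem ind_smul_mk (X : FinGSet L) (h k : H) (x : X) :
    h • indMk φ X (k, x) =
      indMk φ X (h * k, x) := rfl

omit [Finite H] [IsMulCommutative H] in
theorem ind_mk_eq_iff (X : FinGSet L) (p q : H × X) :
    (Quotient.mk (indSetoid φ X) p : Quotient (indSetoid φ X)) = Quotient.mk (indSetoid φ X) q ↔
      ∃ l : L, q = (p.1 * (φ l)⁻¹, l • p.2) :=
  Quotient.eq

theorem ind_fixed_iff (X : FinGSet L) (h k : H) (x : X) :
    h • indMk φ X (k, x) =
      indMk φ X (k, x) ↔ ∃ l, φ l = h ∧ l • x = x := by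
  rw [ind_smul_mk]
  refine (ind_mk_eq_iff X _ _).trans (exists_congr fun l => ?_)
  rw [Prod.ext_iff, mul_comm' h k]
  change k = k * h * (φ l)⁻¹ ∧ x = l • x ↔ _
  rw [eq_mul_inv_iff_mul_eq, mul_right_inj, eq_comm (a := x)]

theorem card_mul_card_ind_fixed (hφ : Function.Injective φ) (X : FinGSet L) (l : L) :
    Nat.card L * Nat.card {q : ind φ X // φ l • q = q} =
      Nat.card H * Nat.card {x : X // l • x = x} := by
  have hfix : ∀ (k : H) (x : X), φ l • indMk φ X (k, x) =
      indMk φ X (k, x) ↔ l • x = x := fun k x => by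
    rw [ind_fixed_iff]
    refine ⟨?_, fun h => ⟨l, rfl, h⟩⟩
    rintro ⟨m, hm, hx⟩
    rwa [hφ hm] at hx
  -- A choice of representatives identifies `H × X^l` with `L × (H ×_L X)^l`, as `L` acts freely.
  rw [← Nat.card_prod, ← Nat.card_prod]
  have hout : ∀ q : Quotient (indSetoid φ X), Quotient.mk (indSetoid φ X) (q.out.1, q.out.2) = q :=
    fun q => Quotient.out_eq q
  have hx : ∀ q : {q : ind φ X // φ l • q = q}, l • (Quotient.out q.1).2 = (Quotient.out q.1).2 :=
    fun q => (hfix (Quotient.out q.1).1 _).1 (by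
      have := hout q.1
      exact (congrArg (fun z : ind φ X => φ l • z) this).trans (q.2.trans this.symm))
  refine Nat.card_congr (Equiv.ofBijective (fun z : L × {q : ind φ X // φ l • q = q} =>
    ((Quotient.out z.2.1).1 * (φ z.1)⁻¹,
      (⟨z.1 • (Quotient.out z.2.1).2, ?_⟩ : {x : X // l • x = x}))) ⟨?_, ?_⟩)
  · have hc : l * z.1 = z.1 * l := hφ (by rw [map_mul, map_mul, mul_comm'])
    rw [smul_smul, hc, mul_smul, hx]
  · rintro ⟨m, q, hq⟩ ⟨m', q', hq'⟩ h
    have h1 := congrArg Prod.fst h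
    have h2 := congrArg (fun z => (z.2 : X)) h
    have hqq : q = q' := by
      refine ((hout q).symm.trans (Quotient.sound ⟨m, rfl⟩)).trans
        (Eq.trans ?_ ((hout q').symm.trans (Quotient.sound ⟨m', rfl⟩)).symm)
      exact congrArg _ (Prod.ext h1 h2)
    subst hqq
    have : m = m' := hφ (inv_injective (mul_left_cancel h1))
    subst this
    rfl
  · rintro ⟨k, x, hkx⟩
    obtain ⟨m, hm⟩ := (ind_mk_eq_iff X _ _).1 (hout (Quotient.mk (indSetoid φ X) (k, x)))
    refine ⟨(m, ⟨indMk φ X (k, x), (hfix k x).2 hkx⟩), ?_⟩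
    exact Prod.ext (congrArg Prod.fst hm).symm (Subtype.ext (congrArg Prod.snd hm).symm)

theorem isEmpty_ind_fixed (X : FinGSet L) {h : H} (hh : h ∉ φ.range) :
    IsEmpty {q : ind φ X // h • q = q} := by
  refine ⟨fun ⟨q, hq⟩ => ?_⟩
  induction q using Quotient.inductionOn with | _ p
  obtain ⟨l, hl, -⟩ := (ind_fixed_iff X h p.1 p.2).1 hq
  exact hh ⟨l, hl⟩

omit [Finite H] [IsMulCommutative H] in
theorem coind_coset_cover (hidx : φ.range.index = 2) {t : H} (ht : t ∉ φ.range) (h : H) :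
    h ∈ φ.range ∨ h * t⁻¹ ∈ φ.range := by
  rw [or_iff_not_imp_left]
  intro hh
  refine (Subgroup.mul_mem_iff_of_index_two hidx).2 ?_
  rw [inv_mem_iff]
  exact ⟨fun h => absurd h hh, fun h => absurd h ht⟩

omit [IsMulCommutative H] in
/-- An equivariant map on a group is determined by its values on representatives of the cosets of
a subgroup of index `2`, and these values are arbitrary. -/
theorem bijective_coind_eval (hφ : Function.Injective φ) (hidx : φ.range.index = 2) {t : H}
    (ht : t ∉ φ.range) (X : FinGSet L) :
    Function.Bijective fun f : coind φ X => (f.1 1, f.1 t) := by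
  constructor
  · intro f f' h
    refine Subtype.ext (funext fun k => ?_)
    rcases coind_coset_cover hidx ht k with ⟨l, rfl⟩ | ⟨l, hl⟩
    · have h1 := f.2 l 1
      have h2 := f'.2 l 1
      rw [mul_one] at h1 h2
      rw [h1, h2]
      exact congrArg (l • ·) (congrArg Prod.fst h)
    · obtain rfl : k = φ l * t := by rw [hl, inv_mul_cancel_right]
      rw [f.2, f'.2]
      exact congrArg (l • ·) (congrArg Prod.snd h)
  · rintro ⟨x, y⟩
    classical
    let e := MonoidHom.ofInjective hφ
    have he : ∀ l, e.symm ⟨φ l, l, rfl⟩ = l := fun l => e.symm_apply_apply l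
    refine ⟨⟨fun h => if hh : h ∈ φ.range then e.symm ⟨h, hh⟩ • x else
      if hh' : h * t⁻¹ ∈ φ.range then e.symm ⟨h * t⁻¹, hh'⟩ • y else x, fun l h => ?_⟩, ?_⟩
    · beta_reduce
      have hmem : φ l * h ∈ φ.range ↔ h ∈ φ.range := Subgroup.mul_mem_cancel_left _ ⟨l, rfl⟩
      by_cases hh : h ∈ φ.range
      · rw [dif_pos hh, dif_pos (hmem.2 hh), smul_smul]
        congr 1
        rw [MulEquiv.symm_apply_eq, map_mul]
        exact Subtype.ext (congrArg (φ l * ·)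
          (congrArg Subtype.val (e.apply_symm_apply ⟨h, hh⟩)).symm)
      · have hh' := (coind_coset_cover hidx ht h).resolve_left hh
        have hh2 : φ l * h * t⁻¹ ∈ φ.range := by
          rw [mul_assoc]
          exact mul_mem ⟨l, rfl⟩ hh'
        rw [dif_neg hh, dif_neg (fun h => hh (hmem.1 h)), dif_pos hh', dif_pos hh2, smul_smul]
        congr 1
        rw [MulEquiv.symm_apply_eq, map_mul]
        refine Subtype.ext ((mul_assoc _ _ _).trans (congrArg (φ l * ·)
          (congrArg Subtype.val (e.apply_symm_apply ⟨h * t⁻¹, hh'⟩)).symm))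
    · have h1 : e.symm ⟨1, one_mem φ.range⟩ = 1 := by
        rw [MulEquiv.symm_apply_eq, map_one]; rfl
      refine Prod.ext ?_ ?_
      · exact (dif_pos (one_mem φ.range)).trans (by rw [h1, one_smul])
      · refine (dif_neg ht).trans ((dif_pos (by rw [mul_inv_cancel]; exact one_mem _)).trans ?_)
        have h2 : e.symm ⟨t * t⁻¹, by rw [mul_inv_cancel]; exact one_mem _⟩ = 1 := by
          rw [MulEquiv.symm_apply_eq, map_one]
          exact Subtype.ext (mul_inv_cancel t)
        rw [h2, one_smul]

theorem card_coind_fixed_of_mem (hφ : Function.Injective φ) (hidx : φ.range.index = 2)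
    (X : FinGSet L) (l : L) :
    Nat.card {f : coind φ X // φ l • f = f} = Nat.card {x : X // l • x = x} ^ 2 := by
  obtain ⟨t, ht⟩ : ∃ t : H, t ∉ φ.range := by
    by_contra! h
    rw [(Subgroup.eq_top_iff' _).2 h, Subgroup.index_top] at hidx
    omega
  have hb := bijective_coind_eval hφ hidx ht X
  have hval : ∀ (f : coind φ X) (k : H), (φ l • f).1 k = l • f.1 k := fun f k => by
    rw [← f.2, mul_comm']; rfl
  rw [sq, ← Nat.card_prod]
  refine Nat.card_congr (((Equiv.ofBijective _ hb).subtypeEquiv (q := fun z => l • z.1 = z.1 ∧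
    l • z.2 = z.2) fun f => ?_).trans
      { toFun := fun z => (⟨z.1.1, z.2.1⟩, ⟨z.1.2, z.2.2⟩)
        invFun := fun z => ⟨(z.1.1, z.2.1), z.1.2, z.2.2⟩
        left_inv := fun _ => rfl
        right_inv := fun _ => rfl })
  rw [← hb.injective.eq_iff, Prod.ext_iff]
  exact and_congr (by change (φ l • f).1 1 = f.1 1 ↔ _; rw [hval]; rfl)
    (by change (φ l • f).1 t = f.1 t ↔ _; rw [hval]; rfl)

omit [IsMulCommutative H] in
/-- For `h` outside a subgroup `L` of index `2`, a function in `Map_L(H, X)` is determined by its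
values at `1` and `h`; it is fixed by `h` exactly when both values are equal and fixed by `h ^ 2`.
-/
theorem card_coind_fixed_of_notMem (hφ : Function.Injective φ) (hidx : φ.range.index = 2)
    (X : FinGSet L) {h : H} (hh : h ∉ φ.range) {m : L} (hm : φ m = h * h) :
    Nat.card {f : coind φ X // h • f = f} = Nat.card {x : X // m • x = x} := by
  have hb := bijective_coind_eval hφ hidx hh X
  have hval1 : ∀ f : coind φ X, (h • f).1 1 = f.1 h := fun f => congrArg f.1 (one_mul h)
  have hval2 : ∀ f : coind φ X, (h • f).1 h = m • f.1 1 := fun f => by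
    rw [← f.2, hm, mul_one]; rfl
  refine Nat.card_congr (((Equiv.ofBijective _ hb).subtypeEquiv (q := fun z => z.2 = z.1 ∧
    m • z.1 = z.2) fun f => ?_).trans
      { toFun := fun z => ⟨z.1.1, z.2.2.trans z.2.1⟩
        invFun := fun x => ⟨(x.1, x.1), rfl, x.2⟩
        left_inv := fun z => Subtype.ext (Prod.ext rfl z.2.1.symm)
        right_inv := fun _ => rfl })
  rw [← hb.injective.eq_iff, Prod.ext_iff]
  exact and_congr (by change (h • f).1 1 = f.1 1 ↔ _; rw [hval1]; rfl)
    (by change (h • f).1 h = f.1 h ↔ _; rw [hval2]; rfl)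

end FinGSet

namespace Burnside

theorem card_mul_mark_ind (hφ : Function.Injective φ) (l : L) (a : Burnside L) :
    (Nat.card L : ℤ) * mark (φ l) (ind φ a) = Nat.card H * mark l a := by
  refine DFunLike.congr_fun (addHom_ext
    (f := (AddMonoidHom.mulLeft (Nat.card L : ℤ)).comp ((mark (φ l)).toAddMonoidHom.comp (ind φ)))
    (g := (AddMonoidHom.mulLeft (Nat.card H : ℤ)).comp (mark l).toAddMonoidHom) fun X => ?_) a
  have h1 : mark (φ l) (ind φ (of X)) = Nat.card {q : FinGSet.ind φ X // φ l • q = q} :=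
    (congrArg (mark (φ l)) (grothendieck_lift_of _ _)).trans (mark_of _ (X.ind φ))
  have h2 : (Nat.card L : ℤ) * mark (φ l) (ind φ (of X)) = Nat.card H * mark l (of X) := by
    rw [h1, mark_of]
    exact_mod_cast FinGSet.card_mul_card_ind_fixed hφ X l
  exact h2

theorem mark_ind_of_notMem {h : H} (hh : h ∉ φ.range) (a : Burnside L) :
    mark h (ind φ a) = 0 := by
  refine DFunLike.congr_fun (addHom_ext (f := (mark h).toAddMonoidHom.comp (ind φ))
    (g := 0) fun X => ?_) a
  refine (congrArg (mark h) (grothendieck_lift_of _ _)).trans ((mark_of _ (X.ind φ)).trans ?_)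
  have := FinGSet.isEmpty_ind_fixed X hh
  exact congrArg Nat.cast Nat.card_of_isEmpty

omit [IsMulCommutative H] in
theorem two_le_card (hidx : φ.range.index = 2) : 2 ≤ Nat.card H :=
  hidx ▸ Nat.le_of_dvd Nat.card_pos φ.range.index_dvd_card

theorem mark_coind_of_mem (hφ : Function.Injective φ) (hidx : φ.range.index = 2) (l : L)
    (a : Burnside L) : mark (φ l) (coind φ a) = mark l a ^ 2 := by
  obtain ⟨x, y, rfl⟩ := exists_rep a
  have h1 := map_diffValue (D := Nat.card H + 1)
    (fun x : BurnsideSemiring L => (GrothendieckAddGroup.of (BurnsideSemiring.coind φ x) :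
      GrothendieckAddGroup (BurnsideSemiring H))) (mark (φ l)).toAddMonoidHom
    (BurnsideSemiring.mark l).toAddMonoidHom (fun z => z ^ 2)
    (diffVanish_sq (by have := two_le_card hidx; omega)) (fun m => by
      induction m using Quotient.inductionOn with | _ X
      refine (mark_of _ (X.coind φ)).trans ?_
      rw [FinGSet.card_coind_fixed_of_mem hφ hidx X l, Nat.cast_pow]
      rfl) x y
  have h2 := map_sub_of (mark l).toAddMonoidHom x y
  refine (congrArg (mark (φ l)) (extendPolynomial_sub _ x y)).trans (h1.trans ?_)
  refine congrArg (· ^ 2) ?_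
  refine Eq.trans ?_ h2.symm
  exact congrArg₂ _ (mark_of_eq l x).symm (mark_of_eq l y).symm

omit [IsMulCommutative H] in
theorem mark_coind_of_notMem (hφ : Function.Injective φ) (hidx : φ.range.index = 2)
    {h : H} (hh : h ∉ φ.range) {m : L} (hm : φ m = h * h) (a : Burnside L) :
    mark h (coind φ a) = mark m a := by
  obtain ⟨x, y, rfl⟩ := exists_rep a
  have h1 := map_diffValue (D := Nat.card H + 1)
    (fun x : BurnsideSemiring L => (GrothendieckAddGroup.of (BurnsideSemiring.coind φ x) :
      GrothendieckAddGroup (BurnsideSemiring H))) (mark h).toAddMonoidHom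
    (BurnsideSemiring.mark m).toAddMonoidHom (fun z => z)
    (diffVanish_addMonoidHom (AddMonoidHom.id ℤ) (by have := two_le_card hidx; omega)) (fun z => by
      induction z using Quotient.inductionOn with | _ X
      refine (mark_of _ (X.coind φ)).trans ?_
      rw [FinGSet.card_coind_fixed_of_notMem hφ hidx X hh hm]
      rfl) x y
  have h2 := map_sub_of (mark m).toAddMonoidHom x y
  refine (congrArg (mark h) (extendPolynomial_sub _ x y)).trans (h1.trans ?_)
  refine Eq.trans ?_ h2.symm
  exact congrArg₂ _ (mark_of_eq m x).symm (mark_of_eq m y).symm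

end Burnside
end ChangeOfGroup

/-! ### Decomposition into orbits -/

section Orbits

variable {H : Type u} [Group H] [Finite H]

namespace BurnsideSemiring

theorem mk_eq_sum_quot (X : FinGSet H) [Fintype (MulAction.orbitRel.Quotient H X)] :
    mk X = ∑ ω : MulAction.orbitRel.Quotient H X,
      mk (FinGSet.quot (MulAction.stabilizer H ω.out)) := by
  classical
  have h := mk_sub_insert X (ι := MulAction.orbitRel.Quotient H X)
    (fun x => Quotient.mk (MulAction.orbitRel H X) x)
    (fun g x => Quotient.sound ⟨g, rfl⟩) Finset.univ
  have h0 : mk X = mk (X.sub (fun x => (Quotient.mk (MulAction.orbitRel H X) x :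
      MulAction.orbitRel.Quotient H X) ∈ Finset.univ) fun g x h => Finset.mem_univ _) :=
    mk_eq (Y := FinGSet.sub _ _ _)
      (Equiv.subtypeUnivEquiv fun x => Finset.mem_univ _).symm fun _ _ => rfl
  refine h0.trans (h.trans (Finset.sum_congr rfl fun ω _ => ?_))
  symm
  have hmem : ∀ h : H, (Quotient.mk (MulAction.orbitRel H X) (h • ω.out) :
      MulAction.orbitRel.Quotient H X) = ω := fun h =>
    (Quotient.sound (s := MulAction.orbitRel H X) (b := ω.out) ⟨h, rfl⟩).trans (Quotient.out_eq ω)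
  refine mk_eq (X := FinGSet.quot _) (Y := FinGSet.sub _ _ _) (Equiv.ofBijective
    (fun q : H ⧸ MulAction.stabilizer H ω.out =>
      ⟨MulAction.ofQuotientStabilizer H ω.out q, ?_⟩) ⟨?_, ?_⟩) fun g q => ?_
  · induction q using Quotient.inductionOn
    exact hmem _
  · intro q r h
    exact MulAction.injective_ofQuotientStabilizer H ω.out (congrArg Subtype.val h)
  · rintro ⟨x, hx⟩
    obtain ⟨g, hg⟩ := Quotient.exact (hx.trans (Quotient.out_eq ω).symm)
    exact ⟨(g : H ⧸ MulAction.stabilizer H ω.out), Subtype.ext hg⟩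
  · exact Subtype.ext (MulAction.ofQuotientStabilizer_smul H ω.out g q)

theorem coind_comp {L J : Type u} [Group L] [Group J] [Finite J] (φ : L →* H) (ψ : H →* J)
    (x : BurnsideSemiring L) : coind (ψ.comp φ) x = coind ψ (coind φ x) := by
  induction x using Quotient.inductionOn with | _ X
  refine mk_eq (X := FinGSet.coind (ψ.comp φ) X) (Y := FinGSet.coind ψ (FinGSet.coind φ X))
    { toFun := fun f => ⟨fun j => ⟨fun h => f.1 (ψ h * j), fun l h => ?_⟩, fun h j => ?_⟩
      invFun := fun f => ⟨fun j => (f.1 j).1 1, fun l j => ?_⟩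
      left_inv := fun f => Subtype.ext (funext fun j => ?_)
      right_inv := fun f => Subtype.ext (funext fun j => Subtype.ext (funext fun h => ?_)) }
    fun j f => ?_
  · have h1 : ψ (φ l * h) * j = ψ (φ l) * (ψ h * j) := by rw [map_mul, mul_assoc]
    exact (congrArg f.1 h1).trans (f.2 l _)
  · refine Subtype.ext (funext fun h' => ?_)
    change f.1 (ψ h' * (ψ h * j)) = f.1 (ψ (h' * h) * j)
    rw [map_mul, mul_assoc]
  · have h1 : f.1 (ψ (φ l) * j) = φ l • f.1 j := f.2 _ _
    have h2 : (φ l • f.1 j).1 1 = (f.1 j).1 (1 * φ l) := rfl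
    change (f.1 (ψ (φ l) * j)).1 1 = _
    rw [h1, h2, one_mul, ← mul_one (φ l)]
    exact (f.1 j).2 l 1
  · change f.1 (ψ 1 * j) = _
    rw [map_one, one_mul]
  · change (f.1 (ψ h * j)).1 1 = _
    rw [f.2]
    exact congrArg (f.1 j).1 (one_mul h)
  · refine Subtype.ext (funext fun j' => Subtype.ext (funext fun h => ?_))
    exact congrArg f.1 (mul_assoc _ _ _)

end BurnsideSemiring

namespace Burnside

theorem mem_closure_quot (z : Burnside H) :
    z ∈ AddSubgroup.closure (Set.range fun M : Subgroup H => of (FinGSet.quot M)) := by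
  have h : ∀ x : BurnsideSemiring H, GrothendieckAddGroup.of x ∈
      (AddSubgroup.closure (Set.range fun M : Subgroup H => of (FinGSet.quot M)) :
        AddSubgroup (Burnside H)) := fun x => by
    induction x using Quotient.inductionOn with | _ X
    have := Fintype.ofFinite (MulAction.orbitRel.Quotient H X)
    have h1 : GrothendieckAddGroup.of (BurnsideSemiring.mk X) = ∑ ω : MulAction.orbitRel.Quotient H X,
      of (FinGSet.quot (MulAction.stabilizer H ω.out)) := by
      rw [BurnsideSemiring.mk_eq_sum_quot, map_sum]; rfl
    have h2 : (∑ ω : MulAction.orbitRel.Quotient H X,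
        of (FinGSet.quot (MulAction.stabilizer H ω.out)) : Burnside H) ∈
        AddSubgroup.closure (Set.range fun M : Subgroup H => of (FinGSet.quot M)) :=
      sum_mem fun ω _ => AddSubgroup.subset_closure ⟨_, rfl⟩
    exact h1 ▸ h2
  obtain ⟨x, y, rfl⟩ := exists_rep z
  exact AddSubgroup.sub_mem _ (h x) (h y)

/-- Coinduction of virtual sets preserves congruences modulo ideals, up to its value at `0`, if
coinduction of genuine sets does. -/
theorem coind_sub_mem {L : Type u} [Group L] (φ : L →* H) (I : AddSubgroup (Burnside L))
    (J : AddSubgroup (Burnside H))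
    (h : ∀ x y : BurnsideSemiring L,
      (GrothendieckAddGroup.of x - GrothendieckAddGroup.of y : Burnside L) ∈ I →
      (GrothendieckAddGroup.of (BurnsideSemiring.coind φ x) -
        GrothendieckAddGroup.of (BurnsideSemiring.coind φ y) : Burnside H) ∈ J)
    (a : Burnside L) (ha : a ∈ I) : coind φ a - coind φ 0 ∈ J := by
  obtain ⟨x, y, rfl⟩ := exists_rep a
  have h1 : coind φ (GrothendieckAddGroup.of x - GrothendieckAddGroup.of y) =
    diffValue (Nat.card H + 1) _ x y := extendPolynomial_sub (coind_diffVanish φ) x y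
  have h2 : coind φ 0 = GrothendieckAddGroup.of (BurnsideSemiring.coind φ 0) :=
    (congrArg (coind φ) (map_zero GrothendieckAddGroup.of).symm).trans
      (extendPolynomial_of (coind_diffVanish φ) 0)
  rw [h1, h2]
  refine diffValue_sub_mem (coind_diffVanish φ) J x y fun k => h _ _ ?_
  have h3 : (GrothendieckAddGroup.of (x + k • y) - GrothendieckAddGroup.of (y + k • y) :
      GrothendieckAddGroup (BurnsideSemiring L)) =
      GrothendieckAddGroup.of x - GrothendieckAddGroup.of y := by
    rw [map_add, map_add, add_sub_add_right_eq_sub]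
  exact (show (GrothendieckAddGroup.of (x + k • y) - GrothendieckAddGroup.of (y + k • y) :
    Burnside L) = _ from h3) ▸ ha

theorem coind_of {L : Type u} [Group L] (φ : L →* H) (x : BurnsideSemiring L) :
    coind φ (GrothendieckAddGroup.of x) =
      GrothendieckAddGroup.of (BurnsideSemiring.coind φ x) :=
  extendPolynomial_of (coind_diffVanish φ) x

end Burnside
end Orbits

/-! ### Subgroups of a cyclic `2`-group -/

section Cyclic

variable {G : Type u} [Group G] [IsCyclic G]

instance isMulCommutative_of_isCyclic : IsMulCommutative G :=
  ⟨⟨fun a b => by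
    obtain ⟨g, hg⟩ := IsCyclic.exists_generator (α := G)
    obtain ⟨i, rfl⟩ := hg a
    obtain ⟨j, rfl⟩ := hg b
    exact zpow_mul_comm g i j⟩⟩

theorem mem_cyc {i : ℕ} {g : G} : g ∈ cyc G i ↔ g ^ 2 ^ i = 1 := by
  refine ⟨fun h => ?_, fun h => Subgroup.subset_closure h⟩
  induction h using Subgroup.closure_induction with
  | mem x hx => exact hx
  | one => exact one_pow _
  | mul x y _ _ hx hy => rw [Commute.mul_pow (mul_comm' x y), hx, hy, one_mul]
  | inv x _ hx => rw [inv_pow, hx, inv_one]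

theorem sq_mem_cyc {i : ℕ} {g : G} (hg : g ∈ cyc G (i + 1)) : g * g ∈ cyc G i := by
  rw [mem_cyc] at hg ⊢
  rw [← sq, ← pow_mul, ← pow_succ', hg]

variable [Finite G] {n : ℕ} (hG : Nat.card G = 2 ^ n)
include hG

theorem exists_generator_cyc {i : ℕ} (hi : i ≤ n) :
    ∃ g : G, orderOf g = 2 ^ i ∧ cyc G i = Subgroup.zpowers g := by
  obtain ⟨g, hg⟩ := IsCyclic.exists_ofOrder_eq_natCard (α := G)
  rw [hG] at hg
  have ho : orderOf (g ^ 2 ^ (n - i)) = 2 ^ i := by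
    rw [orderOf_pow_of_dvd (by positivity) (hg ▸ pow_dvd_pow 2 (by omega)), hg,
      Nat.pow_div (by omega) (by norm_num)]
    congr 1; omega
  refine ⟨_, ho, (Subgroup.eq_of_le_of_card_ge ?_ ?_).symm⟩
  · rw [Subgroup.zpowers_le, mem_cyc, ← ho, pow_orderOf_eq_one]
  · rw [Nat.card_zpowers, ho]
    classical
    have := Fintype.ofFinite G
    have h := IsCyclic.card_pow_eq_one_le (α := G) (n := 2 ^ i) (by positivity)
    rw [← Nat.subtype_card (p := fun g => g ∈ cyc G i) _ fun g => by simp [mem_cyc]]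
      at h
    exact h

theorem card_cyc {i : ℕ} (hi : i ≤ n) : Nat.card (cyc G i) = 2 ^ i := by
  obtain ⟨g, ho, hg⟩ := exists_generator_cyc hG hi
  rw [hg, Nat.card_zpowers, ho]

theorem exists_eq_cyc (M : Subgroup G) : ∃ i ≤ n, M = cyc G i := by
  obtain ⟨i, hi, h⟩ := (Nat.dvd_prime_pow Nat.prime_two).1 (hG ▸ Subgroup.card_subgroup_dvd_card M)
  refine ⟨i, hi, Subgroup.eq_of_le_of_card_ge (fun g hg => ?_) (by rw [card_cyc hG hi, h])⟩
  rw [mem_cyc, ← h]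
  exact congrArg Subtype.val (pow_card_eq_one' (x := (⟨g, hg⟩ : M)))

theorem le_of_cyc_le {i j : ℕ} (hi : i ≤ n) (hj : j ≤ n) (h : cyc G i ≤ cyc G j) : i ≤ j := by
  have := Subgroup.card_le_of_le h
  rw [card_cyc hG hi, card_cyc hG hj] at this
  exact (Nat.pow_le_pow_iff_right (by norm_num)).1 this

theorem index_cyc_subgroupOf {i a : ℕ} (hi : i ≤ n) (ha : a ≤ i) :
    ((cyc G a).subgroupOf (cyc G i)).index = 2 ^ (i - a) := by
  have h := ((cyc G a).subgroupOf (cyc G i)).index_mul_card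
  rw [Nat.card_congr (Subgroup.subgroupOfEquivOfLe (cyc_mono G ha)).toEquiv, card_cyc hG hi,
    card_cyc hG (ha.trans hi)] at h
  refine Nat.eq_of_mul_eq_mul_right (show 0 < 2 ^ a by positivity) (h.trans ?_)
  rw [← pow_add, Nat.sub_add_cancel ha]

end Cyclic

/-! ### The Burnside Tambara functor of a cyclic `2`-group -/

section CyclicBurnside

variable {G : Type u} [Group G] [IsCyclic G] [Finite G]

variable (G) in
/-- The class of `C_{2^i} / C_{2^a}`, for `a ≤ i`. -/
noncomputable def orb (i a : ℕ) : Burnside (cyc G i) :=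
  Burnside.of (FinGSet.quot ((cyc G a).subgroupOf (cyc G i)))

omit [IsCyclic G] in
theorem tset_eq_orb (i j : ℕ) : (tset i j : Burnside (cyc G i)) = orb G i (i - j) := rfl

omit [Finite G] in
theorem burnsideConj_eq_res (g : G) (H : Subgroup G)
    (h : H.map (MulAut.conj g).toMonoidHom ≤ H) (a : Burnside H) :
    burnsideConj g H a = burnsideRes h a := by
  have h1 : ((MulAut.conj g).subgroupMap H).symm.toMonoidHom = Subgroup.inclusion h := by
    ext k
    obtain ⟨l, rfl⟩ := ((MulAut.conj g).subgroupMap H).surjective k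
    change (((MulAut.conj g).subgroupMap H).symm ((MulAut.conj g).subgroupMap H l) : G) = _
    rw [MulEquiv.symm_apply_apply]
    change (l : G) = g * l * g⁻¹
    rw [mul_comm' g, mul_inv_cancel_right]
  rw [burnsideConj, burnsideRes, h1]

omit [IsCyclic G] [Finite G] in
theorem mark_res {L H : Subgroup G} (h : L ≤ H) (g : L) (a : Burnside H) :
    Burnside.mark g (burnsideRes h a) = Burnside.mark ⟨g, h g.2⟩ a :=
  Burnside.mark_pull _ _ _

variable {n : ℕ} (hG : Nat.card G = 2 ^ n)
include hG

section Marks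

open Classical in
theorem mark_orb {i a : ℕ} (hi : i ≤ n) (ha : a ≤ i) (g : cyc G i) :
    Burnside.mark g (orb G i a) = if (g : G) ∈ cyc G a then 2 ^ (i - a) else 0 := by
  rw [orb, Burnside.mark_quot, index_cyc_subgroupOf hG hi ha]
  simp [Subgroup.mem_subgroupOf]

open Classical in
theorem mark_tr {c i : ℕ} (hi : i ≤ n) (hc : c ≤ i) (h : cyc G c ≤ cyc G i) (g : cyc G i)
    (a : Burnside (cyc G c)) : Burnside.mark g (burnsideTr h a) =
      if hg : (g : G) ∈ cyc G c then 2 ^ (i - c) * Burnside.mark ⟨g, hg⟩ a else 0 := by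
  split_ifs with hg
  · have h1 := Burnside.card_mul_mark_ind (Subgroup.inclusion_injective h) ⟨g, hg⟩ a
    have h3 : (2 : ℤ) ^ i = 2 ^ (i - c) * 2 ^ c := by rw [← pow_add, Nat.sub_add_cancel hc]
    rw [card_cyc hG hi, card_cyc hG (hc.trans hi), Nat.cast_pow, Nat.cast_pow, Nat.cast_ofNat,
      h3] at h1
    have h2 : (2 : ℤ) ^ c ≠ 0 := by positivity
    exact mul_left_cancel₀ h2 (h1.trans (by ring))
  · refine Burnside.mark_ind_of_notMem ?_ a
    rintro ⟨l, rfl⟩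
    exact hg l.2

open Classical in
/-- The marks of a norm of index `2`. They are polynomial functions of the marks of the argument,
and the norm extends polynomially from sets to virtual sets, so that the count of fixed points
suffices. -/
theorem mark_norm {i : ℕ} (hi : i + 1 ≤ n) (h : cyc G i ≤ cyc G (i + 1)) (g : cyc G (i + 1))
    (a : Burnside (cyc G i)) : Burnside.mark g (burnsideNorm h a) =
      if hg : (g : G) ∈ cyc G i then Burnside.mark ⟨g, hg⟩ a ^ 2
      else Burnside.mark ⟨g * g, sq_mem_cyc g.2⟩ a := by
  have hidx : (Subgroup.inclusion h).range.index = 2 := by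
    rw [Subgroup.inclusion_range, index_cyc_subgroupOf hG hi (Nat.le_succ i)]
    simp
  split_ifs with hg
  · exact Burnside.mark_coind_of_mem (Subgroup.inclusion_injective h) hidx ⟨g, hg⟩ a
  · refine Burnside.mark_coind_of_notMem (Subgroup.inclusion_injective h) hidx ?_ rfl a
    rintro ⟨l, rfl⟩
    exact hg l.2

end Marks

/-- The transitive sets span the Burnside ring. -/
theorem exists_eq_sum_orb {i : ℕ} (hi : i ≤ n) (z : Burnside (cyc G i)) :
    ∃ c : ℕ → ℤ, z = ∑ a ∈ Finset.range (i + 1), c a • orb G i a := by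
  induction Burnside.mem_closure_quot z using AddSubgroup.closure_induction with
  | mem x hx =>
    obtain ⟨M, rfl⟩ := hx
    obtain ⟨a, ha, h⟩ := exists_eq_cyc hG (M.map (cyc G i).subtype)
    have hai : a ≤ i := le_of_cyc_le hG ha hi (h ▸ Subgroup.map_subtype_le M)
    have hM : M = (cyc G a).subgroupOf (cyc G i) := by
      rw [← h, Subgroup.subgroupOf, Subgroup.comap_map_eq_self_of_injective]
      exact Subtype.val_injective
    refine ⟨fun b => if b = a then 1 else 0, ?_⟩
    rw [Finset.sum_eq_single a]
    · simp only [if_pos, one_smul, hM]; rfl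
    · intro b _ hb
      simp only [if_neg hb, zero_smul]
    · intro hb
      exact absurd (Finset.mem_range.2 (by omega)) hb
  | zero => exact ⟨0, by simp⟩
  | add x y _ _ hx hy =>
    obtain ⟨c, rfl⟩ := hx
    obtain ⟨d, rfl⟩ := hy
    exact ⟨c + d, by simp [add_smul, Finset.sum_add_distrib]⟩
  | neg x _ hx =>
    obtain ⟨c, rfl⟩ := hx
    refine ⟨-c, (Finset.sum_neg_distrib _).symm.trans (Finset.sum_congr rfl fun a _ => ?_)⟩
    exact (neg_smul _ _).symm

/-- A virtual set is determined by its marks, because the marks of the transitive sets form a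
triangular matrix. -/
theorem ext_mark {i : ℕ} (hi : i ≤ n) {y z : Burnside (cyc G i)}
    (h : ∀ g, Burnside.mark g y = Burnside.mark g z) : y = z := by
  classical
  rw [← sub_eq_zero]
  replace h : ∀ g, Burnside.mark g (y - z) = 0 := fun g => by rw [map_sub, h, sub_self]
  generalize y - z = w at h
  obtain ⟨c, rfl⟩ := exists_eq_sum_orb hG hi w
  have hc : ∀ d j, j + d = i → c j = 0 := by
    intro d
    induction d using Nat.strong_induction_on with
    | _ d ih =>
      intro j hj
      obtain ⟨g, ho, hg⟩ := exists_generator_cyc hG (show j ≤ n by omega)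
      have hgj : g ∈ cyc G j := hg ▸ Subgroup.mem_zpowers g
      have h1 := h ⟨g, cyc_mono G (show j ≤ i by omega) hgj⟩
      rw [map_sum, Finset.sum_eq_single j] at h1
      · rw [map_zsmul, mark_orb hG hi (by omega), if_pos hgj, smul_eq_mul] at h1
        exact (mul_eq_zero.1 h1).resolve_right (by positivity)
      · intro a ha haj
        have ha' : a ≤ i := by simpa [Nat.lt_succ_iff] using ha
        rw [map_zsmul, mark_orb hG hi ha']
        rcases lt_or_gt_of_ne haj with hlt | hgt
        · rw [if_neg, smul_zero]
          rw [mem_cyc]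
          intro h2
          have := Nat.le_of_dvd (by positivity) (orderOf_dvd_of_pow_eq_one h2)
          rw [ho] at this
          exact absurd ((Nat.pow_le_pow_iff_right (by norm_num)).1 this) (by omega)
        · rw [ih (i - a) (by omega) a (by omega), zero_smul]
      · intro hj'
        exact absurd (Finset.mem_range.2 (by omega)) hj'
  refine Finset.sum_eq_zero fun a ha => ?_
  have ha' : a < i + 1 := Finset.mem_range.1 ha
  rw [hc (i - a) a (by omega), zero_smul]

section Formulas

variable {i : ℕ} (hi : i ≤ n)
include hi

theorem orb_self : orb G i i = 1 := by
  classical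
  refine ext_mark hG hi fun g => ?_
  rw [mark_orb hG hi le_rfl, if_pos g.2, map_one, Nat.sub_self, pow_zero]

theorem res_orb_of_le {b c : ℕ} (hbc : b ≤ c) (hc : c ≤ i) (h : cyc G c ≤ cyc G i) :
    burnsideRes h (orb G i b) = 2 ^ (i - c) * orb G c b := by
  classical
  refine ext_mark hG (hc.trans hi) fun g => ?_
  rw [mark_res, map_mul, map_pow, map_ofNat, mark_orb hG hi (hbc.trans hc),
    mark_orb hG (hc.trans hi) hbc]
  by_cases h : (g : G) ∈ cyc G b
  · rw [if_pos h, if_pos h, ← pow_add]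
    congr 1; omega
  · rw [if_neg h, if_neg h, mul_zero]

theorem res_orb_of_ge {b c : ℕ} (hcb : c ≤ b) (hb : b ≤ i) (h : cyc G c ≤ cyc G i) :
    burnsideRes h (orb G i b) = 2 ^ (i - b) := by
  classical
  refine ext_mark hG (hcb.trans (hb.trans hi)) fun g => ?_
  rw [mark_res, map_pow, map_ofNat, mark_orb hG hi hb, if_pos (cyc_mono G hcb g.2)]

theorem tr_orb {b c : ℕ} (hbc : b ≤ c) (hc : c ≤ i) (h : cyc G c ≤ cyc G i) :
    burnsideTr h (orb G c b) = orb G i b := by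
  classical
  refine ext_mark hG hi fun g => ?_
  rw [mark_tr hG hi hc, mark_orb hG hi (hbc.trans hc)]
  by_cases hg : (g : G) ∈ cyc G c
  · rw [dif_pos hg, mark_orb hG (hc.trans hi) hbc]
    by_cases h : (g : G) ∈ cyc G b
    · rw [if_pos h, if_pos h, ← pow_add]
      congr 1; omega
    · rw [if_neg h, if_neg h, mul_zero]
  · rw [dif_neg hg, if_neg fun h => hg (cyc_mono G hbc h)]

theorem tr_res_mul {c : ℕ} (hc : c ≤ i) (h : cyc G c ≤ cyc G i) (a : Burnside (cyc G i))
    (b : Burnside (cyc G c)) : burnsideTr h (burnsideRes h a * b) = a * burnsideTr h b := by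
  classical
  refine ext_mark hG hi fun g => ?_
  rw [map_mul (Burnside.mark g), mark_tr hG hi hc, mark_tr hG hi hc]
  by_cases hg : (g : G) ∈ cyc G c
  · rw [dif_pos hg, dif_pos hg, map_mul, mark_res]
    ring
  · rw [dif_neg hg, dif_neg hg, mul_zero]

theorem tr_tr {b c : ℕ} (hbc : b ≤ c) (hc : c ≤ i) (h : cyc G c ≤ cyc G i)
    (h' : cyc G b ≤ cyc G c) (h'' : cyc G b ≤ cyc G i) (a : Burnside (cyc G b)) :
    burnsideTr h (burnsideTr h' a) = burnsideTr h'' a := by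
  classical
  refine ext_mark hG hi fun g => ?_
  rw [mark_tr hG hi hc, mark_tr hG hi (hbc.trans hc)]
  by_cases hg : (g : G) ∈ cyc G c
  · rw [dif_pos hg, mark_tr hG (hc.trans hi) hbc]
    by_cases hb : (g : G) ∈ cyc G b
    · rw [dif_pos hb, dif_pos hb, ← mul_assoc, ← pow_add]
      congr 2; omega
    · rw [dif_neg hb, dif_neg hb, mul_zero]
  · rw [dif_neg hg, dif_neg fun h => hg (h' h)]

end Formulas

section Norm

variable {i : ℕ} (hi : i + 1 ≤ n) (h : cyc G i ≤ cyc G (i + 1))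
include hi

theorem norm_zero : burnsideNorm h 0 = 0 := by
  classical
  refine ext_mark hG hi fun g => ?_
  rw [mark_norm hG hi]
  split_ifs <;> simp

theorem norm_add (a b : Burnside (cyc G i)) :
    burnsideNorm h (a + b) = burnsideNorm h a + burnsideNorm h b + burnsideTr h (a * b) := by
  classical
  refine ext_mark hG hi fun g => ?_
  rw [map_add, map_add, mark_norm hG hi, mark_norm hG hi, mark_norm hG hi,
    mark_tr hG hi (Nat.le_succ i)]
  split_ifs
  · rw [map_add, map_mul, Nat.succ_sub (le_refl i), Nat.sub_self]
    ring
  · rw [map_add, add_zero]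

end Norm

end CyclicBurnside

/-! ### Transfers between intermediate fields -/

section SelfTransfer

variable {k l : Type u} [Field k] [Field l] [Algebra k l] [NeZero (2 : k)] [NeZero (2 : l)]

theorem GW.baseChange_unary_one : GW.baseChange l (GW.unary (1 : kˣ)) = GW.unary (1 : lˣ) := by
  refine (GW.baseChange_of_mk (RegForm.unary (1 : kˣ))).trans (congrArg GrothendieckAddGroup.of
    (FormClasses.mk_baseChange_eq (RegForm.unary (1 : kˣ)) (RegForm.unary (1 : lˣ))
      (algebraMap k l).toAddMonoidHom ?_ ?_ ?_ ?_))
  · intro c (v : k)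
    exact map_mul (algebraMap k l) c v
  · intro (v : k)
    change ((1 : lˣ) : l) * (algebraMap k l v * algebraMap k l v) =
      algebraMap k l (((1 : kˣ) : k) * (v * v))
    rw [Units.val_one, Units.val_one, one_mul, one_mul, map_mul]
  · rw [← top_le_iff]
    rintro (w : l) -
    have h : w • algebraMap k l 1 = w := by rw [map_one, smul_eq_mul, mul_one]
    have h2 : w • algebraMap k l 1 ∈ Submodule.span l (Set.range (algebraMap k l)) :=
      Submodule.smul_mem _ w (Submodule.subset_span ⟨1, rfl⟩)
    exact (congrArg (· ∈ Submodule.span l (Set.range (algebraMap k l))) h).mp h2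
  · exact (Module.finrank_self k).trans (Module.finrank_self l).symm

theorem GW.transfer_unary_one_of_surjective [FiniteDimensional k l] [Algebra.IsSeparable k l]
    (h : Function.Surjective (algebraMap k l)) :
    GW.transfer k (GW.unary (1 : lˣ)) = GW.unary (1 : kˣ) := by
  let e : k ≃ₐ[k] l := AlgEquiv.ofBijective (Algebra.ofId k l) ⟨(algebraMap k l).injective, h⟩
  rw [GW.transfer_unary_one_congr e.symm]
  refine (GW.transfer_of_mk _).trans (congrArg GrothendieckAddGroup.of
    (FormClasses.mk_eq (q := RegForm.transfer k (RegForm.unary (1 : kˣ)))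
      (r := RegForm.unary (1 : kˣ))
      { toFun := id
        invFun := id
        left_inv := fun _ => rfl
        right_inv := fun _ => rfl
        map_add' := fun _ _ => rfl
        map_smul' := fun _ _ => rfl
        map_app' := fun v => (Algebra.trace_self_apply _).symm }))

end SelfTransfer

section FieldTransfer

variable {F : Type v} {K : Type u} [Field F] [Field K] [Algebra F K]

/-- The algebra structure given by an inclusion of intermediate fields. -/
@[reducible] def inclusionAlgebra {E E' : IntermediateField F K} (h : E ≤ E') : Algebra E E' :=
  (IntermediateField.inclusion h).toRingHom.toAlgebra

variable [FiniteDimensional F K]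

/-- An element of the Galois group that fixes `E` and preserves `E'`, as an automorphism of `E'`
over `E`. -/
theorem exists_restrictAut {E E' : IntermediateField F K} (h : E ≤ E') (g : Gal(K/F))
    (hE : ∀ x ∈ E, g x = x) (hE' : ∀ x ∈ E', g x ∈ E') :
    letI := inclusionAlgebra h
    ∃ τ : E' ≃ₐ[E] E', ∀ t : E', (τ t : K) = g t := by
  let _ := inclusionAlgebra h
  have : IsScalarTower F E E' := IsScalarTower.of_algebraMap_eq fun _ => rfl
  have : FiniteDimensional E E' := FiniteDimensional.right F E E'
  let f : E' →ₐ[E] E' :=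
    { toFun := fun t => ⟨g t, hE' t t.2⟩
      map_one' := Subtype.ext (map_one g)
      map_zero' := Subtype.ext (map_zero g)
      map_add' := fun x y => Subtype.ext (map_add g (x : K) y)
      map_mul' := fun x y => Subtype.ext (map_mul g (x : K) y)
      commutes' := fun x => Subtype.ext (hE x x.2) }
  exact ⟨AlgEquiv.ofBijective f (Algebra.IsAlgebraic.algHom_bijective f), fun t => rfl⟩

theorem finrank_inclusionAlgebra {E E' : IntermediateField F K} (h : E ≤ E') :
    letI := inclusionAlgebra h
    Module.finrank E E' * Module.finrank E' K = Module.finrank E K := by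
  let _ := inclusionAlgebra h
  have : IsScalarTower E E' K := IsScalarTower.of_algebraMap_eq fun _ => rfl
  exact Module.finrank_mul_finrank E E' K

variable [IsGalois F K]

theorem fieldTransfer_fieldTransfer {E E' E'' : IntermediateField F K} (h : E ≤ E') (h' : E' ≤ E'')
    (z : GW E'') : fieldTransfer h (fieldTransfer h' z) = fieldTransfer (h.trans h') z := by
  let _ := inclusionAlgebra h
  let _ := inclusionAlgebra h'
  let _ := inclusionAlgebra (h.trans h')
  have : IsScalarTower F E E' := IsScalarTower.of_algebraMap_eq fun _ => rfl
  have : IsScalarTower F E' E'' := IsScalarTower.of_algebraMap_eq fun _ => rfl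
  have : IsScalarTower F E E'' := IsScalarTower.of_algebraMap_eq fun _ => rfl
  have : IsScalarTower E E' E'' := IsScalarTower.of_algebraMap_eq fun _ => rfl
  have : FiniteDimensional E E' := FiniteDimensional.right F E E'
  have : FiniteDimensional E' E'' := FiniteDimensional.right F E' E''
  have : FiniteDimensional E E'' := FiniteDimensional.right F E E''
  have : Algebra.IsSeparable E E' := Algebra.isSeparable_tower_top_of_isSeparable F E E'
  have : Algebra.IsSeparable E' E'' := Algebra.isSeparable_tower_top_of_isSeparable F E' E''
  have : Algebra.IsSeparable E E'' := Algebra.isSeparable_tower_top_of_isSeparable F E E''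
  exact GW.transfer_transfer z

variable [NeZero (2 : F)]

theorem fieldTransfer_of_ge {E E' : IntermediateField F K} (h : E ≤ E') (h' : E' ≤ E) :
    fieldTransfer h (GW.unary 1) = GW.unary 1 := by
  let _ := inclusionAlgebra h
  have : IsScalarTower F E E' := IsScalarTower.of_algebraMap_eq fun _ => rfl
  have : FiniteDimensional E E' := FiniteDimensional.right F E E'
  have : Algebra.IsSeparable E E' := Algebra.isSeparable_tower_top_of_isSeparable F E E'
  exact GW.transfer_unary_one_of_surjective (k := E) (l := E') fun x => ⟨⟨x, h' x.2⟩, rfl⟩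

omit [NeZero (2 : F)] in
theorem rank_fieldTransfer {E E' : IntermediateField F K} (h : E ≤ E') (z : GW E') :
    GW.rank E (fieldTransfer h z) * Module.finrank E' K = Module.finrank E K * GW.rank E' z := by
  let _ := inclusionAlgebra h
  have : IsScalarTower F E E' := IsScalarTower.of_algebraMap_eq fun _ => rfl
  have : FiniteDimensional E E' := FiniteDimensional.right F E E'
  have : Algebra.IsSeparable E E' := Algebra.isSeparable_tower_top_of_isSeparable F E E'
  rw [← finrank_inclusionAlgebra h]
  refine (congrArg (· * (Module.finrank E' K : ℤ)) (GW.rank_transfer (k := E) z)).trans ?_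
  push_cast
  ring

/-- Extension of scalars of quadratic forms between intermediate fields. -/
noncomputable def fieldBaseChange {E E' : IntermediateField F K} (h : E ≤ E') : GW E →+ GW E' :=
  letI := inclusionAlgebra h
  GW.baseChange E'

omit [FiniteDimensional F K] [IsGalois F K] in
theorem fieldBaseChange_one {E E' : IntermediateField F K} (h : E ≤ E') :
    fieldBaseChange h (GW.unary 1) = GW.unary 1 := by
  let _ := inclusionAlgebra h
  exact GW.baseChange_unary_one

section Quadratic

variable {E E' : IntermediateField F K} (h : E ≤ E')
  (hdeg : Module.finrank E K = 2 * Module.finrank E' K) {g : Gal(K/F)}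
  (hE : ∀ x ∈ E, g x = x) (hE' : ∀ x ∈ E', g x ∈ E') {s : E'} (hs : g s = -s)
include hdeg hE hE' hs

/-- The transfer of `⟨c⟩` from `E(√Δ)`, for `c` in `E`, between intermediate fields. -/
theorem fieldTransfer_unary_coe {Δ : Eˣ} (hΔ : (s : K) ^ 2 = ((Δ : E) : K)) (c : Eˣ) {c' : E'ˣ}
    (hc : ((c' : E') : K) = ((c : E) : K)) :
    fieldTransfer h (GW.unary c') =
      GW.unary (Units.mk0 2 (NeZero.ne 2) * c) + GW.unary (Units.mk0 2 (NeZero.ne 2) * c * Δ) := by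
  let _ := inclusionAlgebra h
  have : IsScalarTower F E E' := IsScalarTower.of_algebraMap_eq fun _ => rfl
  have : FiniteDimensional E E' := FiniteDimensional.right F E E'
  have : Algebra.IsSeparable E E' := Algebra.isSeparable_tower_top_of_isSeparable F E E'
  have h2 : Module.finrank E E' = 2 :=
    Nat.eq_of_mul_eq_mul_right Module.finrank_pos ((finrank_inclusionAlgebra h).trans hdeg)
  obtain ⟨τ, hτ⟩ := exists_restrictAut h g hE hE'
  exact GW.transfer_unary_algebraMap_of_finrank_two h2 τ (s := s) (Subtype.ext ((hτ s).trans hs))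
    (Subtype.ext hΔ) c (Subtype.ext hc)

theorem fieldTransfer_unary_of_sum_sq {Δ x : Eˣ} {a b : E} (hΔ : (s : K) ^ 2 = ((Δ : E) : K))
    (hab : (Δ : E) = a ^ 2 + b ^ 2) (hb : b ≠ 0) {δ : E'ˣ}
    (hδ : ((δ : E') : K) = 2 * (((x : E) : K) * (((Δ : E) : K) + (a : K) * s))) :
    fieldTransfer h (GW.unary δ) = GW.unary x + GW.unary x := by
  let _ := inclusionAlgebra h
  have : IsScalarTower F E E' := IsScalarTower.of_algebraMap_eq fun _ => rfl
  have : FiniteDimensional E E' := FiniteDimensional.right F E E'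
  have : Algebra.IsSeparable E E' := Algebra.isSeparable_tower_top_of_isSeparable F E E'
  have h2 : Module.finrank E E' = 2 :=
    Nat.eq_of_mul_eq_mul_right Module.finrank_pos ((finrank_inclusionAlgebra h).trans hdeg)
  obtain ⟨τ, hτ⟩ := exists_restrictAut h g hE hE'
  exact GW.transfer_unary_of_finrank_two h2 τ (s := s) (Subtype.ext ((hτ s).trans hs))
    (Subtype.ext hΔ) hab hb (Subtype.ext hδ)

theorem fieldBaseChange_fieldTransfer (hs0 : s ≠ 0) {E'' : IntermediateField F K} (h' : E' ≤ E'')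
    (hE'' : ∀ x ∈ E'', g x ∈ E'') :
    fieldBaseChange h (fieldTransfer (h.trans h') (GW.unary 1)) =
      fieldTransfer h' (GW.unary 1) + fieldTransfer h' (GW.unary 1) := by
  let _ := inclusionAlgebra h
  let _ := inclusionAlgebra h'
  let _ := inclusionAlgebra (h.trans h')
  have : IsScalarTower F E E' := IsScalarTower.of_algebraMap_eq fun _ => rfl
  have : IsScalarTower F E' E'' := IsScalarTower.of_algebraMap_eq fun _ => rfl
  have : IsScalarTower F E E'' := IsScalarTower.of_algebraMap_eq fun _ => rfl
  have : IsScalarTower E E' E'' := IsScalarTower.of_algebraMap_eq fun _ => rfl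
  have : FiniteDimensional E E' := FiniteDimensional.right F E E'
  have : FiniteDimensional E' E'' := FiniteDimensional.right F E' E''
  have : FiniteDimensional E E'' := FiniteDimensional.right F E E''
  have : Algebra.IsSeparable E E' := Algebra.isSeparable_tower_top_of_isSeparable F E E'
  have : Algebra.IsSeparable E' E'' := Algebra.isSeparable_tower_top_of_isSeparable F E' E''
  have : Algebra.IsSeparable E E'' := Algebra.isSeparable_tower_top_of_isSeparable F E E''
  have h2 : Module.finrank E E' = 2 :=
    Nat.eq_of_mul_eq_mul_right Module.finrank_pos ((finrank_inclusionAlgebra h).trans hdeg)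
  obtain ⟨τ, hτ⟩ := exists_restrictAut h g hE hE'
  obtain ⟨τ', hτ'⟩ := exists_restrictAut (h.trans h') g hE hE''
  exact GW.baseChange_transfer_unary_one h2 τ (s := s) (Subtype.ext ((hτ s).trans hs)) hs0 τ'
    fun t => Subtype.ext ((hτ' _).trans (hτ t).symm)

end Quadratic

end FieldTransfer

section Levels

variable {F : Type v} {K : Type u} [Field F] [Field K] [Algebra F K]

theorem apply_mem_levelField [IsCyclic Gal(K/F)] (g : Gal(K/F)) {i : ℕ} {x : K}
    (hx : x ∈ levelField F K i) : g x ∈ levelField F K i := by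
  rw [IntermediateField.mem_fixedField_iff] at hx ⊢
  intro f hf
  have h : f * g = g * f := mul_comm' f g
  exact (DFunLike.congr_fun h x).trans (congrArg g (hx f hf))

theorem apply_eq_of_mem_levelField {g : Gal(K/F)} {i : ℕ} (hg : g ∈ cyc Gal(K/F) i) {x : K}
    (hx : x ∈ levelField F K i) : g x = x :=
  (IntermediateField.mem_fixedField_iff _ _).1 hx g hg

theorem mem_levelField_of_apply_eq {g : Gal(K/F)} {i : ℕ}
    (hg : cyc Gal(K/F) i = Subgroup.zpowers g) {x : K} (hx : g x = x) : x ∈ levelField F K i := by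
  rw [IntermediateField.mem_fixedField_iff]
  intro f hf
  have h : Subgroup.zpowers g ≤ MulAction.stabilizer Gal(K/F) x :=
    Subgroup.zpowers_le.2 hx
  rw [hg] at hf
  exact h hf

variable [FiniteDimensional F K]  [IsCyclic Gal(K/F)] {n : ℕ}
  (hG : Nat.card Gal(K/F) = 2 ^ n)
include hG

theorem finrank_levelField {i : ℕ} (hi : i ≤ n) : Module.finrank (levelField F K i) K = 2 ^ i := by
  rw [IntermediateField.finrank_fixedField_eq_card, card_cyc hG hi]

/-- A generator of `C_{2^(i+1)}` acts on `K^{C_{2^i}}` with an eigenvector for `-1`. -/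
theorem exists_neg_eigenvector {i : ℕ} (hi : i + 1 ≤ n) {g : Gal(K/F)}
    (hg : cyc Gal(K/F) (i + 1) = Subgroup.zpowers g) :
    ∃ s : levelField F K i, s ≠ 0 ∧ g s = -s := by
  have hgm : g ∈ cyc Gal(K/F) (i + 1) := hg ▸ Subgroup.mem_zpowers g
  have hgg : ∀ x ∈ levelField F K i, g (g x) = x := fun x hx =>
    apply_eq_of_mem_levelField (sq_mem_cyc hgm) hx
  obtain ⟨t, ht, hgt⟩ : ∃ t ∈ levelField F K i, g t ≠ t := by
    by_contra! h
    have h1 : levelField F K i ≤ levelField F K (i + 1) := fun x hx =>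
      mem_levelField_of_apply_eq hg (h x hx)
    have h2 : levelField F K i = levelField F K (i + 1) :=
      le_antisymm h1 (levelField_anti F K (Nat.le_succ i))
    have h3 := finrank_levelField hG hi
    rw [← h2, finrank_levelField hG (by omega)] at h3
    exact absurd (Nat.pow_right_injective (le_refl 2) h3) (by omega)
  refine ⟨⟨t - g t, sub_mem ht (apply_mem_levelField g ht)⟩, fun h => hgt ?_, ?_⟩
  · exact (sub_eq_zero.1 (congrArg Subtype.val h)).symm
  · change g (t - g t) = -(t - g t)
    rw [map_sub, hgg t ht, neg_sub]

theorem finrank_levelField_succ {i : ℕ} (hi : i + 1 ≤ n) :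
    Module.finrank (levelField F K (i + 1)) K = 2 * Module.finrank (levelField F K i) K := by
  rw [finrank_levelField hG hi, finrank_levelField hG (by omega), pow_succ']

variable [IsGalois F K] [NeZero (2 : F)]

omit [IsCyclic Gal(K/F)] hG in
theorem dress_orb {i a : ℕ} (ha : a ≤ i) : dress (cyc Gal(K/F) i) (orb Gal(K/F) i a) =
    fieldTransfer (levelField_anti F K ha) (GW.unary 1) := by
  refine (dress_quot _ _).trans ?_
  have key : ∀ (M : Subgroup Gal(K/F)) (h : levelField F K i ≤ IntermediateField.fixedField M),
      M = cyc Gal(K/F) a → fieldTransfer h (GW.unary 1) =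
        fieldTransfer (levelField_anti F K ha) (GW.unary 1) := by
    rintro _ h rfl
    rfl
  exact key _ _ (Subgroup.map_subgroupOf_eq_of_le (cyc_mono _ ha))

theorem dress_one {i : ℕ} (hi : i ≤ n) : dress (cyc Gal(K/F) i) 1 = GW.unary 1 := by
  rw [← orb_self hG hi, dress_orb le_rfl, fieldTransfer_of_ge _ le_rfl]

/-- The Dress maps are compatible with transfers. -/
theorem dress_tr {c i : ℕ} (hi : i ≤ n) (hc : c ≤ i) (h : cyc Gal(K/F) c ≤ cyc Gal(K/F) i)
    (z : Burnside (cyc Gal(K/F) c)) : dress (cyc Gal(K/F) i) (burnsideTr h z) =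
      fieldTransfer (levelField_anti F K hc) (dress (cyc Gal(K/F) c) z) := by
  obtain ⟨w, rfl⟩ := exists_eq_sum_orb hG (hc.trans hi) z
  simp only [map_sum, map_zsmul]
  refine Finset.sum_congr rfl fun a ha => ?_
  have ha : a ≤ c := by simpa [Nat.lt_succ_iff] using ha
  rw [tr_orb hG hi ha hc, dress_orb (ha.trans hc), dress_orb ha, fieldTransfer_fieldTransfer]

/-- The Dress maps are compatible with restrictions of index `2`. -/
theorem dress_res {i : ℕ} (hi : i + 1 ≤ n) (h : cyc Gal(K/F) i ≤ cyc Gal(K/F) (i + 1))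
    (z : Burnside (cyc Gal(K/F) (i + 1))) : dress (cyc Gal(K/F) i) (burnsideRes h z) =
      fieldBaseChange (levelField_anti F K (Nat.le_succ i)) (dress (cyc Gal(K/F) (i + 1)) z) := by
  obtain ⟨w, rfl⟩ := exists_eq_sum_orb hG hi z
  simp only [map_sum, map_zsmul]
  refine Finset.sum_congr rfl fun a ha => ?_
  have ha : a ≤ i + 1 := by simpa [Nat.lt_succ_iff] using ha
  rcases ha.eq_or_lt with rfl | ha
  · rw [orb_self hG hi, map_one, dress_one hG hi, dress_one hG (by omega), fieldBaseChange_one]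
  · obtain ⟨g, -, hg⟩ := exists_generator_cyc hG hi
    have hgm : g ∈ cyc Gal(K/F) (i + 1) := hg ▸ Subgroup.mem_zpowers g
    obtain ⟨s, hs0, hs⟩ := exists_neg_eigenvector hG hi hg
    rw [res_orb_of_le hG hi (Nat.le_of_lt_succ ha) (Nat.le_succ i), Nat.succ_sub le_rfl, Nat.sub_self,
      pow_one, two_mul, map_add, dress_orb (Nat.le_of_lt_succ ha), dress_orb ha.le]
    congr 1
    exact (fieldBaseChange_fieldTransfer (levelField_anti F K (Nat.le_succ i))
      (finrank_levelField_succ hG hi) (fun x hx => apply_eq_of_mem_levelField hgm hx)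
      (fun x hx => apply_mem_levelField g hx) hs hs0
      (levelField_anti F K (Nat.le_of_lt_succ ha)) (fun x hx => apply_mem_levelField g hx)).symm

theorem rank_dress_orb {i a : ℕ} (hi : i ≤ n) (ha : a ≤ i) :
    GW.rank _ (dress (cyc Gal(K/F) i) (orb Gal(K/F) i a)) = 2 ^ (i - a) := by
  have h := rank_fieldTransfer (levelField_anti F K ha) (GW.unary 1)
  rw [finrank_levelField hG hi, finrank_levelField hG (ha.trans hi), GW.rank_unary, mul_one] at h
  rw [dress_orb ha]
  have h2 : (2 : ℤ) ^ a ≠ 0 := by positivity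
  refine mul_right_cancel₀ h2 ?_
  rw [← pow_add, Nat.sub_add_cancel ha]
  exact_mod_cast h

end Levels

/-! ### Cyclic quartic extensions and their trace forms -/

section Quartic

variable {L N : Type u} [Field L] [Field N] [Algebra L N] [NeZero (2 : L)] (ρ : N ≃ₐ[L] N)

/-- Let `T₁ = ⟨2⟩ + ⟨2Δ⟩` and `T₂ = ⟨1⟩ + ⟨Δ⟩ + 2⟨x⟩` be the trace forms of the quadratic and of the
quartic level of a cyclic extension. If some `c` is represented by `⟨2, 2Δ⟩`, by `⟨1, -Δ⟩` and by
`⟨x, x⟩`, then `T₂ = T₁ + 2⟨1⟩`. -/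
theorem GW.quartic_eq_of_represents {Δ x : Lˣ} {u v u' v' r t : L} {c : Lˣ}
    (h1 : (c : L) = 2 * u ^ 2 + 2 * Δ * v ^ 2) (h2 : (c : L) = u' ^ 2 - Δ * v' ^ 2)
    (h3 : (c : L) = x * (r ^ 2 + t ^ 2)) :
    GW.unary 1 + GW.unary Δ + (GW.unary x + GW.unary x) =
      GW.unary (Units.mk0 2 (NeZero.ne 2)) + GW.unary (Units.mk0 2 (NeZero.ne 2) * Δ) +
        (GW.unary 1 + GW.unary 1) := by
  have e1 := GW.unary_add_unary (a := Units.mk0 2 (NeZero.ne 2)) (b := Units.mk0 2 (NeZero.ne 2) * Δ)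
    (c := c) u v (by push_cast; rw [Units.val_mk0, h1])
  have e1' : GW.unary (Units.mk0 2 (NeZero.ne 2) * (Units.mk0 2 (NeZero.ne 2) * Δ) * c) =
      GW.unary (Δ * c) := GW.unary_eq_of_sq (Units.mk0 2 (NeZero.ne 2))
        (by push_cast; rw [Units.val_mk0]; ring)
  have hd : ((c / x : Lˣ) : L) = r ^ 2 + t ^ 2 := by
    rw [Units.val_div_eq_div_val, h3, mul_div_cancel_left₀ _ x.ne_zero]
  have e2 := GW.two_unary_mul r t hd x
  rw [mul_div_cancel] at e2
  obtain ⟨y, z, hyz⟩ : ∃ y z : L, ((1 : Lˣ) : L) = Δ * y ^ 2 + c * z ^ 2 := by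
    by_cases hu : u' = 0
    · -- then `⟨Δ, c⟩` is a hyperbolic plane
      have hv : v' ≠ 0 := by
        rintro rfl
        exact c.ne_zero (by rw [h2, hu]; ring)
      have h4 : (2 : L) ≠ 0 := NeZero.ne 2
      have hΔ := Δ.ne_zero
      refine ⟨((Δ : L)⁻¹ + 1) / 2, (((Δ : L)⁻¹ - 1) / 2) / v', ?_⟩
      rw [h2, hu, Units.val_one]
      field_simp
      ring
    · refine ⟨v' / u', 1 / u', ?_⟩
      rw [h2, Units.val_one]
      field_simp
      ring
  have e3 := GW.unary_add_unary y z hyz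
  rw [mul_one] at e3
  rw [e1, e1', e2, add_add_add_comm, e3]
  abel

section Eigenvector

variable {ρ}

/-- If `η` is an eigenvector for `-1` of the fourth power of `ρ`, then the trace form of the quartic
extension fixed by `ρ ^ 4` is determined. The element `ε = η ^ 2` has `ρ ε = y ^ 2 ε`, where
`y = ρ η / η` has norm `-1`, and the three representations of the norm of `ε + ρ ^ 2 ε` below come
from the components of `y ε` under `ρ ^ 2`. -/
theorem GW.quartic_eq_of_neg_eigenvector (hfix : ∀ t, ρ t = t → ∃ l, algebraMap L N l = t)
    {s θ η : N} {Δ x : Lˣ} {a b : L} (hs : ρ s = -s) (hΔ : s ^ 2 = algebraMap L N Δ)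
    (hab : (Δ : L) = a ^ 2 + b ^ 2) (hθ : ρ (ρ θ) = -θ) (hθ0 : θ ≠ 0)
    (hδ : θ ^ 2 = algebraMap L N x * (algebraMap L N Δ + algebraMap L N a * s))
    (hη : ρ (ρ (ρ (ρ η))) = -η) (hη0 : η ≠ 0) :
    GW.unary 1 + GW.unary Δ + (GW.unary x + GW.unary x) =
      GW.unary (Units.mk0 2 (NeZero.ne 2)) + GW.unary (Units.mk0 2 (NeZero.ne 2) * Δ) +
        (GW.unary 1 + GW.unary 1) := by
  have h2 : (2 : N) ≠ 0 := by
    rw [← map_ofNat (algebraMap L N) 2]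
    exact (map_ne_zero _).2 (NeZero.ne 2)
  have hs0 : s ≠ 0 := by
    rintro rfl
    exact Δ.ne_zero ((map_eq_zero (algebraMap L N)).1 (by rw [← hΔ]; ring))
  -- Multiplying `η` by `1 + θ`, one may assume that `ε + ρ ^ 2 ε` is nonzero.
  obtain ⟨η, hη, hη0, hp0⟩ : ∃ η, ρ (ρ (ρ (ρ η))) = -η ∧ η ≠ 0 ∧ η ^ 2 + ρ (ρ η) ^ 2 ≠ 0 := by
    by_cases hp : η ^ 2 + ρ (ρ η) ^ 2 = 0
    · have h1 : 1 + θ ≠ 0 := fun h => by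
        have h3 : θ = -1 := by linear_combination h
        rw [h3, map_neg, map_neg, map_one, map_one] at hθ
        exact h2 (by linear_combination -hθ)
      refine ⟨η * (1 + θ), ?_, mul_ne_zero hη0 h1, fun h => ?_⟩
      · simp only [map_mul, map_add, map_one, hη, hθ, map_neg]; ring
      · simp only [map_mul, map_add, map_one, hθ] at h
        have h3 : 2 * 2 * θ * η ^ 2 = 0 := by linear_combination h - (1 - θ) ^ 2 * hp
        simp [h2, hθ0, hη0] at h3
    · exact ⟨η, hη, hη0, hp⟩
  have hfix2 : ∀ t, ρ (ρ t) = t → ∃ l m, t = algebraMap L N l + algebraMap L N m * s := by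
    intro t ht
    obtain ⟨l, hl⟩ := hfix ((t + ρ t) / 2) (by rw [map_div₀, map_add, ht, map_ofNat, add_comm])
    obtain ⟨m, hm⟩ := hfix ((t - ρ t) / (2 * s)) (by
      rw [map_div₀, map_sub, ht, map_mul, map_ofNat, hs, mul_neg, div_neg, ← neg_div, neg_sub])
    exact ⟨l, m, by rw [hl, hm]; field_simp; ring⟩
  set η1 := ρ η with hη1
  set η2 := ρ η1 with hη2
  set η3 := ρ η2 with hη3
  have hρ3 : ρ η3 = -η := hη
  obtain ⟨c, hc⟩ := hfix ((η ^ 2 + η2 ^ 2) * (η1 ^ 2 + η3 ^ 2)) (by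
    simp only [map_mul, map_add, map_pow, ← hη1, ← hη2, ← hη3, hρ3]; ring)
  have hc0 : c ≠ 0 := by
    rintro rfl
    rw [map_zero] at hc
    have h3 : ρ (η ^ 2 + η2 ^ 2) = η1 ^ 2 + η3 ^ 2 := by
      simp only [map_add, map_pow, ← hη1, ← hη3]
    rw [← h3] at hc
    rcases mul_eq_zero.1 hc.symm with h | h
    · exact hp0 h
    · exact hp0 ((map_eq_zero ρ).1 h)
  obtain ⟨u, v, hP⟩ := hfix2 (η * η1 + η2 * η3) (by
    simp only [map_add, map_mul, ← hη1, ← hη2, ← hη3, hρ3, map_neg]; ring)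
  obtain ⟨u', v', hp⟩ := hfix2 (η ^ 2 + η2 ^ 2) (by
    simp only [map_add, map_pow, ← hη1, ← hη2, ← hη3, hρ3]; ring)
  obtain ⟨q, q', hQ⟩ := hfix2 ((η * η1 - η2 * η3) / θ) (by
    simp only [map_div₀, map_sub, map_mul, ← hη1, ← hη2, ← hη3, hρ3, map_neg, hθ]
    rw [div_neg, ← neg_div]
    congr 1; ring)
  rw [div_eq_iff hθ0] at hQ
  have hP' := congrArg ρ hP
  have hp' := congrArg ρ hp
  simp only [map_add, map_mul, map_pow, ← hη1, ← hη2, ← hη3, hρ3, AlgEquiv.commutes, hs] at hP' hp'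
  have hQ2 : (η * η1 - η2 * η3) ^ 2 = (algebraMap L N q + algebraMap L N q' * s) ^ 2 *
      (algebraMap L N x * (algebraMap L N Δ + algebraMap L N a * s)) := by
    rw [hQ, mul_pow, hδ]
  have hQ2' := congrArg ρ hQ2
  simp only [map_sub, map_add, map_mul, map_pow, ← hη1, ← hη2, ← hη3, hρ3, AlgEquiv.commutes, hs]
    at hQ2'
  have hinj := (algebraMap L N).injective
  refine GW.quartic_eq_of_represents (c := Units.mk0 c hc0) (u := u) (v := v) (u' := u') (v' := v')
    (r := a * (q + a * q') - b * (b * q') + (a * (b * q') + b * (q + a * q')))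
    (t := a * (q + a * q') - b * (b * q') - (a * (b * q') + b * (q + a * q'))) ?_ ?_ ?_
  · rw [Units.val_mk0]
    apply hinj
    simp only [map_add, map_mul, map_pow, map_ofNat]
    rw [hc, ← hΔ]
    have : (η ^ 2 + η2 ^ 2) * (η1 ^ 2 + η3 ^ 2) =
        (η * η1 + η2 * η3) ^ 2 + (η1 * η2 + η3 * -η) ^ 2 := by ring
    rw [this, hP, hP']
    ring
  · rw [Units.val_mk0]
    apply hinj
    simp only [map_sub, map_mul, map_pow]
    rw [hc, ← hΔ, hp, hp']
    ring
  · rw [Units.val_mk0]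
    apply hinj
    have : (η ^ 2 + η2 ^ 2) * (η1 ^ 2 + η3 ^ 2) =
        (η * η1 - η2 * η3) ^ 2 + (η1 * η2 - η3 * -η) ^ 2 := by ring
    rw [hc, this, hQ2, hQ2', hab]
    rw [hab, map_add, map_pow, map_pow] at hΔ
    simp only [map_sub, map_add, map_mul, map_pow]
    linear_combination (2 * algebraMap L N x * (algebraMap L N q' ^ 2 *
      (algebraMap L N a ^ 2 + algebraMap L N b ^ 2) + 2 * algebraMap L N q * algebraMap L N q' *
        algebraMap L N a)) * hΔ

end Eigenvector

omit [Algebra L N] in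
/-- If `⟨a⟩ + ⟨b⟩ = ⟨c⟩ + ⟨d⟩` in `GW L`, then `⟨a, b⟩` represents `c`, by Witt cancellation. -/
theorem GW.exists_represents_of_two {a b c d : Lˣ}
    (h : GW.unary a + GW.unary b = GW.unary c + GW.unary d) :
    ∃ u v : L, (c : L) = a * u ^ 2 + b * v ^ 2 := by
  obtain ⟨e⟩ := GW.equivalent_of_eq (q := (RegForm.unary a).sum (RegForm.unary b))
    (r := (RegForm.unary c).sum (RegForm.unary d))
    (by rw [GW.of_mk_add, GW.of_mk_add]; exact h)
  let E : L × L → L × L := fun w => e w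
  have key : ∀ w : L × L, (a : L) * (w.1 * w.1) + b * (w.2 * w.2) =
      c * ((E w).1 * (E w).1) + d * ((E w).2 * (E w).2) := fun w => (e.map_app w).symm
  let w : L × L := e.symm ((1, 0) : L × L)
  have h1 := key w
  have h2 : E w = ((1, 0) : L × L) :=
    e.toLinearEquiv.apply_symm_apply _
  rw [h2] at h1
  have h3 := h1.trans (show (c : L) * (1 * 1) + d * (0 * 0) = c by ring)
  exact ⟨w.1, w.2, by linear_combination -h3⟩

omit [Algebra L N] in
/-- If `⟨a⟩ + ⟨b⟩ + ⟨c⟩ - ⟨d⟩` is the class of a form, then `⟨a, b, c⟩` represents `d`. -/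
theorem GW.exists_represents_of_three {a b c d : Lˣ} {z : GW L}
    (h : GW.unary a + (GW.unary b + GW.unary c) = GW.unary d + z) {q : RegForm L}
    (hz : z = GrothendieckAddGroup.of (FormClasses.mk q)) :
    ∃ u v w : L, (d : L) = a * u ^ 2 + (b * v ^ 2 + c * w ^ 2) := by
  subst hz
  obtain ⟨e⟩ := GW.equivalent_of_eq
    (q := (RegForm.unary a).sum ((RegForm.unary b).sum (RegForm.unary c)))
    (r := (RegForm.unary d).sum q)
    (by rw [GW.of_mk_add, GW.of_mk_add, GW.of_mk_add]; exact h)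
  let E : L × L × L → L × q.V := fun w => e w
  have key : ∀ w : L × L × L, (a : L) * (w.1 * w.1) + (b * (w.2.1 * w.2.1) + c * (w.2.2 * w.2.2)) =
      d * ((E w).1 * (E w).1) + q.form (E w).2 := fun w => (e.map_app w).symm
  let w : L × L × L := e.symm ((1, 0) : L × q.V)
  have h1 := key w
  have h2 : E w = ((1, 0) : L × q.V) :=
    e.toLinearEquiv.apply_symm_apply _
  rw [h2, QuadraticMap.map_zero] at h1
  have h3 := h1.trans (show (d : L) * (1 * 1) + 0 = d by ring)
  exact ⟨w.1, w.2.1, w.2.2, by linear_combination -h3⟩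

/-- The converse construction: an equality of trace forms produces an element `ε` with
`ρ ε = y ^ 2 ε` for some `y` of norm `-1`. -/
theorem exists_of_quartic_eq {s θ : N} {Δ x : Lˣ} {a b : L}
    (hs : ρ s = -s) (hΔ : s ^ 2 = algebraMap L N Δ)
    (hab : (Δ : L) = a ^ 2 + b ^ 2) (hb : b ≠ 0) (hsq : ¬ IsSquare (Δ : L)) (hθ : ρ (ρ θ) = -θ)
    (hδ : θ ^ 2 = algebraMap L N x * (algebraMap L N Δ + algebraMap L N a * s))
    (h : GW.unary 1 + GW.unary Δ + (GW.unary x + GW.unary x) =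
      GW.unary (Units.mk0 2 (NeZero.ne 2)) + GW.unary (Units.mk0 2 (NeZero.ne 2) * Δ) +
        (GW.unary 1 + GW.unary 1)) :
    ∃ ε y : N, ε ≠ 0 ∧ ρ ε = y ^ 2 * ε ∧ y * ρ y * ρ (ρ y) * ρ (ρ (ρ y)) = -1 := by
  have h2L : (2 : L) ≠ 0 := NeZero.ne 2
  have h2 : (2 : N) ≠ 0 := by
    rw [← map_ofNat (algebraMap L N) 2]
    exact (map_ne_zero _).2 (NeZero.ne 2)
  set two : Lˣ := Units.mk0 2 (NeZero.ne 2) with htwo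
  -- `⟨Δ, x, x⟩` represents `1`
  obtain ⟨f, r, t, hf⟩ : ∃ f r t : L, 1 = Δ * f ^ 2 + x * (r ^ 2 + t ^ 2) := by
    have h1 : GW.unary Δ + (GW.unary x + GW.unary x) =
        GW.unary 1 + (GW.unary two + GW.unary (two * Δ)) := by
      refine add_left_cancel (a := GW.unary (1 : Lˣ)) ?_
      rw [← add_assoc, h]; abel
    obtain ⟨f, r, t, hf⟩ := GW.exists_represents_of_three h1
      (q := (RegForm.unary two).sum (RegForm.unary (two * Δ))) (GW.of_mk_add _ _).symm
    exact ⟨f, r, t, by rw [← Units.val_one, hf]; ring⟩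
  set c : L := 1 - Δ * f ^ 2 with hc
  have hc0 : c ≠ 0 := by
    intro h0
    by_cases hf0 : f = 0
    · rw [hc, hf0] at h0; simp at h0
    · exact hsq ⟨1 / f, by field_simp; linear_combination -h0⟩
  have hcx : c = x * (r ^ 2 + t ^ 2) := by linear_combination hc + hf
  -- `⟨2, 2 Δ⟩` represents `c`
  obtain ⟨u, v, huv⟩ : ∃ u v : L, c = 2 * u ^ 2 + 2 * Δ * v ^ 2 := by
    refine GW.exists_represents_of_two (a := two) (b := two * Δ) (c := Units.mk0 c hc0)
      (d := Units.mk0 c hc0 * Δ) ?_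
    have e1 := GW.unary_add_unary (a := Δ) (b := Units.mk0 c hc0) (c := 1) f 1
      (by rw [Units.val_one, Units.val_mk0, hc]; ring)
    have hd : ((Units.mk0 c hc0 / x : Lˣ) : L) = r ^ 2 + t ^ 2 := by
      rw [Units.val_div_eq_div_val, Units.val_mk0, hcx, mul_div_cancel_left₀ _ x.ne_zero]
    have e2 := GW.two_unary_mul r t hd x
    rw [mul_div_cancel] at e2
    rw [e2] at h
    rw [mul_one, mul_comm] at e1
    refine add_left_cancel (a := GW.unary (1 : Lˣ) + GW.unary 1) ?_
    calc GW.unary (1 : Lˣ) + GW.unary 1 + (GW.unary two + GW.unary (two * Δ))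
        = GW.unary two + GW.unary (two * Δ) + (GW.unary 1 + GW.unary 1) := add_comm _ _
      _ = GW.unary 1 + (GW.unary Δ + GW.unary (Units.mk0 c hc0)) + GW.unary (Units.mk0 c hc0) := by
        rw [← h]; abel
      _ = _ := by rw [e1]; abel
  have hcN : algebraMap L N c ≠ 0 := (map_ne_zero _).2 hc0
  have hb' : algebraMap L N b ≠ 0 := (map_ne_zero _).2 hb
  have hΔ0 : algebraMap L N Δ ≠ 0 := (map_ne_zero _).2 Δ.ne_zero
  have hab' : algebraMap L N Δ = algebraMap L N a ^ 2 + algebraMap L N b ^ 2 := by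
    rw [hab, map_add, map_pow, map_pow]
  -- With `P ^ 2 + (ρ P) ^ 2 = c = Q ^ 2 + (ρ Q) ^ 2` and `p * ρ p = c`, where `ρ ^ 2` fixes `P`, `p`
  -- and negates `Q`, the elements `α = (P + Q) / 2`, `ε = (α ^ 2 + ρ ^ 3 α ^ 2) / ρ p` and
  -- `y = α / ε` are as required.
  set P : N := algebraMap L N u + algebraMap L N v * s with hP
  set p : N := 1 + algebraMap L N f * s with hp
  have hPP : P ^ 2 + ρ P ^ 2 = algebraMap L N c := by
    rw [huv, hP]
    simp only [map_add, map_mul, AlgEquiv.commutes, hs, map_pow, map_ofNat, ← hΔ]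
    ring
  have hpp : p * ρ p = algebraMap L N c := by
    rw [hc, hp]
    simp only [map_add, map_sub, map_one, map_mul, AlgEquiv.commutes, hs, map_pow, ← hΔ]
    ring
  have hP2 : ρ (ρ P) = P := by
    rw [hP]; simp only [map_add, map_mul, AlgEquiv.commutes, hs, map_neg, neg_neg]
  have hp2 : ρ (ρ p) = p := by
    rw [hp]; simp only [map_add, map_one, map_mul, AlgEquiv.commutes, hs, map_neg, neg_neg]
  obtain ⟨q, q', hq⟩ : ∃ q q' : L, c = 2 * x * Δ * ((q + a * q') ^ 2 + (b * q') ^ 2) := by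
    refine ⟨(a * ((r + t) / 2) + b * ((r - t) / 2)) / Δ -
      a * ((a * ((r - t) / 2) - b * ((r + t) / 2)) / Δ / b),
      (a * ((r - t) / 2) - b * ((r + t) / 2)) / Δ / b, ?_⟩
    have hΔ0 := Δ.ne_zero
    rw [sub_add_cancel, mul_div_cancel₀ _ hb, hcx]
    have h4 : ((a * ((r + t) / 2) + b * ((r - t) / 2)) / (Δ : L)) ^ 2 +
        ((a * ((r - t) / 2) - b * ((r + t) / 2)) / Δ) ^ 2 =
        (a ^ 2 + b ^ 2) * (r ^ 2 + t ^ 2) / (2 * Δ ^ 2) := by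
      field_simp
      ring
    rw [h4, ← hab]
    field_simp
  set Q : N := (algebraMap L N q + algebraMap L N q' * s) * θ with hQ
  have hQ2 : ρ (ρ Q) = -Q := by
    rw [hQ]
    simp only [map_add, map_mul, AlgEquiv.commutes, hs, map_neg, neg_neg, hθ, mul_neg]
  have hQQ : Q ^ 2 + ρ Q ^ 2 = algebraMap L N c := by
    have h5 : Q ^ 2 = (algebraMap L N q + algebraMap L N q' * s) ^ 2 *
      (algebraMap L N x * (algebraMap L N Δ + algebraMap L N a * s)) := by
      rw [hQ, mul_pow, hδ]
    rw [← map_pow, h5, hq]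
    simp only [map_add, map_mul, AlgEquiv.commutes, hs, map_pow, map_ofNat]
    rw [← sub_eq_zero]
    linear_combination (2 * algebraMap L N x * (algebraMap L N q' ^ 2 *
      algebraMap L N Δ + 2 * algebraMap L N q * algebraMap L N q' *
        algebraMap L N a)) * hΔ + 2 * algebraMap L N x * algebraMap L N Δ *
        algebraMap L N q' ^ 2 * hab'
  set P' := ρ P with hP'
  set Q' := ρ Q with hQ'
  set p' := ρ p with hp'
  have hQ'2 : ρ Q' = -Q := hQ2
  have hp0 : p ≠ 0 := by rintro h0; rw [h0, zero_mul] at hpp; exact hcN hpp.symm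
  have hp'0 : p' ≠ 0 := by rintro h0; rw [h0, mul_zero] at hpp; exact hcN hpp.symm
  have hα0 : P + Q ≠ 0 := by
    intro h0
    have h6 := congrArg ρ (congrArg ρ h0)
    simp only [map_add, map_zero, ← hP', hP2, ← hQ', hQ'2] at h6
    have h7 : 2 * P = 0 := by linear_combination h0 + h6
    have h8 : P = 0 := (mul_eq_zero.1 h7).resolve_left h2
    rw [hP', h8, map_zero] at hPP
    apply hcN
    rw [← hPP]; ring
  have hα0' : P - Q ≠ 0 := by
    intro h0
    have h6 := congrArg ρ (congrArg ρ h0)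
    simp only [map_sub, map_zero, ← hP', hP2, ← hQ', hQ'2] at h6
    exact hα0 (by linear_combination h6)
  have key : (((P + Q) / 2) ^ 2 + ((P' - Q') / 2) ^ 2) / p' *
      ((((P' + Q') / 2) ^ 2 + ((P + Q) / 2) ^ 2) / p) = ((P + Q) / 2) ^ 2 := by
    rw [div_mul_div_comm, mul_comm p' p, hpp, div_eq_iff hcN]
    have e1 : P' ^ 2 = algebraMap L N c - P ^ 2 := by linear_combination hPP
    have e2 : Q' ^ 2 = algebraMap L N c - Q ^ 2 := by linear_combination hQQ
    field_simp
    have e3 : ((P + Q) ^ 2 + (P' - Q') ^ 2) * ((P' + Q') ^ 2 + (P + Q) ^ 2) =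
      ((P + Q) ^ 2 + P' ^ 2 + Q' ^ 2) ^ 2 - 4 * (P' ^ 2 * Q' ^ 2) := by ring
    rw [e3, e1, e2]
    ring
  have hε0 : (((P + Q) / 2) ^ 2 + ((P' - Q') / 2) ^ 2) / p' ≠ 0 := by
    intro h0
    rw [h0, zero_mul] at key
    exact pow_ne_zero 2 (div_ne_zero hα0 h2) key.symm
  have hρε : ρ ((((P + Q) / 2) ^ 2 + ((P' - Q') / 2) ^ 2) / p') =
      (((P' + Q') / 2) ^ 2 + ((P + Q) / 2) ^ 2) / p := by
    simp only [map_div₀, map_add, map_pow, map_sub, map_ofNat, ← hP', ← hQ', hP2, hp2, hQ'2]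
    rw [sub_neg_eq_add]
  set ε := (((P + Q) / 2) ^ 2 + ((P' - Q') / 2) ^ 2) / p' with hε
  set ε' := ρ ε with hε'
  rw [← hρε] at key
  have hε'0 : ε' ≠ 0 := (map_ne_zero ρ).2 hε0
  refine ⟨ε, ((P + Q) / 2) / ε, hε0, ?_, ?_⟩
  · rw [div_pow, ← key]
    field_simp
    exact hε'.symm
  · have key2 := congrArg (fun z => ρ (ρ z)) key
    simp only [map_mul, map_div₀, map_pow, map_add, map_ofNat, ← hε', ← hP', ← hQ', hP2, hQ'2,
      ← sub_eq_add_neg] at key2 ⊢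
    clear_value ε' ε P Q P' Q'
    have hε2 : ρ ε' ≠ 0 := (map_ne_zero ρ).2 hε'0
    have hε3 : ρ (ρ ε') ≠ 0 := (map_ne_zero ρ).2 hε2
    have e4 : (P' + Q') * (P' - Q') = -((P + Q) * (P - Q)) := by linear_combination hPP - hQQ
    have e5 : ε * ε' * (ρ ε' * ρ (ρ ε')) = (((P + Q) / 2) * ((P - Q) / 2)) ^ 2 := by
      rw [key, key2]; ring
    simp only [map_sub, ← hP', ← hQ']
    rw [div_mul_div_comm, div_mul_div_comm, div_mul_div_comm, div_eq_iff
      (mul_ne_zero (mul_ne_zero (mul_ne_zero hε0 hε'0) hε2) hε3)]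
    linear_combination (P + Q) / 2 / 2 * ((P - Q) / 2 / 2) * e4 + e5

end Quartic

/-! ### Cyclic quartic extensions inside cyclic octic ones -/

section Embedding

variable {L M : Type u} [Field L] [Field M] [Algebra L M] [NeZero (2 : L)]

/-- If `ρ` generates the Galois group of the cyclic quartic extension `M / L` and `ρ ε = y ^ 2 ε`
with `y` of norm `-1`, then `M(√ε) / L` is cyclic of degree `8`. -/
theorem embedsInCyclic_of_apply_eq (hdeg : Module.finrank L M = 4) (ρ : M ≃ₐ[L] M)
    (hρ : ∀ t, ρ (ρ (ρ (ρ t))) = t) {ε y : M} (hε0 : ε ≠ 0) (hε : ρ ε = y ^ 2 * ε)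
    (hy : y * ρ y * ρ (ρ y) * ρ (ρ (ρ y)) = -1) : EmbedsInCyclic L M 8 := by
  have h2 : (2 : M) ≠ 0 := by
    rw [← map_ofNat (algebraMap L M) 2]
    exact (map_ne_zero _).2 (NeZero.ne 2)
  have hfin : FiniteDimensional L M := Module.finite_of_finrank_pos (by omega)
  let f : Polynomial M := Polynomial.X ^ 2 - Polynomial.C ε
  have hirr : Irreducible f := by
    refine X_pow_sub_C_irreducible_of_prime Nat.prime_two fun η hη => ?_
    have h1 : (ρ η) ^ 2 = (y * η) ^ 2 := by rw [← map_pow, hη, hε, mul_pow, hη]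
    have hη0 : η ≠ 0 := by
      rintro rfl
      exact hε0 (by rw [← hη]; ring)
    -- `ρ η = ± y η`, hence `ρ ^ 4 η = N(y) η`
    have h3 : η = -η := by
      rcases sq_eq_sq_iff_eq_or_eq_neg.1 h1 with h | h
      · calc η = ρ (ρ (ρ (ρ η))) := (hρ η).symm
          _ = y * ρ y * ρ (ρ y) * ρ (ρ (ρ y)) * η := by simp only [h, map_mul]; ring
          _ = -η := by rw [hy]; ring
      · calc η = ρ (ρ (ρ (ρ η))) := (hρ η).symm
          _ = y * ρ y * ρ (ρ y) * ρ (ρ (ρ y)) * η := by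
            simp only [h, map_mul, map_neg, mul_neg, neg_neg]; ring
          _ = -η := by rw [hy]; ring
    have h4 : 2 * η = 0 := by linear_combination h3
    exact hη0 ((mul_eq_zero.1 h4).resolve_left h2)
  have : Fact (Irreducible f) := ⟨hirr⟩
  have hroot : AdjoinRoot.root f ^ 2 = AdjoinRoot.of f ε := by
    have h := AdjoinRoot.eval₂_root f
    rw [Polynomial.eval₂_sub, Polynomial.eval₂_pow, Polynomial.eval₂_X, Polynomial.eval₂_C] at h
    exact sub_eq_zero.1 h
  have hroot0 : AdjoinRoot.root f ≠ 0 := by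
    intro h
    rw [h] at hroot
    exact hε0 ((map_eq_zero (AdjoinRoot.of f)).1 (by rw [← hroot]; ring))
  have hdegN : Module.finrank L (AdjoinRoot f) = 8 := by
    have h1 : Module.finrank M (AdjoinRoot f) = 2 := by
      rw [(AdjoinRoot.powerBasis hirr.ne_zero).finrank, AdjoinRoot.powerBasis_dim]
      exact Polynomial.natDegree_X_pow_sub_C
    rw [← Module.finrank_mul_finrank L M, hdeg, h1]
  have hfinN : FiniteDimensional L (AdjoinRoot f) := Module.finite_of_finrank_pos (by omega)
  -- the extension of `ρ` that sends the root `√ε` to `y √ε`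
  let r0 : AdjoinRoot f →+* AdjoinRoot f :=
    AdjoinRoot.lift ((AdjoinRoot.of f).comp (ρ : M →+* M)) (AdjoinRoot.of f y * AdjoinRoot.root f) (by
      rw [Polynomial.eval₂_sub, Polynomial.eval₂_pow, Polynomial.eval₂_X, Polynomial.eval₂_C,
        mul_pow, hroot, RingHom.comp_apply]
      change _ - AdjoinRoot.of f (ρ ε) = 0
      rw [hε, map_mul, map_pow, sub_self])
  have hr0 : ∀ t : M, r0 (AdjoinRoot.of f t) = AdjoinRoot.of f (ρ t) := fun t =>
    AdjoinRoot.lift_of _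
  have hr0r : r0 (AdjoinRoot.root f) = AdjoinRoot.of f y * AdjoinRoot.root f :=
    AdjoinRoot.lift_root _
  let r1 : AdjoinRoot f →ₐ[L] AdjoinRoot f :=
    { r0 with
      commutes' := fun c => by
        have h1 : algebraMap L (AdjoinRoot f) c = AdjoinRoot.of f (algebraMap L M c) :=
          IsScalarTower.algebraMap_apply L M (AdjoinRoot f) c
        change r0 (algebraMap L (AdjoinRoot f) c) = _
        rw [h1, hr0, ρ.commutes] }
  let r : Gal(AdjoinRoot f/L) :=
    AlgEquiv.ofBijective r1 (Algebra.IsAlgebraic.algHom_bijective r1)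
  have hr : ∀ t : M, r (AdjoinRoot.of f t) = AdjoinRoot.of f (ρ t) := hr0
  have hrr : r (AdjoinRoot.root f) = AdjoinRoot.of f y * AdjoinRoot.root f := hr0r
  have h4 : ∀ t, (r ^ 4) t = r (r (r (r t))) := fun t => rfl
  have h4r : (r ^ 4) (AdjoinRoot.root f) = -AdjoinRoot.root f := by
    rw [h4]
    have h5 : r (r (r (r (AdjoinRoot.root f)))) =
        AdjoinRoot.of f (y * ρ y * ρ (ρ y) * ρ (ρ (ρ y))) * AdjoinRoot.root f := by
      simp only [hr, hrr, map_mul]; ring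
    rw [h5, hy, map_neg, map_one]; ring
  have h4m : ∀ t : M, (r ^ 4) (AdjoinRoot.of f t) = AdjoinRoot.of f t := fun t => by
    rw [h4, hr, hr, hr, hr, hρ]
  have hord : orderOf r = 2 ^ (2 + 1) := by
    refine orderOf_eq_prime_pow (p := 2) (fun h => ?_) ?_
    · have h5 := DFunLike.congr_fun h (AdjoinRoot.root f)
      have h6 := h4r.symm.trans h5
      have h7 : AdjoinRoot.of f 2 * AdjoinRoot.root f = 0 := by
        rw [map_ofNat]
        have : -AdjoinRoot.root f = AdjoinRoot.root f := h6
        linear_combination -this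
      rcases mul_eq_zero.1 h7 with h8 | h8
      · exact h2 ((map_eq_zero (AdjoinRoot.of f)).1 h8)
      · exact hroot0 h8
    · have h8 : r ^ 2 ^ (2 + 1) = r ^ 4 * r ^ 4 := by rw [← pow_add]; norm_num
      rw [h8]
      refine AlgEquiv.coe_toAlgHom_injective (AdjoinRoot.algHom_ext' (AlgHom.ext fun t => ?_) ?_)
      · change (r ^ 4) ((r ^ 4) (AdjoinRoot.of f t)) = AdjoinRoot.of f t
        rw [h4m, h4m]
      · change (r ^ 4) ((r ^ 4) (AdjoinRoot.root f)) = AdjoinRoot.root f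
        rw [h4r, map_neg, h4r, neg_neg]
  have hle : Nat.card Gal(AdjoinRoot f/L) ≤ 8 := by
    rw [← hdegN]
    exact (Nat.card_congr (algEquivEquivAlgHom L (AdjoinRoot f)).toEquiv).trans_le
      (card_algHom_le_finrank L (AdjoinRoot f) (AdjoinRoot f))
  have hge : 8 ∣ Nat.card Gal(AdjoinRoot f/L) := by
    have := orderOf_dvd_natCard r
    rwa [hord] at this
  have hcard : Nat.card Gal(AdjoinRoot f/L) = 8 :=
    le_antisymm hle (Nat.le_of_dvd Nat.card_pos hge)
  exact ⟨AdjoinRoot f, inferInstance, inferInstance, inferInstance, inferInstance,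
    IsGalois.of_card_aut_eq_finrank _ _ (hcard.trans hdegN.symm),
    isCyclic_of_orderOf_eq_card r (by rw [hord, hcard]; norm_num), hdegN⟩

end Embedding

section IsQuartic

variable {L N : Type u} [Field L] [Field N] [Algebra L N] [NeZero (2 : L)]

/-- Elements `s` and `θ` that generate a cyclic quartic extension of `L` on which the automorphism
`ρ` of `N / L` acts with order `4`: one has `s = √Δ` for a sum of two squares `Δ = a ^ 2 + b ^ 2`,
and `θ = √(x (Δ + a √Δ))`. -/
structure IsQuartic (ρ : N ≃ₐ[L] N) (s θ : N) (Δ x : Lˣ) (a b : L) : Prop where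
  apply_s : ρ s = -s
  s_sq : s ^ 2 = algebraMap L N Δ
  Δ_eq : (Δ : L) = a ^ 2 + b ^ 2
  apply_θ : ρ (ρ θ) = -θ
  θ_sq : θ ^ 2 = algebraMap L N x * (algebraMap L N Δ + algebraMap L N a * s)

omit [NeZero (2 : L)] in
theorem two_ne_zero_of_algebra [NeZero (2 : L)] : (2 : N) ≠ 0 := by
  rw [← map_ofNat (algebraMap L N) 2]
  exact (map_ne_zero _).2 (NeZero.ne 2)

variable {ρ : N ≃ₐ[L] N}

/-- If the fixed field of `ρ` is `L`, then the fixed field of `ρ ^ 2` is `L + L s`, where `ρ s =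
-s`. -/
theorem exists_eq_add_mul_of_apply_apply (hfix : ∀ t, ρ t = t → ∃ l, algebraMap L N l = t) {s : N}
    (hs : ρ s = -s) (hs0 : s ≠ 0) {t : N} (ht : ρ (ρ t) = t) :
    ∃ l m, t = algebraMap L N l + algebraMap L N m * s := by
  have h2 : (2 : N) ≠ 0 := two_ne_zero_of_algebra (L := L)
  obtain ⟨l, hl⟩ := hfix ((t + ρ t) / 2) (by rw [map_div₀, map_add, ht, map_ofNat, add_comm])
  obtain ⟨m, hm⟩ := hfix ((t - ρ t) / (2 * s)) (by
    rw [map_div₀, map_sub, ht, map_mul, map_ofNat, hs, mul_neg, div_neg, ← neg_div, neg_sub])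
  exact ⟨l, m, by rw [hl, hm]; field_simp; ring⟩

namespace IsQuartic

variable {s θ : N} {Δ x : Lˣ} {a b : L} (h : IsQuartic ρ s θ Δ x a b)
include h

omit [NeZero (2 : L)] in
theorem s_ne_zero : s ≠ 0 := by
  rintro rfl
  exact Δ.ne_zero ((map_eq_zero (algebraMap L N)).1 (by rw [← h.s_sq]; ring))

theorem not_mem (l : L) : algebraMap L N l ≠ s := by
  rintro rfl
  have h1 := h.apply_s
  rw [ρ.commutes] at h1
  have h2 : 2 * algebraMap L N l = 0 := by linear_combination h1
  exact h.s_ne_zero ((mul_eq_zero.1 h2).resolve_left (two_ne_zero_of_algebra (L := L)))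

theorem not_isSquare : ¬ IsSquare (Δ : L) := by
  rintro ⟨l, hl⟩
  have h1 := h.s_sq
  rw [hl, ← sq, map_pow] at h1
  rcases sq_eq_sq_iff_eq_or_eq_neg.1 h1 with h2 | h2
  · exact h.not_mem l h2.symm
  · exact h.not_mem (-l) (by rw [map_neg, h2])

theorem b_ne_zero : b ≠ 0 := by
  rintro rfl
  exact h.not_isSquare ⟨a, by rw [h.Δ_eq]; ring⟩

theorem θ_ne_zero : θ ≠ 0 := by
  rintro rfl
  have h1 := h.θ_sq
  rw [zero_pow two_ne_zero, eq_comm, mul_eq_zero, or_iff_right ((map_ne_zero _).2 x.ne_zero)] at h1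
  by_cases ha : a = 0
  · rw [ha, map_zero, zero_mul, add_zero, map_eq_zero] at h1
    exact Δ.ne_zero h1
  · have ha' : algebraMap L N a ≠ 0 := (map_ne_zero _).2 ha
    refine h.not_mem (-Δ / a) ?_
    rw [map_div₀, map_neg, div_eq_iff ha']
    linear_combination -h1

end IsQuartic

/-- A cyclic quartic extension can be generated by elements as in `IsQuartic`. From any `θ₀` negated
by `ρ ^ 2` one gets `ζ = ρ θ₀ / θ₀` with `ζ * ρ ζ = -1`; writing `ζ = α + s` with `α` in `L`
and `ρ s = -s`, this says that `s ^ 2 = α ^ 2 + 1`. -/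
theorem exists_isQuartic (hfix : ∀ t, ρ t = t → ∃ l, algebraMap L N l = t) {s₀ θ₀ : N}
    (hs : ρ s₀ = -s₀) (hs0 : s₀ ≠ 0) (hθ : ρ (ρ θ₀) = -θ₀) (hθ0 : θ₀ ≠ 0) :
    ∃ s θ Δ x a b, IsQuartic (L := L) ρ s θ Δ x a b := by
  have h2 : (2 : N) ≠ 0 := two_ne_zero_of_algebra (L := L)
  -- Multiplying `θ₀` by `1 + s₀`, one may assume that `ζ` is not fixed by `ρ`.
  obtain ⟨θ, hθ, hθ0, hζ⟩ : ∃ θ, ρ (ρ θ) = -θ ∧ θ ≠ 0 ∧ ρ (ρ θ / θ) ≠ ρ θ / θ := by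
    by_cases hζ : ρ (ρ θ₀ / θ₀) = ρ θ₀ / θ₀
    · have h1 : 1 + s₀ ≠ 0 := fun h => by
        have h3 : s₀ = -1 := by linear_combination h
        rw [h3, map_neg, map_one] at hs
        exact h2 (by linear_combination -hs)
      have h1' : 1 - s₀ ≠ 0 := fun h => by
        have h3 : s₀ = 1 := by linear_combination -h
        rw [h3, map_one] at hs
        exact h2 (by linear_combination hs)
      refine ⟨θ₀ * (1 + s₀), ?_, mul_ne_zero hθ0 h1, fun h => ?_⟩
      · simp only [map_mul, map_add, map_one, hs, hθ, map_neg]; ring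
      · have h4 : ρ (θ₀ * (1 + s₀)) / (θ₀ * (1 + s₀)) = ρ θ₀ / θ₀ * ((1 - s₀) / (1 + s₀)) := by
          rw [map_mul, map_add, map_one, hs, mul_div_mul_comm, sub_eq_add_neg]
        rw [h4, map_mul, hζ, map_div₀, map_sub, map_add, map_one, hs, sub_neg_eq_add,
          ← sub_eq_add_neg] at h
        have h5 : ρ θ₀ / θ₀ ≠ 0 := div_ne_zero ((map_ne_zero ρ).2 hθ0) hθ0
        have h6 := mul_left_cancel₀ h5 h
        rw [div_eq_div_iff h1' h1] at h6
        have h7 : 2 * 2 * s₀ = 0 := by linear_combination h6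
        simp [h2, hs0] at h7
    · exact ⟨θ₀, hθ, hθ0, hζ⟩
  have hρθ : ρ θ ≠ 0 := (map_ne_zero ρ).2 hθ0
  set ζ := ρ θ / θ with hζdef
  have hζζ : ζ * ρ ζ = -1 := by
    rw [hζdef, map_div₀, hθ]
    field_simp
  have hζ2 : ρ (ρ ζ) = ζ := by
    rw [hζdef]
    simp only [map_div₀, hθ, map_neg]
    rw [neg_div_neg_eq]
  obtain ⟨α, hα⟩ := hfix ((ζ + ρ ζ) / 2) (by rw [map_div₀, map_add, hζ2, map_ofNat, add_comm])
  set s := (ζ - ρ ζ) / 2 with hsdef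
  have hs : ρ s = -s := by
    rw [hsdef, map_div₀, map_sub, hζ2, map_ofNat, ← neg_div, neg_sub]
  have hs0 : s ≠ 0 := div_ne_zero (sub_ne_zero.2 (Ne.symm hζ)) h2
  have hζs : ζ = algebraMap L N α + s := by rw [hα, hsdef]; field_simp; ring
  have hs2 : s ^ 2 = algebraMap L N (α ^ 2 + 1) := by
    rw [map_add, map_pow, map_one, hα, hsdef]
    field_simp
    linear_combination -4 * hζζ
  have hΔ0 : α ^ 2 + 1 ≠ 0 := by
    intro h0
    rw [h0, map_zero] at hs2
    exact hs0 (pow_eq_zero_iff two_ne_zero |>.1 hs2)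
  have hsα : s - algebraMap L N α ≠ 0 := by
    intro h0
    have h1 : s = algebraMap L N α := sub_eq_zero.1 h0
    have h3 := hs
    rw [h1, ρ.commutes] at h3
    have h4 : 2 * algebraMap L N α = 0 := by linear_combination h3
    exact hs0 (h1.trans ((mul_eq_zero.1 h4).resolve_left h2))
  have hζ1 : ρ θ = (algebraMap L N α + s) * θ := by rw [← hζs, hζdef]; field_simp
  have hden : algebraMap L N (α ^ 2 + 1) + algebraMap L N (-α) * s = s * (s - algebraMap L N α) := by
    rw [← hs2, map_neg]; ring
  have hden0 : algebraMap L N (α ^ 2 + 1) + algebraMap L N (-α) * s ≠ 0 :=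
    hden ▸ mul_ne_zero hs0 hsα
  obtain ⟨x, hx⟩ := hfix (θ ^ 2 / (s * (s - algebraMap L N α))) (by
    have h3 : -s - algebraMap L N α ≠ 0 := by
      have := (map_ne_zero ρ).2 hsα
      rwa [map_sub, hs, ρ.commutes] at this
    rw [map_div₀, map_pow, hζ1, map_mul, map_sub, hs, ρ.commutes,
      div_eq_div_iff (mul_ne_zero (neg_ne_zero.2 hs0) h3) (mul_ne_zero hs0 hsα)]
    have h5 : s ^ 2 = algebraMap L N α ^ 2 + 1 := by rw [hs2, map_add, map_pow, map_one]
    linear_combination (θ ^ 2 * s * (s + algebraMap L N α)) * h5)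
  have hx0 : x ≠ 0 := by
    rintro rfl
    rw [map_zero, eq_comm, div_eq_zero_iff] at hx
    rcases hx with hx | hx
    · exact hθ0 (pow_eq_zero_iff two_ne_zero |>.1 hx)
    · exact mul_ne_zero hs0 hsα hx
  refine ⟨s, θ, Units.mk0 _ hΔ0, Units.mk0 x hx0, -α, 1, hs, hs2, ?_, hθ, ?_⟩
  · rw [Units.val_mk0]; ring
  · rw [Units.val_mk0, Units.val_mk0, hden, hx, div_mul_cancel₀ _ (mul_ne_zero hs0 hsα)]

/-- If the cyclic quartic extension `N / L` embeds into a cyclic extension of degree `8`, then its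
trace form is determined by the trace form of the quadratic subextension. -/
theorem IsQuartic.eq_of_embedsInCyclic {s θ : N} {Δ x : Lˣ} {a b : L}
    (h : IsQuartic ρ s θ Δ x a b) (hN : EmbedsInCyclic L N 8) :
    GW.unary 1 + GW.unary Δ + (GW.unary x + GW.unary x) =
      GW.unary (Units.mk0 2 (NeZero.ne 2)) + GW.unary (Units.mk0 2 (NeZero.ne 2) * Δ) +
        (GW.unary 1 + GW.unary 1) := by
  obtain ⟨M, _, _, _, _, hgal, hcyc, hdeg⟩ := hN
  have hfin : FiniteDimensional L M := Module.finite_of_finrank_pos (by omega)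
  obtain ⟨σ, hσ⟩ := IsCyclic.exists_generator (α := Gal(M/L))
  have hord : orderOf σ = 8 := by
    rw [orderOf_eq_card_of_forall_mem_zpowers hσ, IsGalois.card_aut_eq_finrank, hdeg]
  have hfix : ∀ t, σ t = t → ∃ l, algebraMap L M l = t := fun t ht => by
    refine IsGalois.mem_range_algebraMap_iff_fixed t |>.2 fun τ => ?_
    have h1 : Subgroup.zpowers σ ≤ MulAction.stabilizer Gal(M/L) t := Subgroup.zpowers_le.2 ht
    exact h1 (hσ τ)
  have hmap : ∀ l, algebraMap N M (algebraMap L N l) = algebraMap L M l := fun l =>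
    (IsScalarTower.algebraMap_apply L N M l).symm
  have hinj := (algebraMap N M).injective
  have hs2 : algebraMap N M s ^ 2 = algebraMap L M Δ := by rw [← map_pow, h.s_sq, hmap]
  have hs : σ (algebraMap N M s) = -algebraMap N M s := by
    have h1 : σ (algebraMap N M s) ^ 2 = algebraMap N M s ^ 2 := by
      rw [← map_pow, hs2, σ.commutes]
    refine (sq_eq_sq_iff_eq_or_eq_neg.1 h1).resolve_left fun h2 => ?_
    obtain ⟨l, hl⟩ := hfix _ h2
    rw [← hmap] at hl
    exact h.not_mem l (hinj hl)
  have hθ2 : algebraMap N M θ ^ 2 = algebraMap L M x *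
      (algebraMap L M Δ + algebraMap L M a * algebraMap N M s) := by
    rw [← map_pow, h.θ_sq]
    simp only [map_mul, map_add, hmap]
  have hs0 : algebraMap N M s ≠ 0 := (map_ne_zero _).2 h.s_ne_zero
  have hθ : σ (σ (algebraMap N M θ)) = -algebraMap N M θ := by
    have h1 : σ (σ (algebraMap N M θ)) ^ 2 = algebraMap N M θ ^ 2 := by
      rw [← map_pow, ← map_pow, hθ2]
      simp only [map_mul, map_add, σ.commutes, hs, map_neg, neg_neg]
    refine (sq_eq_sq_iff_eq_or_eq_neg.1 h1).resolve_left fun h2 => ?_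
    obtain ⟨l, m, hlm⟩ := exists_eq_add_mul_of_apply_apply hfix hs hs0 h2
    rw [← hmap, ← hmap, ← map_mul, ← map_add] at hlm
    have h3 := h.apply_θ
    rw [hinj hlm] at h3
    simp only [map_add, map_mul, ρ.commutes, h.apply_s, map_neg, neg_neg] at h3
    rw [← hinj hlm] at h3
    have h4 : 2 * θ = 0 := by linear_combination h3
    exact h.θ_ne_zero ((mul_eq_zero.1 h4).resolve_left (two_ne_zero_of_algebra (L := L)))
  obtain ⟨t, ht⟩ : ∃ t, (σ ^ 4) t ≠ t := by
    by_contra! h1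
    have h2 : σ ^ 4 = 1 := AlgEquiv.ext h1
    have := Nat.le_of_dvd (by norm_num) (orderOf_dvd_of_pow_eq_one h2)
    omega
  have h8 : ∀ t, (σ ^ 4) ((σ ^ 4) t) = t := fun t => by
    have h1 : σ ^ 4 * σ ^ 4 = 1 := by
      rw [← pow_add]
      exact (congrArg (σ ^ ·) hord.symm).trans (pow_orderOf_eq_one σ)
    exact DFunLike.congr_fun h1 t
  refine GW.quartic_eq_of_neg_eigenvector hfix hs hs2 h.Δ_eq hθ ((map_ne_zero _).2 h.θ_ne_zero) hθ2
    (η := t - (σ ^ 4) t) ?_ (sub_ne_zero.2 (Ne.symm ht))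
  change (σ ^ 4) (t - (σ ^ 4) t) = _
  rw [map_sub, h8, neg_sub]

end IsQuartic

/-! ### Trace forms at the levels of the cyclic extension -/

theorem cyc_eq_zpowers_sq {G : Type u} [Group G] [IsCyclic G] [Finite G] {n : ℕ}
    (hG : Nat.card G = 2 ^ n) {i j : ℕ} (hj : j = i + 1) (hi : j ≤ n) {g : G}
    (hg : cyc G j = Subgroup.zpowers g) : cyc G i = Subgroup.zpowers (g * g) := by
  subst hj
  have hgm : g ∈ cyc G (i + 1) := hg ▸ Subgroup.mem_zpowers g
  have ho : orderOf g = 2 ^ (i + 1) := by rw [← Nat.card_zpowers, ← hg, card_cyc hG hi]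
  refine (Subgroup.eq_of_le_of_card_ge (Subgroup.zpowers_le.2 (sq_mem_cyc hgm)) ?_).symm
  rw [card_cyc hG (by omega), Nat.card_zpowers, ← sq, orderOf_pow_of_dvd two_ne_zero
    (ho ▸ dvd_pow_self 2 (by omega)), ho, pow_succ, Nat.mul_div_cancel _ (by norm_num)]

section Generic

variable {F : Type v} {K : Type u} [Field F] [Field K] [Algebra F K] [FiniteDimensional F K]
  [IsGalois F K] [NeZero (2 : F)] {B E M : IntermediateField F K} (h : B ≤ E) (h' : E ≤ M)
  {g : Gal(K/F)}

/-- The trace form of `B(√Δ)` over `B` is `⟨2⟩ + ⟨2Δ⟩`. -/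
theorem fieldTransfer_unary_one_of_sq (hdeg : Module.finrank B K = 2 * Module.finrank E K)
    (hE : ∀ x ∈ B, g x = x) (hE' : ∀ x ∈ E, g x ∈ E) {s : K} (hsE : s ∈ E) (hs : g s = -s)
    {Δ : Bˣ} (hΔ : s ^ 2 = ((Δ : B) : K)) :
    fieldTransfer h (GW.unary 1) =
      GW.unary (Units.mk0 2 (NeZero.ne 2)) + GW.unary (Units.mk0 2 (NeZero.ne 2) * Δ) := by
  have h1 := fieldTransfer_unary_coe h hdeg hE hE' (s := ⟨s, hsE⟩) hs (Δ := Δ) hΔ 1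
    (c' := 1) (by rw [Units.val_one, Units.val_one, OneMemClass.coe_one, OneMemClass.coe_one])
  rw [h1, mul_one]

/-- The trace form of `B(√(x(Δ + a√Δ)))` over `B`, where `Δ = a ^ 2 + b ^ 2`. -/
theorem fieldTransfer_unary_one_of_quartic
    (hdeg : Module.finrank B K = 2 * Module.finrank E K)
    (hdeg' : Module.finrank E K = 2 * Module.finrank M K)
    (hE : ∀ x ∈ B, g x = x) (hE' : ∀ x ∈ E, g x ∈ E)
    (hM : ∀ x ∈ E, (g * g) x = x) (hM' : ∀ x ∈ M, (g * g) x ∈ M)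
    {s : K} (hsE : s ∈ E) (hs : g s = -s)
    {Δ x : Bˣ} {a b : B} (hΔ : s ^ 2 = ((Δ : B) : K)) (hab : (Δ : B) = a ^ 2 + b ^ 2) (hb : b ≠ 0)
    {θ : K} (hθM : θ ∈ M) (hθ : g (g θ) = -θ) (hθ0 : θ ≠ 0)
    (hδ : θ ^ 2 = ((x : B) : K) * (((Δ : B) : K) + (a : K) * s)) :
    fieldTransfer (h.trans h') (GW.unary 1) =
      GW.unary 1 + GW.unary Δ + (GW.unary x + GW.unary x) := by
  obtain ⟨δ, hδE⟩ : ∃ δ : E, (δ : K) = ((x : B) : K) * (((Δ : B) : K) + (a : K) * s) :=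
    ⟨⟨_, mul_mem (h (x : B).2) (add_mem (h (Δ : B).2) (mul_mem (h a.2) hsE))⟩, rfl⟩
  rw [← hδE] at hδ
  have hδ0 : δ ≠ 0 := by
    rintro rfl
    exact hθ0 (pow_eq_zero_iff two_ne_zero |>.1 hδ)
  have h1 := fieldTransfer_unary_one_of_sq h' hdeg' hM hM' hθM hθ (Δ := Units.mk0 δ hδ0) hδ
  have h2 := fieldTransfer_unary_coe h hdeg hE hE' (s := ⟨s, hsE⟩) hs (Δ := Δ) hΔ
    (Units.mk0 2 (NeZero.ne 2)) (c' := Units.mk0 2 (NeZero.ne 2)) (by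
      rw [Units.val_mk0, Units.val_mk0]; rfl)
  have h3 := fieldTransfer_unary_of_sum_sq h hdeg hE hE' (s := ⟨s, hsE⟩) hs (Δ := Δ) (x := x) hΔ hab
    hb (δ := Units.mk0 2 (NeZero.ne 2) * Units.mk0 δ hδ0) (by
      rw [Units.val_mul, Units.val_mk0, Units.val_mk0, MulMemClass.coe_mul, hδE]; rfl)
  rw [← fieldTransfer_fieldTransfer h h', h1, map_add, h2, h3]
  have e : ∀ c : Bˣ, GW.unary (Units.mk0 2 (NeZero.ne 2) * Units.mk0 2 (NeZero.ne 2) * c) =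
      GW.unary c := fun c => GW.unary_eq_of_sq (Units.mk0 2 (NeZero.ne 2)) (by
    rw [Units.val_mul, Units.val_mul, Units.val_mk0]; ring)
  rw [e, ← e 1, mul_one]

end Generic

section Levels

variable {F : Type v} {K : Type u} [Field F] [Field K] [Algebra F K]

/-- An element of `C_{2^i}`, as an automorphism of `K` over the fixed field of `C_{2^i}`. -/
def levelAut {i : ℕ} {g : Gal(K/F)} (hg : cyc Gal(K/F) i = Subgroup.zpowers g) :
    K ≃ₐ[levelField F K i] K :=
  { g with
    commutes' := fun x => apply_eq_of_mem_levelField (hg ▸ Subgroup.mem_zpowers g) x.2 }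

theorem levelAut_apply {i : ℕ} {g : Gal(K/F)} (hg : cyc Gal(K/F) i = Subgroup.zpowers g) (t : K) :
    levelAut hg t = g t := rfl

theorem exists_algebraMap_eq_of_levelAut {i : ℕ} {g : Gal(K/F)}
    (hg : cyc Gal(K/F) i = Subgroup.zpowers g) (t : K) (ht : levelAut hg t = t) :
    ∃ l, algebraMap (levelField F K i) K l = t :=
  ⟨⟨t, mem_levelField_of_apply_eq hg ht⟩, rfl⟩

variable [FiniteDimensional F K] [IsCyclic Gal(K/F)] {n : ℕ} (hG : Nat.card Gal(K/F) = 2 ^ n)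
  [NeZero (2 : F)]
include hG

section

variable {i j k : ℕ} (hj : j = i + 1) (hk : k = j + 1) (hi : k ≤ n) {g : Gal(K/F)}
  (hg : cyc Gal(K/F) k = Subgroup.zpowers g)
include hj hk hi

/-- The extension of the fixed field of `C_{2^k}` by that of `C_{2^(k-2)}` is cyclic quartic, and
is generated by elements as in `IsQuartic`. -/
theorem exists_isQuartic_levelAut : ∃ s θ Δ x a b, IsQuartic (levelAut hg) s θ Δ x a b := by
  have hg' := cyc_eq_zpowers_sq hG hk hi hg
  subst hj hk
  obtain ⟨s, hs0, hs⟩ := exists_neg_eigenvector hG hi hg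
  obtain ⟨θ, hθ0, hθ⟩ := exists_neg_eigenvector hG (show i + 1 ≤ n by omega) hg'
  exact exists_isQuartic (exists_algebraMap_eq_of_levelAut hg) (s₀ := (s : K)) (θ₀ := (θ : K)) hs
    (fun h => hs0 (Subtype.ext h)) hθ (fun h => hθ0 (Subtype.ext h))

variable {s θ : K} {Δ x : (levelField F K k)ˣ} {a b : levelField F K k} {hg}
  (h : IsQuartic (levelAut hg) s θ Δ x a b)
include h

omit hG hj hk hi [FiniteDimensional F K] [IsCyclic Gal(K/F)] [NeZero (2 : F)] in
theorem IsQuartic.apply_s_eq : g s = -s := (levelAut_apply hg s).symm.trans h.apply_s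

omit hG hj hk hi [FiniteDimensional F K] [IsCyclic Gal(K/F)] [NeZero (2 : F)] in
theorem IsQuartic.apply_θ_eq : g (g θ) = -θ := by
  rw [← levelAut_apply hg, ← levelAut_apply hg, h.apply_θ]

omit hG hj hk hi [FiniteDimensional F K] [IsCyclic Gal(K/F)] [NeZero (2 : F)] in
theorem IsQuartic.coe_s_sq : s ^ 2 = ((Δ : levelField F K k) : K) := h.s_sq

omit hG hj hk hi [FiniteDimensional F K] [IsCyclic Gal(K/F)] [NeZero (2 : F)] in
theorem IsQuartic.coe_θ_sq : θ ^ 2 = ((x : levelField F K k) : K) *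
    (((Δ : levelField F K k) : K) + (a : K) * s) := h.θ_sq

omit [NeZero (2 : F)] hj in
theorem IsQuartic.s_mem : s ∈ levelField F K j := by
  have hs := h.apply_s_eq
  refine mem_levelField_of_apply_eq (cyc_eq_zpowers_sq hG hk hi hg) ?_
  change g (g s) = s
  rw [hs, map_neg, hs, neg_neg]

omit [NeZero (2 : F)] in
theorem IsQuartic.θ_mem : θ ∈ levelField F K i := by
  have hθ := h.apply_θ_eq
  have hg1 := cyc_eq_zpowers_sq hG hk hi hg
  refine mem_levelField_of_apply_eq (cyc_eq_zpowers_sq hG hj (by omega) hg1) ?_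
  change g (g (g (g θ))) = θ
  rw [hθ, map_neg, map_neg, hθ, neg_neg]

variable [IsGalois F K]

/-- The trace form of the quadratic level is `⟨2⟩ + ⟨2Δ⟩`. -/
theorem IsQuartic.dress_orb_quadratic :
    dress (cyc Gal(K/F) k) (orb Gal(K/F) k j) =
      GW.unary (Units.mk0 2 (NeZero.ne 2)) + GW.unary (Units.mk0 2 (NeZero.ne 2) * Δ) := by
  have hs' := h.s_mem hG hk hi
  have hs := h.apply_s_eq
  have hΔ := h.coe_s_sq
  clear h
  subst hj hk
  have hgm : g ∈ cyc Gal(K/F) (i + 1 + 1) := hg ▸ Subgroup.mem_zpowers g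
  rw [dress_orb (Nat.le_add_right (i + 1) 1)]
  exact fieldTransfer_unary_one_of_sq _
    (finrank_levelField_succ hG hi) (fun x hx => apply_eq_of_mem_levelField hgm hx)
    (fun x hx => apply_mem_levelField g hx) hs' hs hΔ

/-- The trace form of the quartic level is `⟨1⟩ + ⟨Δ⟩ + 2⟨x⟩`. -/
theorem IsQuartic.dress_orb_quartic :
    dress (cyc Gal(K/F) k) (orb Gal(K/F) k i) =
      GW.unary 1 + GW.unary Δ + (GW.unary x + GW.unary x) := by
  have hs' := h.s_mem hG hk hi
  have hθ' := h.θ_mem hG hj hk hi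
  have hs := h.apply_s_eq
  have hΔ := h.coe_s_sq
  have hab := h.Δ_eq
  have hb := h.b_ne_zero
  have hθ := h.apply_θ_eq
  have hδ := h.coe_θ_sq
  have hθ0 := h.θ_ne_zero
  clear h
  subst hj hk
  have hgm : g ∈ cyc Gal(K/F) (i + 1 + 1) := hg ▸ Subgroup.mem_zpowers g
  rw [dress_orb (show i ≤ i + 1 + 1 by omega)]
  exact fieldTransfer_unary_one_of_quartic (levelField_anti F K (Nat.le_add_right (i + 1) 1))
    (levelField_anti F K (Nat.le_add_right i 1))
    (finrank_levelField_succ hG hi) (finrank_levelField_succ hG (show i + 1 ≤ n by omega))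
    (fun x hx => apply_eq_of_mem_levelField hgm hx)
    (fun x hx => apply_mem_levelField g hx)
    (fun x hx => apply_eq_of_mem_levelField (sq_mem_cyc hgm) hx)
    (fun x hx => apply_mem_levelField (g * g) hx) hs' hs hΔ hab hb hθ' hθ hθ0 hδ

end

variable [IsGalois F K]

/-- Twice the trace form `⟨2⟩ + ⟨2Δ⟩` is `4⟨1⟩`, because `2` and `Δ` are sums of two squares. That
`Δ` is one comes from the quadratic extension being part of a cyclic quartic one. -/
theorem two_dress_orb_quadratic {i j k : ℕ} (hj : j = i + 1) (hk : k = j + 1) (hi : k ≤ n) :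
    2 • dress (cyc Gal(K/F) k) (orb Gal(K/F) k j) = 4 • GW.unary 1 := by
  obtain ⟨g, -, hg⟩ := exists_generator_cyc hG hi
  obtain ⟨s, θ, Δ, x, a, b, h⟩ := exists_isQuartic_levelAut hG hj hk hi hg
  rw [h.dress_orb_quadratic hG hj hk hi]
  have h1 := GW.two_unary_mul (d := Units.mk0 2 (NeZero.ne (2 : levelField F K k))) 1 1
    (by rw [Units.val_mk0]; norm_num) 1
  have h2 := GW.two_unary_mul (d := Units.mk0 2 (NeZero.ne (2 : levelField F K k)) * Δ)
    (a + b) (a - b) (by rw [Units.val_mul, Units.val_mk0, h.Δ_eq]; ring) 1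
  rw [one_mul] at h1 h2
  rw [two_nsmul, add_add_add_comm, ← h1, ← h2]
  abel

/-- The quartic trace form equals the quadratic one plus `2⟨1⟩` at every level above the bottom:
for `i ≥ 1` the field fixed by `C_{2^i}` is not all of `K`, so that `K` provides the eigenvector
for `-1` of `GW.quartic_eq_of_neg_eigenvector`. -/
theorem dress_orb_quartic_eq {i j k : ℕ} (hi1 : 1 ≤ i) (hj : j = i + 1) (hk : k = j + 1)
    (hi : k ≤ n) : dress (cyc Gal(K/F) k) (orb Gal(K/F) k i) =
      dress (cyc Gal(K/F) k) (orb Gal(K/F) k j) +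
        (GW.unary 1 + GW.unary 1) := by
  obtain ⟨g, -, hg⟩ := exists_generator_cyc hG hi
  obtain ⟨s, θ, Δ, x, a, b, h⟩ := exists_isQuartic_levelAut hG hj hk hi hg
  obtain ⟨l, rfl⟩ := Nat.exists_eq_add_of_le' hi1
  have hg' := cyc_eq_zpowers_sq hG hj (by omega) (cyc_eq_zpowers_sq hG hk hi hg)
  obtain ⟨η, hη0, hη⟩ := exists_neg_eigenvector hG (show l + 1 ≤ n by omega) hg'
  rw [h.dress_orb_quartic hG hj hk hi, h.dress_orb_quadratic hG hj hk hi]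
  exact GW.quartic_eq_of_neg_eigenvector (exists_algebraMap_eq_of_levelAut hg) h.apply_s h.s_sq
    h.Δ_eq h.apply_θ h.θ_ne_zero h.θ_sq (η := (η : K)) hη (fun h => hη0 (Subtype.ext h))

/-- At the bottom level, the equality of trace forms amounts to the embeddability of `K` into a
cyclic extension of degree `8`. -/
theorem dress_orb_quartic_eq_iff (hn : 2 ≤ n) :
    dress (cyc Gal(K/F) 2) (orb Gal(K/F) 2 0) = dress (cyc Gal(K/F) 2) (orb Gal(K/F) 2 1) +
        (GW.unary 1 + GW.unary 1) ↔ EmbedsInCyclic (levelField F K 2) K 8 := by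
  obtain ⟨g, ho, hg⟩ := exists_generator_cyc hG hn
  obtain ⟨s, θ, Δ, x, a, b, h⟩ :=
    exists_isQuartic_levelAut hG (zero_add 1).symm one_add_one_eq_two.symm hn hg
  rw [h.dress_orb_quartic hG (zero_add 1).symm one_add_one_eq_two.symm hn,
    h.dress_orb_quadratic hG (zero_add 1).symm one_add_one_eq_two.symm hn]
  refine ⟨fun h1 => ?_, h.eq_of_embedsInCyclic⟩
  obtain ⟨ε, y, hε0, hε, hy⟩ := exists_of_quartic_eq (levelAut hg) h.apply_s h.s_sq h.Δ_eq
    h.b_ne_zero h.not_isSquare h.apply_θ h.θ_sq h1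
  refine embedsInCyclic_of_apply_eq ((finrank_levelField hG hn).trans (by norm_num)) (levelAut hg)
    (fun t => ?_) hε0 hε hy
  have h4 : g ^ 4 = 1 := by
    have := pow_orderOf_eq_one g
    rwa [ho] at this
  exact DFunLike.congr_fun h4 t

/-! ### Presentations of the quartic extension -/

omit hG [FiniteDimensional F K] [IsCyclic Gal(K/F)] [NeZero (2 : F)] [IsGalois F K] in
/-- A field generated over the fixed field of `g * g` by a `-1`-eigenvector of `g * g`. -/
theorem top_eq_sup_adjoin [NeZero (2 : K)] {i : ℕ} {g : Gal(K/F)}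
    (hg : cyc Gal(K/F) i = Subgroup.zpowers g) (hgg : ∀ t, g (g t) = t) {θ : K} (hθ : g θ = -θ)
    (hθ0 : θ ≠ 0) : ⊤ = levelField F K i ⊔ IntermediateField.adjoin F {θ} := by
  have h2 : (2 : K) ≠ 0 := NeZero.ne 2
  refine (le_antisymm le_top fun t _ => ?_).symm
  have hp : (t + g t) / 2 ∈ levelField F K i := by
    refine mem_levelField_of_apply_eq hg ?_
    rw [map_div₀, map_add, map_ofNat, hgg, add_comm]
  have hq : (t - g t) / (2 * θ) ∈ levelField F K i := by
    refine mem_levelField_of_apply_eq hg ?_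
    rw [map_div₀, map_sub, map_mul, map_ofNat, hgg, hθ, mul_neg, div_neg, ← neg_div, neg_sub]
  have ht : t = (t + g t) / 2 + (t - g t) / (2 * θ) * θ := by
    field_simp
    ring
  have hθ' := le_sup_right (a := levelField F K i) (IntermediateField.mem_adjoin_simple_self F θ)
  have hL := le_sup_left (a := levelField F K i) (b := IntermediateField.adjoin F {θ})
  rw [ht]
  exact add_mem (hL hp) (mul_mem (hL hq) hθ')

omit hG [FiniteDimensional F K] [IsCyclic Gal(K/F)] [IsGalois F K] in
theorem levelField_eq_sup_adjoin {i k : ℕ} (hik : i ≤ k) {g : Gal(K/F)}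
    (hg : cyc Gal(K/F) k = Subgroup.zpowers g) (hgi : g * g ∈ cyc Gal(K/F) i) {s : K}
    (hs : g s = -s) (hs0 : s ≠ 0) (hsi : s ∈ levelField F K i) :
    levelField F K i = levelField F K k ⊔ IntermediateField.adjoin F {s} := by
  refine le_antisymm (fun t ht => ?_) (sup_le (levelField_anti F K hik) ?_)
  · obtain ⟨l, m, hlm⟩ := exists_eq_add_mul_of_apply_apply (exists_algebraMap_eq_of_levelAut hg)
      hs hs0 (apply_eq_of_mem_levelField hgi ht :)
    have hs' := le_sup_right (a := levelField F K k)
      (IntermediateField.mem_adjoin_simple_self F s)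
    have hL := fun l : levelField F K k => le_sup_left (b := IntermediateField.adjoin F {s}) l.2
    rw [hlm]
    exact add_mem (hL l) (mul_mem (hL m) hs')
  · rw [IntermediateField.adjoin_le_iff, Set.singleton_subset_iff]
    exact hsi

omit [IsGalois F K] in
/-- The extension `K` of `K^{C_4}` has a presentation by `Δ = a ^ 2 + b ^ 2` and `x`. -/
theorem nonempty_quarticPresentation (hn : 2 ≤ n) : Nonempty (QuarticPresentation F K) := by
  obtain ⟨g, ho, hg⟩ := exists_generator_cyc hG hn
  obtain ⟨s, θ, Δ, x, a, b, h⟩ :=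
    exists_isQuartic_levelAut hG (zero_add 1).symm one_add_one_eq_two.symm hn hg
  have hle : levelField F K 2 ≤ levelField F K 1 := levelField_anti F K one_le_two
  have hs := h.s_mem hG one_add_one_eq_two.symm hn
  have hg1 := cyc_eq_zpowers_sq hG one_add_one_eq_two.symm hn hg
  have : NeZero (2 : K) := ⟨fun h => NeZero.ne (2 : F)
      ((algebraMap F K).injective (by rw [map_ofNat, h, map_zero]))⟩
  have h4 : ∀ t, (g * g) ((g * g) t) = t := fun t => by
    have := pow_orderOf_eq_one g
    rw [ho] at this
    exact DFunLike.congr_fun this t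
  obtain ⟨δ, hδ⟩ : ∃ δ : levelField F K 1, (δ : K) = ((x : levelField F K 2) : K) *
      (((Δ : levelField F K 2) : K) + (a : K) * s) :=
    ⟨⟨_, mul_mem (hle (x : levelField F K 2).2) (add_mem (hle (Δ : levelField F K 2).2)
      (mul_mem (hle a.2) hs))⟩, rfl⟩
  exact ⟨{
    a := a
    b := b
    Δ := Δ
    x := x
    sqrtΔ := s
    δ := δ
    sqrtδ := θ
    Δ_eq := h.Δ_eq
    sqrtΔ_sq := h.coe_s_sq
    E_eq := levelField_eq_sup_adjoin one_le_two hg (hg1 ▸ Subgroup.mem_zpowers _) h.apply_s_eq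
      h.s_ne_zero hs
    δ_eq := hδ
    sqrtδ_sq := h.coe_θ_sq.trans hδ.symm
    K_eq := top_eq_sup_adjoin hg1 h4 h.apply_θ_eq h.θ_ne_zero }⟩

omit [IsGalois F K] [NeZero (2 : F)] in
/-- A presentation consists of elements as in `IsQuartic`, for every generator of `C_4`: the signs
in `ρ s = -s` and `ρ ^ 2 θ = -θ` are forced, as `K` is generated by `s` and `θ`. -/
theorem QuarticPresentation.isQuartic (hn : 2 ≤ n) (P : QuarticPresentation F K) {g : Gal(K/F)}
    (hg : cyc Gal(K/F) 2 = Subgroup.zpowers g) :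
    IsQuartic (levelAut hg) P.sqrtΔ P.sqrtδ P.Δ P.x P.a P.b := by
  have hgm : g ∈ cyc Gal(K/F) 2 := hg ▸ Subgroup.mem_zpowers g
  have hg1 := cyc_eq_zpowers_sq hG one_add_one_eq_two.symm hn hg
  have hδ : P.sqrtδ ^ 2 = ((P.x : levelField F K 2) : K) *
    (((P.Δ : levelField F K 2) : K) + (P.a : K) * P.sqrtΔ) := P.sqrtδ_sq.trans P.δ_eq
  have hs : g P.sqrtΔ = -P.sqrtΔ := by
    have h1 : g P.sqrtΔ ^ 2 = P.sqrtΔ ^ 2 := by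
      rw [← map_pow, P.sqrtΔ_sq]
      exact apply_eq_of_mem_levelField hgm (P.Δ : levelField F K 2).2
    refine (sq_eq_sq_iff_eq_or_eq_neg.1 h1).resolve_left fun h2 => ?_
    have h3 : levelField F K 1 ≤ levelField F K 2 := by
      rw [P.E_eq]
      refine sup_le le_rfl ?_
      rw [IntermediateField.adjoin_le_iff, Set.singleton_subset_iff]
      exact mem_levelField_of_apply_eq hg h2
    have h4 := finrank_levelField hG (show 1 ≤ n by omega)
    rw [le_antisymm h3 (levelField_anti F K one_le_two), finrank_levelField hG hn] at h4
    norm_num at h4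
  have hθ : g (g P.sqrtδ) = -P.sqrtδ := by
    have h1 : g (g P.sqrtδ) ^ 2 = P.sqrtδ ^ 2 := by
      rw [← map_pow, ← map_pow, P.sqrtδ_sq]
      exact apply_eq_of_mem_levelField (sq_mem_cyc hgm) P.δ.2
    refine (sq_eq_sq_iff_eq_or_eq_neg.1 h1).resolve_left fun h2 => ?_
    have h3 : levelField F K 1 = ⊤ := by
      refine top_le_iff.1 ?_
      rw [P.K_eq]
      refine sup_le le_rfl ?_
      rw [IntermediateField.adjoin_le_iff, Set.singleton_subset_iff]
      exact mem_levelField_of_apply_eq hg1 h2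
    have h4 := finrank_levelField hG (show 1 ≤ n by omega)
    rw [h3, IntermediateField.finrank_top] at h4
    norm_num at h4
  exact ⟨hs, P.sqrtΔ_sq, P.Δ_eq, hθ, hδ⟩

/-- The virtual form `⟨Δ, x, x⟩ - ⟨2, 2Δ, 1⟩` is the image of `[C_4 / 1] - [C_4 / C_2] - 2`, so
that its transfers are images of the transfers of that element. -/
theorem QuarticPresentation.transferVanishes_iff (hn : 2 ≤ n) (P : QuarticPresentation F K) {m : ℕ}
    (hm : 2 ≤ m) (hmn : m ≤ n) : P.TransferVanishes m ↔
      dress (cyc Gal(K/F) m) (orb Gal(K/F) m 0) = dress (cyc Gal(K/F) m) (orb Gal(K/F) m 1) +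
        2 • dress (cyc Gal(K/F) m) (orb Gal(K/F) m 2) := by
  obtain ⟨g, ho, hg⟩ := exists_generator_cyc hG hn
  have h := P.isQuartic hG hn hg
  have key : ∀ a ≤ 2, dress (cyc Gal(K/F) m) (orb Gal(K/F) m a) =
      fieldTransfer (levelField_anti F K hm) (dress (cyc Gal(K/F) 2) (orb Gal(K/F) 2 a)) := by
    intro a ha
    rw [← tr_orb hG hmn ha hm (cyc_mono _ hm), dress_tr hG hmn hm]
  rw [key 0 (by omega), key 1 (by omega), key 2 le_rfl,
    h.dress_orb_quartic hG (zero_add 1).symm one_add_one_eq_two.symm hn,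
    h.dress_orb_quadratic hG (zero_add 1).symm one_add_one_eq_two.symm hn, orb_self hG hn,
    dress_one hG hn, ← map_nsmul, ← map_add, ← sub_eq_zero,
    ← map_sub]
  have h1 : GW.unary P.Δ + GW.unary P.x + GW.unary P.x -
      (GW.unary (Units.mk0 2 (NeZero.ne 2)) + GW.unary (Units.mk0 2 (NeZero.ne 2) * P.Δ) +
        GW.unary 1) = GW.unary 1 + GW.unary P.Δ + (GW.unary P.x + GW.unary P.x) -
      (GW.unary (Units.mk0 2 (NeZero.ne 2)) + GW.unary (Units.mk0 2 (NeZero.ne 2) * P.Δ) +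
        2 • GW.unary 1) := by abel
  rw [← h1]
  exact ⟨fun ⟨_, h⟩ => h, fun h => ⟨hm, h⟩⟩

end Levels

/-! ### The discriminant of the trace form of a cyclic extension -/

/-- A generator of a cyclic group of even order acts on the group as a cycle of even length. -/
theorem sign_mulLeft_of_generator {G : Type u} [Group G] [Fintype G] [DecidableEq G] {ρ : G}
    (hρ : ∀ σ : G, σ ∈ Subgroup.zpowers ρ) (hG : Even (Fintype.card G)) :
    Equiv.Perm.sign (Equiv.mulLeft ρ) = -1 := by
  have h1 : ρ ≠ 1 := by
    rintro rfl
    have h : Fintype.card G = 1 := Fintype.card_eq_one_iff.2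
      ⟨1, fun σ => by simpa using hρ σ⟩
    rw [h] at hG
    exact absurd hG (by decide)
  have hz : ∀ (m : ℤ) (x : G), ((Equiv.mulLeft ρ : Equiv.Perm G) ^ m) x = ρ ^ m * x := fun m x => by
    change ((MulAction.toPermHom G G ρ) ^ m) x = _
    rw [← map_zpow]
    rfl
  have hc : (Equiv.mulLeft ρ : Equiv.Perm G).IsCycle := by
    refine ⟨1, by simpa using h1, fun y _ => ?_⟩
    obtain ⟨m, hm⟩ := hρ y
    exact ⟨m, by rw [hz, mul_one]; exact hm⟩
  have hs : (Equiv.mulLeft ρ : Equiv.Perm G).support = Finset.univ := by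
    ext x
    simpa using h1
  rw [hc.sign, hs, Finset.card_univ, hG.neg_one_pow]

/-- The determinant `d` of the matrix of conjugates of a basis has `ρ d = -d`, and the discriminant
of the trace form is `d ^ 2` up to squares. -/
theorem GW.discr_transfer_unary_one_ne_zero {k l : Type u} [Field k] [Field l] [Algebra k l]
    [FiniteDimensional k l] [IsGalois k l] [NeZero (2 : l)] {ρ : l ≃ₐ[k] l}
    (hρ : ∀ σ, σ ∈ Subgroup.zpowers ρ) (hkl : Even (Module.finrank k l)) :
    GW.discr k (GW.transfer k (GW.unary (1 : lˣ))) ≠ 0 := by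
  classical
  have hcard : Fintype.card (l ≃ₐ[k] l) = Module.finrank k l := by
    rw [← Nat.card_eq_fintype_card, IsGalois.card_aut_eq_finrank]
  let b : Module.Basis (l ≃ₐ[k] l) k l := (Module.finBasis k l).reindex
    (Fintype.equivOfCardEq (by rw [Fintype.card_fin, hcard]))
  let A : Matrix (l ≃ₐ[k] l) (l ≃ₐ[k] l) l := Matrix.of fun σ τ => σ (b τ)
  have hA : ρ A.det = -A.det := by
    have h1 : ρ A.det = (A.submatrix (Equiv.mulLeft ρ) id).det := by
      rw [← AlgEquiv.coe_ringEquiv, RingEquiv.map_det]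
      rfl
    rw [h1, Matrix.det_permute, sign_mulLeft_of_generator hρ (by rwa [hcard])]
    simp
  let q : RegForm k := RegForm.transfer k (RegForm.unary (1 : lˣ))
  let b' : Module.Basis (l ≃ₐ[k] l) k q.V := 
    { repr := { toFun := fun v => b.repr v
                invFun := fun f => b.repr.symm f
                left_inv := fun v => b.repr.symm_apply_apply v
                right_inv := fun f => b.repr.apply_symm_apply f
                map_add' := fun (v w : l) => map_add b.repr v w
                map_smul' := fun c (v : l) => (congrArg b.repr (Algebra.smul_def c (v : l)).symm).trans
                  (map_smul b.repr c v) } }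
  have hb' : ∀ σ, b' σ = b σ := fun σ => rfl
  have hq : ∀ v : l, q.form v = Algebra.trace k l (v * v) := fun v =>
    congrArg (Algebra.trace k l) (one_mul (v * v))
  have hpol : ∀ v w : l, QuadraticMap.polar q.form v w = Algebra.trace k l (2 * (v * w)) := by
    intro v w
    refine (congrArg₂ (· - ·) (congrArg₂ (· - ·) (hq (v + w)) (hq v)) (hq w)).trans ?_
    rw [← map_sub, ← map_sub]
    congr 1
    ring
  have hgram : (q.gram b').map (algebraMap k l) = (2 : l) • (A.transpose * A) := by
    ext σ τ
    have h1 : q.gram b' σ τ = Algebra.trace k l (2 * (b σ * b τ)) :=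
      (q.gram_apply b' σ τ).trans (hpol _ _)
    rw [Matrix.map_apply, h1, trace_eq_sum_automorphisms]
    simp only [Matrix.smul_apply, Matrix.mul_apply, Matrix.transpose_apply, A, Matrix.of_apply,
      map_mul, map_ofNat, smul_eq_mul, Finset.mul_sum]
  have hdet : algebraMap k l (q.gram b').det = 2 ^ Fintype.card (l ≃ₐ[k] l) * A.det ^ 2 := by
    rw [RingHom.map_det, RingHom.mapMatrix_apply, hgram, Matrix.det_smul, Matrix.det_mul,
      Matrix.det_transpose, sq]
  have hne : algebraMap k l (q.gram b').det ≠ 0 :=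
    (map_ne_zero _).2 (q.gram_det_ne_zero b')
  have hA0 : A.det ≠ 0 := fun h => hne (by rw [hdet, h]; ring)
  intro h0
  have h1 : GW.discr k (GrothendieckAddGroup.of (FormClasses.mk q)) = 0 :=
    (congrArg (GW.discr k) (GW.transfer_of_mk (k := k) (RegForm.unary (1 : lˣ)))).symm.trans h0
  rw [GW.discr_of_mk q b', squareClass_eq_zero_iff, Units.val_mk0] at h1
  obtain ⟨d, hd⟩ := h1
  obtain ⟨N, hN⟩ := hkl
  rw [hd, hcard, hN, map_mul] at hdet
  have h2 : algebraMap k l d ^ 2 = (2 ^ N * A.det) ^ 2 := by rw [sq, hdet]; ring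
  have h3 : ρ (2 ^ N * A.det) = 2 ^ N * A.det := by
    rcases sq_eq_sq_iff_eq_or_eq_neg.1 h2 with h | h
    · rw [← h, AlgEquiv.commutes]
    · rw [← neg_eq_iff_eq_neg.2 h, map_neg, AlgEquiv.commutes]
  rw [map_mul, hA, map_pow, map_ofNat, mul_neg, neg_eq_iff_add_eq_zero,
    ← two_mul] at h3
  exact mul_ne_zero two_ne_zero (mul_ne_zero (pow_ne_zero N two_ne_zero) hA0) h3

/-! ### Sums of squares and the order of the trace form -/

section SumsOfSquares

variable {k : Type u} [Field k]

theorem IsSumOfSquares.succ {m : ℕ} {α : k} (h : IsSumOfSquares m α) (c : k) :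
    IsSumOfSquares (m + 1) (c ^ 2 + α) := by
  obtain ⟨v, rfl⟩ := h
  exact ⟨Fin.cons c v, by simp [Fin.sum_univ_succ]⟩

theorem IsSumOfSquares.mono {m m' : ℕ} {α : k} (h : IsSumOfSquares m α) (hm : m ≤ m') :
    IsSumOfSquares m' α := by
  induction hm with
  | refl => exact h
  | step _ ih => simpa using ih.succ 0

theorem exists_isSumOfSquares_of_isSumSq {α : k} (h : IsSumSq α) :
    ∃ r, IsSumOfSquares (2 ^ r) α := by
  have h1 : ∃ m, IsSumOfSquares m α := by
    induction h with
    | zero => exact ⟨0, ![], by simp⟩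
    | sq_add c _ ih =>
      obtain ⟨m, hm⟩ := ih
      exact ⟨m + 1, by simpa [sq] using hm.succ c⟩
  obtain ⟨m, hm⟩ := h1
  exact ⟨m, hm.mono Nat.lt_two_pow_self.le⟩

theorem isSumOfSquares_of_tau_ne_zero {α : k} (h : tau α ≠ 0) : ∃ r, IsSumOfSquares (2 ^ r) α := by
  by_contra hc
  exact h (dif_neg hc)

theorem not_isSumSq_of_tau_eq_zero {α : k} (h : tau α = 0) : ¬ IsSumSq α := by
  intro hs
  have h1 := exists_isSumOfSquares_of_isSumSq hs
  rw [tau, dif_pos h1] at h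
  exact pow_ne_zero _ two_ne_zero h

variable [NeZero (2 : k)]

omit [NeZero (2 : k)] in
theorem two_pow_nsmul_squareClasses (x : SquareClasses k) {r : ℕ}
    (hr : r ≠ 0) : 2 ^ r • x = 0 := by
  obtain ⟨r, rfl⟩ := Nat.exists_eq_succ_of_ne_zero hr
  rw [pow_succ, mul_smul, two_nsmul_squareClasses, smul_zero]

/-- The class `m⟨1⟩` is that of a form all of whose values are sums of squares. -/
theorem GW.nsmul_unary_one (m : ℕ) : ∃ q : RegForm k, (m • GW.unary 1 : GW k) =
    GrothendieckAddGroup.of (FormClasses.mk q) ∧ ∀ v, IsSumSq (q.form v) := by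
  induction m with
  | zero => exact ⟨RegForm.zero k, by rw [zero_nsmul]; exact (map_zero _).symm, fun v => .zero⟩
  | succ m ih =>
    obtain ⟨q, hq, hv⟩ := ih
    refine ⟨q.sum (RegForm.unary 1), ?_, fun v => ?_⟩
    · rw [succ_nsmul, hq]
      exact (map_add GrothendieckAddGroup.of _ _).symm
    · have h1 : (q.sum (RegForm.unary (1 : kˣ))).form v =
          q.form v.1 +
          (1 : k) * ((show k from v.2) * (show k from v.2)) := rfl
      rw [h1, one_mul]
      exact (hv v.1).add (IsSumSq.mul_self _)

omit [NeZero (2 : k)] in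
theorem GW.exists_nsmul (q : RegForm k) (m : ℕ) : ∃ r : RegForm k,
    (m • GrothendieckAddGroup.of (FormClasses.mk q) : GW k) =
      GrothendieckAddGroup.of (FormClasses.mk r) := by
  induction m with
  | zero => exact ⟨RegForm.zero k, by rw [zero_nsmul]; exact (map_zero _).symm⟩
  | succ m ih =>
    obtain ⟨r, hr⟩ := ih
    exact ⟨r.sum q, by rw [succ_nsmul, hr]; exact (map_add GrothendieckAddGroup.of _ _).symm⟩

/-- If the quadratic trace form `⟨2⟩ + ⟨2δ⟩` differs from `2⟨1⟩` by torsion, then `δ` is a sum of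
squares, being up to squares a value of a multiple of `⟨1⟩`. -/
theorem isSumSq_of_nsmul_eq {δ : kˣ} {m : ℕ} (hm : m ≠ 0)
    (h : m • (GW.unary (Units.mk0 2 (NeZero.ne 2)) + GW.unary (Units.mk0 2 (NeZero.ne 2) * δ)) =
      (m * 2) • GW.unary 1) : IsSumSq (δ : k) := by
  obtain ⟨m, rfl⟩ := Nat.exists_eq_succ_of_ne_zero hm
  obtain ⟨q, hq, hv⟩ := GW.nsmul_unary_one (k := k) ((m + 1) * 2)
  let p : RegForm k := (RegForm.unary (Units.mk0 2 (NeZero.ne 2))).sum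
    (RegForm.unary (Units.mk0 2 (NeZero.ne 2) * δ))
  obtain ⟨r, hr⟩ := GW.exists_nsmul p m
  have h1 : GrothendieckAddGroup.of (FormClasses.mk (r.sum p)) =
      GrothendieckAddGroup.of (FormClasses.mk q) := by
    rw [← hq, ← h, succ_nsmul]
    refine (map_add GrothendieckAddGroup.of (FormClasses.mk r) (FormClasses.mk p)).trans ?_
    rw [← hr]
    exact congrArg (fun z => m • z + z) (map_add GrothendieckAddGroup.of
      (FormClasses.mk _) (FormClasses.mk _))
  obtain ⟨e⟩ := GW.equivalent_of_eq h1
  have h2 := e.map_app ((0, ((0 : k), (1 : k))) : (r.sum p).V)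
  have h3 : (r.sum p).form ((0, ((0 : k), (1 : k))) : (r.sum p).V) = r.form 0 +
      (2 * ((0 : k) * 0) + 2 * (δ : k) * (1 * 1)) := rfl
  rw [QuadraticMap.map_zero] at h3
  have h4 := hv (e ((0, ((0 : k), (1 : k))) : (r.sum p).V))
  rw [h2, h3] at h4
  have h20 : (2 : k) ≠ 0 := NeZero.ne 2
  have h5 := (h4.add h4).mul (IsSumSq.mul_self (2⁻¹ : k))
  convert h5 using 1
  field_simp
  ring

end SumsOfSquares

section Levels

variable {F : Type v} {K : Type u} [Field F] [Field K] [Algebra F K]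
variable [FiniteDimensional F K] [IsCyclic Gal(K/F)] {n : ℕ} (hG : Nat.card Gal(K/F) = 2 ^ n)
  [NeZero (2 : F)] [IsGalois F K]

omit [FiniteDimensional F K] [NeZero (2 : F)] [IsGalois F K] in
theorem mem_levelField_zero (t : K) : t ∈ levelField F K 0 := by
  refine (IntermediateField.mem_fixedField_iff _ _).2 fun f hf => ?_
  rw [mem_cyc, pow_zero, pow_one] at hf
  rw [hf]
  rfl

theorem dress_orb_zero [NeZero (2 : K)] (i : ℕ) : dress (cyc Gal(K/F) i) (orb Gal(K/F) i 0) =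
    GW.transfer (levelField F K i) (GW.unary (1 : Kˣ)) := by
  rw [dress_orb (Nat.zero_le i)]
  let _ := inclusionAlgebra (levelField_anti F K (Nat.zero_le i))
  have : IsScalarTower F (levelField F K i) (levelField F K 0) :=
    IsScalarTower.of_algebraMap_eq fun _ => rfl
  have : FiniteDimensional (levelField F K i) (levelField F K 0) :=
    FiniteDimensional.right F (levelField F K i) (levelField F K 0)
  have : Algebra.IsSeparable (levelField F K i) (levelField F K 0) :=
    Algebra.isSeparable_tower_top_of_isSeparable F (levelField F K i) (levelField F K 0)
  let e : levelField F K 0 ≃ₐ[levelField F K i] K := AlgEquiv.ofBijective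
    { (levelField F K 0).val.toRingHom with commutes' := fun _ => rfl }
    ⟨Subtype.val_injective, fun t => ⟨⟨t, mem_levelField_zero t⟩, rfl⟩⟩
  exact GW.transfer_unary_one_congr e

include hG

theorem dress_two_pow {i : ℕ} (hi : i ≤ n) (r : ℕ) :
    dress (cyc Gal(K/F) i) (2 ^ r) = 2 ^ r • GW.unary 1 := by
  have h2 : (2 ^ r : Burnside (cyc Gal(K/F) i)) = 2 ^ r • 1 := by
    rw [nsmul_one]; push_cast; rfl
  rw [h2, map_nsmul, dress_one hG hi]

/-- The order of the trace form, in terms of the Dress map. -/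
theorem traceOrder_eq {i : ℕ} (hi : i ≤ n) : traceOrder F K i =
    addOrderOf (dress (cyc Gal(K/F) i) (orb Gal(K/F) i 0 - 2 ^ i)) := by
  have : NeZero (2 : K) := ⟨fun h => NeZero.ne (2 : F)
      ((algebraMap F K).injective (by rw [map_ofNat, h, map_zero]))⟩
  rw [map_sub, dress_two_pow hG hi, dress_orb_zero]
  rfl

theorem traceOrder_dvd_iff {i : ℕ} (hi : i ≤ n) (m : ℕ) : traceOrder F K i ∣ m ↔
    m • dress (cyc Gal(K/F) i) (orb Gal(K/F) i 0 - 2 ^ i) = 0 := by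
  rw [traceOrder_eq hG hi, addOrderOf_dvd_iff_nsmul_eq_zero]

omit hG [IsCyclic Gal(K/F)] [NeZero (2 : F)] [IsGalois F K] in
/-- The automorphism of `K` given by a generator of `C_{2^i}` generates the Galois group of `K`
over the fixed field of `C_{2^i}`. -/
theorem mem_zpowers_levelAut {i : ℕ} {g : Gal(K/F)} (hg : cyc Gal(K/F) i = Subgroup.zpowers g)
    (σ : K ≃ₐ[levelField F K i] K) : σ ∈ Subgroup.zpowers (levelAut hg) := by
  have h1 : σ.restrictScalars F ∈ Subgroup.zpowers g := by
    rw [← hg, ← IntermediateField.fixingSubgroup_fixedField (cyc Gal(K/F) i),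
      IntermediateField.mem_fixingSubgroup_iff]
    exact fun x hx => σ.commutes ⟨x, hx⟩
  obtain ⟨m, hm⟩ := h1
  refine ⟨m, AlgEquiv.restrictScalars_injective F ?_⟩
  refine Eq.trans ?_ hm
  exact map_zpow (AlgEquiv.restrictScalarsHom F) (levelAut hg) m

theorem discr_dress_orb_zero_ne_zero {i : ℕ} (hi1 : 1 ≤ i) (hi : i ≤ n) :
    GW.discr _ (dress (cyc Gal(K/F) i) (orb Gal(K/F) i 0)) ≠ 0 := by
  have : NeZero (2 : K) := ⟨fun h => NeZero.ne (2 : F)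
      ((algebraMap F K).injective (by rw [map_ofNat, h, map_zero]))⟩
  obtain ⟨g, -, hg⟩ := exists_generator_cyc hG hi
  rw [dress_orb_zero]
  refine GW.discr_transfer_unary_one_ne_zero (mem_zpowers_levelAut hg) ?_
  rw [finrank_levelField hG hi]
  exact (Nat.even_pow' (by omega)).2 even_two

/-- The form `⟨2⟩ + ⟨2Δ⟩` has discriminant `Δ`, which is not a square. -/
theorem discr_dress_orb_quadratic_ne_zero {i j k : ℕ} (hj : j = i + 1) (hk : k = j + 1)
    (hi : k ≤ n) : GW.discr _ (dress (cyc Gal(K/F) k) (orb Gal(K/F) k j)) ≠ 0 := by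
  obtain ⟨g, -, hg⟩ := exists_generator_cyc hG hi
  obtain ⟨s, θ, Δ, x, a, b, h⟩ := exists_isQuartic_levelAut hG hj hk hi hg
  rw [h.dress_orb_quadratic hG hj hk hi, map_add, GW.discr_unary, GW.discr_unary, squareClass_mul,
    ← two_nsmul, two_nsmul_squareClasses, zero_add, ← add_assoc, ← two_nsmul,
    two_nsmul_squareClasses, zero_add]
  exact fun h0 => h.not_isSquare (squareClass_eq_zero_iff.1 h0)

/-- The trace form of `K` differs from `2 ^ i ⟨1⟩` by its discriminant. -/
theorem traceOrder_ne_one {i : ℕ} (hi1 : 1 ≤ i) (hi : i ≤ n) : traceOrder F K i ≠ 1 := by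
  rw [traceOrder_eq hG hi, Ne, AddMonoid.addOrderOf_eq_one_iff, map_sub, dress_two_pow hG hi,
    sub_eq_zero]
  intro h
  refine discr_dress_orb_zero_ne_zero hG hi1 hi ?_
  rw [h, map_nsmul, two_pow_nsmul_squareClasses _ (by omega)]

/-- The trace form of a level is the transfer of that of the level below, and by
`two_dress_orb_quadratic` the even multiple `2 ^ i ⟨1⟩` transfers to `2 ^ (i + 1) ⟨1⟩`. -/
theorem traceOrder_succ_dvd {i : ℕ} (hi1 : 1 ≤ i) (hi : i + 1 ≤ n) :
    traceOrder F K (i + 1) ∣ traceOrder F K i := by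
  rw [traceOrder_dvd_iff hG hi]
  have h0 := (traceOrder_dvd_iff hG (Nat.le_of_succ_le hi) _).1 (dvd_refl (traceOrder F K i))
  obtain ⟨l, rfl⟩ := Nat.exists_eq_add_of_le' hi1
  have h1 := two_dress_orb_quadratic hG (i := l) rfl rfl hi
  have h2 := dress_tr hG hi (Nat.le_succ (l + 1)) (cyc_mono _ (Nat.le_succ _))
    (orb Gal(K/F) (l + 1) 0 - 2 ^ (l + 1))
  have h3 : burnsideTr (cyc_mono Gal(K/F) (Nat.le_succ (l + 1)))
      (orb Gal(K/F) (l + 1) 0 - 2 ^ (l + 1)) = orb Gal(K/F) (l + 1 + 1) 0 -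
        2 ^ (l + 1) • orb Gal(K/F) (l + 1 + 1) (l + 1) := by
    have h4 : (2 ^ (l + 1) : Burnside (cyc Gal(K/F) (l + 1))) =
        2 ^ (l + 1) • orb Gal(K/F) (l + 1) (l + 1) := by
      rw [orb_self hG (by omega), nsmul_one]; push_cast; rfl
    rw [h4, map_sub, map_nsmul, tr_orb hG hi (Nat.zero_le _) (Nat.le_succ _),
      tr_orb hG hi le_rfl (Nat.le_succ _)]
  rw [h3, map_sub, map_nsmul, pow_succ, mul_smul, h1] at h2
  rw [map_sub, dress_two_pow hG hi, pow_succ, pow_succ, mul_assoc, mul_smul, show 2 * 2 = 4 from rfl,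
    h2, ← map_nsmul, h0, map_zero]

/-- Base change to the level below doubles the difference of the trace form and a multiple of
`⟨1⟩`. -/
theorem traceOrder_dvd_two_mul {i : ℕ} (hi : i + 1 ≤ n) :
    traceOrder F K i ∣ 2 * traceOrder F K (i + 1) := by
  rw [traceOrder_dvd_iff hG (Nat.le_of_succ_le hi)]
  have h0 := (traceOrder_dvd_iff hG hi _).1 (dvd_refl (traceOrder F K (i + 1)))
  have h1 := dress_res hG hi (cyc_mono _ (Nat.le_succ i)) (orb Gal(K/F) (i + 1) 0 - 2 ^ (i + 1))
  rw [map_sub, res_orb_of_le hG hi (Nat.zero_le _) (Nat.le_succ _), map_pow, map_ofNat,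
    Nat.add_sub_cancel_left, pow_one, pow_succ', ← mul_sub, two_mul, map_add, ← two_nsmul] at h1
  rw [mul_comm, mul_smul, h1, ← map_nsmul, h0, map_zero]

variable {g : Gal(K/F)} (hn : 2 ≤ n) (P : QuarticPresentation F K)
include hn

/-- The trace form of `K` over `K^{C_2}` is `⟨2⟩ + ⟨2δ⟩`. -/
theorem QuarticPresentation.exists_dress_orb : ∃ δ : (levelField F K 1)ˣ,
    (δ : levelField F K 1) = P.δ ∧ dress (cyc Gal(K/F) 1) (orb Gal(K/F) 1 0) =
      GW.unary (Units.mk0 2 (NeZero.ne 2)) + GW.unary (Units.mk0 2 (NeZero.ne 2) * δ) := by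
  obtain ⟨g, -, hg⟩ := exists_generator_cyc hG hn
  have h := P.isQuartic hG hn hg
  have h1 := P.sqrtδ_sq
  have hδ0 : P.δ ≠ 0 := by
    intro h0
    rw [h0] at h1
    exact h.θ_ne_zero (pow_eq_zero_iff two_ne_zero |>.1 h1)
  have hgm : g * g ∈ cyc Gal(K/F) 1 := sq_mem_cyc (hg ▸ Subgroup.mem_zpowers g)
  refine ⟨Units.mk0 P.δ hδ0, rfl, ?_⟩
  rw [dress_orb (Nat.zero_le 1)]
  exact fieldTransfer_unary_one_of_sq _
    (finrank_levelField_succ hG (by omega)) (fun x hx => apply_eq_of_mem_levelField hgm hx)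
    (fun x hx => apply_mem_levelField (g * g) hx) (mem_levelField_zero _) h.apply_θ_eq h1

/-- If `δ` is a sum of `2 ^ r` squares, then `2 ^ r ⟨δ⟩ = 2 ^ r ⟨1⟩`, so that the trace forms
differ from multiples of `⟨1⟩` by `2`-primary torsion. -/
theorem QuarticPresentation.exists_traceOrder_dvd (hτ : tau P.δ ≠ 0) {i : ℕ} (hi1 : 1 ≤ i)
    (hi : i ≤ n) : ∃ r, traceOrder F K i ∣ 2 ^ r := by
  suffices h : ∃ r, traceOrder F K 1 ∣ 2 ^ r by
    obtain ⟨r, hr⟩ := h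
    refine ⟨r, dvd_trans ?_ hr⟩
    induction hi1 with
    | refl => exact dvd_rfl
    | step h ih => exact (traceOrder_succ_dvd hG h hi).trans (ih (Nat.le_of_succ_le hi))
  obtain ⟨δ, hδ, h⟩ := P.exists_dress_orb hG hn
  rw [← hδ] at hτ
  obtain ⟨r, hr⟩ := isSumOfSquares_of_tau_ne_zero hτ
  have h2 : GW.unary (Units.mk0 2 (NeZero.ne 2)) + GW.unary (Units.mk0 2 (NeZero.ne 2)) =
      GW.unary (1 : (levelField F K 1)ˣ) + GW.unary 1 := by
    have := GW.two_unary_mul (d := Units.mk0 2 (NeZero.ne (2 : levelField F K 1))) 1 1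
      (by rw [Units.val_mk0]; norm_num) 1
    rw [one_mul] at this
    exact this.symm
  refine ⟨r, (traceOrder_dvd_iff hG (by omega) _).2 ?_⟩
  rw [map_sub, dress_two_pow hG (by omega), h, smul_sub, smul_add,
    GW.two_pow_smul_unary_mul r δ hr, ← smul_add, h2, pow_one, two_nsmul, sub_self]

/-- If `δ` is not a sum of squares, then the trace forms differ from multiples of `⟨1⟩` by elements
of infinite order. -/
theorem QuarticPresentation.traceOrder_eq_zero (hτ : tau P.δ = 0) {i : ℕ} (hi1 : 1 ≤ i)
    (hi : i ≤ n) : traceOrder F K i = 0 := by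
  induction hi1 with
  | refl =>
    obtain ⟨δ, hδ, h⟩ := P.exists_dress_orb hG hn
    rw [← hδ] at hτ
    by_contra hm
    refine not_isSumSq_of_tau_eq_zero hτ (isSumSq_of_nsmul_eq hm ?_)
    have h0 := (traceOrder_dvd_iff hG hi _).1 (dvd_refl (traceOrder F K 1))
    rwa [map_sub, dress_two_pow hG hi, pow_one, smul_sub, sub_eq_zero, h, ← mul_smul] at h0
  | step _ ih =>
    have h1 := traceOrder_dvd_two_mul hG hi
    rw [ih (by omega), zero_dvd_iff] at h1
    exact (mul_eq_zero.1 h1).resolve_left two_ne_zero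

end Levels

/-! ### Norms of the basic relations -/

section Relations

variable (G : Type u) [Group G] [Finite G]

/-- The relation `[C / C_{2^i}] = [C / C_{2^(i+1)}] + 2` in the Burnside ring of
`C = C_{2^(i+2)}`. -/
noncomputable def quarticRel (i : ℕ) : Burnside (cyc G (i + 1 + 1)) :=
  orb G (i + 1 + 1) i - orb G (i + 1 + 1) (i + 1) - 2

/-- The relation `2 [C / C_{2^i}] = 4` in the Burnside ring of `C = C_{2^(i+1)}`. -/
noncomputable def doubleRel (i : ℕ) : Burnside (cyc G (i + 1)) := 2 * orb G (i + 1) i - 4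

/-- The relation `[C / 1] - 2 ^ (i + 1) = [C / C_{2^i}] - 2` in the Burnside ring of
`C = C_{2^(i+1)}`. -/
noncomputable def regularRel (i : ℕ) : Burnside (cyc G (i + 1)) :=
  orb G (i + 1) 0 - orb G (i + 1) i - 2 ^ (i + 1) + 2

/-- The relation `[C / 1] = [C / C_2] + 2 [C / C_4]` in the Burnside ring of `C = C_{2^i}`. -/
noncomputable def bottomRel (i : ℕ) : Burnside (cyc G i) :=
  orb G i 0 - orb G i 1 - 2 * orb G i 2

/-- The difference `[C / 1] - 2 ^ i` in the Burnside ring of `C = C_{2^i}`. -/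
noncomputable def rankRel (i : ℕ) : Burnside (cyc G i) := orb G i 0 - 2 ^ i

variable {G} [IsCyclic G] {n : ℕ} (hG : Nat.card G = 2 ^ n)

omit [Finite G] in
theorem mul_self_notMem_cyc {i a : ℕ} (ha : a < i) {g : G} (hg : g ∉ cyc G i) :
    g * g ∉ cyc G a := by
  intro h
  refine hg (cyc_mono G (show a + 1 ≤ i from ha) ?_)
  rw [mem_cyc] at h ⊢
  rw [pow_succ', pow_mul, sq, h]

include hG

theorem intCast_tr {c i : ℕ} (hi : i ≤ n) (hc : c ≤ i) (h : cyc G c ≤ cyc G i) (m : ℤ) :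
    burnsideTr h (m : Burnside (cyc G c)) = m * orb G i c := by
  rw [← zsmul_one, ← orb_self hG (hc.trans hi), map_zsmul, tr_orb hG hi le_rfl hc, zsmul_eq_mul]

open Classical in
theorem mark_orb_of_add_eq {i a d : ℕ} (hi : i ≤ n) (hd : a + d = i) (g : cyc G i) :
    Burnside.mark g (orb G i a) = if (g : G) ∈ cyc G a then 2 ^ d else 0 := by
  subst hd
  rw [mark_orb hG hi (by omega), Nat.add_sub_cancel_left]

section

variable {i : ℕ}

theorem tr_quarticRel {d : ℕ} (hi : i ≤ n) (hd : d + 1 + 1 ≤ i) (h : cyc G (d + 1 + 1) ≤ cyc G i) :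
    burnsideTr h (quarticRel G d) = orb G i d - orb G i (d + 1) - 2 * orb G i (d + 2) := by
  have h2 := intCast_tr hG hi hd h 2
  push_cast at h2
  rw [quarticRel, map_sub, map_sub, tr_orb hG hi (by omega) hd,
    tr_orb hG hi (by omega) hd, h2]

/-- Norm and transfer carry the quartic relation to the one at the next level. -/
theorem norm_quarticRel (hi : i + 1 + 1 + 1 ≤ n) (h : cyc G (i + 1 + 1) ≤ cyc G (i + 1 + 1 + 1)) :
    burnsideNorm h (quarticRel G i) =
      quarticRel G (i + 1) - 2 * burnsideTr h (quarticRel G i) := by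
  classical
  rw [tr_quarticRel hG hi (Nat.le_succ _)]
  refine ext_mark hG hi fun g => ?_
  rw [mark_norm hG hi]
  have o0 := mark_orb_of_add_eq hG hi (show i + 3 = _ from rfl) g
  have o1 := mark_orb_of_add_eq hG hi (show i + 1 + 2 = _ from rfl) g
  have o2 := mark_orb_of_add_eq hG hi (show i + 1 + 1 + 1 = _ from rfl) g
  have p0 := mark_orb_of_add_eq hG (Nat.le_of_succ_le hi) (show i + 2 = _ from rfl)
  have p1 := mark_orb_of_add_eq hG (Nat.le_of_succ_le hi) (show i + 1 + 1 = _ from rfl)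
  simp only [quarticRel, map_sub, map_mul, map_ofNat, o0, o1, o2, p0, p1]
  by_cases h2 : (g : G) ∈ cyc G (i + 1 + 1)
  · by_cases h1 : (g : G) ∈ cyc G (i + 1)
    · by_cases h0 : (g : G) ∈ cyc G i <;> simp [h0, h1, h2]
    · have h0 : (g : G) ∉ cyc G i := fun h => h1 (cyc_mono G (Nat.le_succ i) h)
      simp [h0, h1, h2]
  · have h1 : (g : G) ∉ cyc G (i + 1) := fun h => h2 (cyc_mono G (Nat.le_succ _) h)
    have h0 : (g : G) ∉ cyc G i := fun h => h1 (cyc_mono G (Nat.le_succ i) h)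
    have k1 := mul_self_notMem_cyc (show i + 1 < i + 1 + 1 by omega) h2
    have k0 := mul_self_notMem_cyc (show i < i + 1 + 1 by omega) h2
    simp [h0, h1, h2, k0, k1]

/-- The relation `doubleRel` of a level follows from that of the level below, up to the quartic
relation. -/
theorem tr_doubleRel (hi : i + 1 + 1 ≤ n) (h : cyc G (i + 1) ≤ cyc G (i + 1 + 1)) :
    burnsideTr h (doubleRel G i) = 2 * quarticRel G i - doubleRel G (i + 1) := by
  have h2 := intCast_tr hG hi (Nat.le_succ _) h 4
  push_cast at h2
  rw [doubleRel, two_mul, map_sub, map_add, tr_orb hG hi (by omega) (by omega), h2, quarticRel,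
    doubleRel]
  ring

theorem norm_doubleRel (hi : i + 1 + 1 ≤ n) (h : cyc G (i + 1) ≤ cyc G (i + 1 + 1)) :
    burnsideNorm h (doubleRel G i) = 3 * doubleRel G (i + 1) - 4 * quarticRel G i := by
  classical
  refine ext_mark hG hi fun g => ?_
  rw [mark_norm hG hi]
  have o0 := mark_orb_of_add_eq hG hi (show i + 2 = _ from rfl) g
  have o1 := mark_orb_of_add_eq hG hi (show i + 1 + 1 = _ from rfl) g
  have p0 := mark_orb_of_add_eq hG (Nat.le_of_succ_le hi) (show i + 1 = _ from rfl)
  simp only [doubleRel, quarticRel, map_sub, map_mul, map_ofNat, o0, o1, p0]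
  by_cases h1 : (g : G) ∈ cyc G (i + 1)
  · by_cases h0 : (g : G) ∈ cyc G i <;> simp [h0, h1]
  · have h0 : (g : G) ∉ cyc G i := fun h => h1 (cyc_mono G (Nat.le_succ i) h)
    have k0 := mul_self_notMem_cyc (Nat.lt_succ_self i) h1
    simp [h0, h1, k0]

/-- The relation `regularRel` of a level follows from that of the level below, up to the other
relations. -/
theorem tr_regularRel (hi : i + 1 + 1 ≤ n) (h : cyc G (i + 1) ≤ cyc G (i + 1 + 1)) :
    burnsideTr h (regularRel G i) = regularRel G (i + 1) - quarticRel G i -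
      (2 ^ i - 1) * doubleRel G (i + 1) := by
  have h2 := intCast_tr hG hi (Nat.le_succ _) h (2 - 2 ^ (i + 1))
  push_cast at h2
  have h3 : regularRel G i = orb G (i + 1) 0 - orb G (i + 1) i + (2 - 2 ^ (i + 1)) := by
    rw [regularRel]
    ring
  rw [h3, map_add, map_sub, tr_orb hG hi (by omega) (by omega), tr_orb hG hi (by omega) (by omega),
    h2, regularRel, quarticRel, doubleRel]
  ring

theorem tr_rankRel (hi : i + 1 ≤ n) (h : cyc G i ≤ cyc G (i + 1)) :
    burnsideTr h (rankRel G i) = orb G (i + 1) 0 - 2 ^ i * orb G (i + 1) i := by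
  have h2 := intCast_tr hG hi (Nat.le_succ _) h (2 ^ i)
  push_cast at h2
  rw [rankRel, map_sub, tr_orb hG hi (by omega) (by omega), h2]

theorem tr_bottomRel (hi : i + 1 ≤ n) (hi2 : 2 ≤ i) (h : cyc G i ≤ cyc G (i + 1)) :
    burnsideTr h (bottomRel G i) = bottomRel G (i + 1) := by
  rw [bottomRel, two_mul, map_sub, map_sub, map_add, tr_orb hG hi (by omega) (by omega),
    tr_orb hG hi (by omega) (by omega), tr_orb hG hi (by omega) (by omega), ← two_mul, bottomRel]

/-- The norm of `regularRel` is already a consequence of the quartic relation and of the transfer.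
-/
theorem norm_regularRel (hi : i + 1 + 1 ≤ n) (h : cyc G (i + 1) ≤ cyc G (i + 1 + 1)) :
    burnsideNorm h (regularRel G i) =
      (2 ^ i - 1) * quarticRel G i - 2 ^ i * burnsideTr h (regularRel G i) := by
  classical
  rw [tr_regularRel hG hi]
  refine ext_mark hG hi fun g => ?_
  rw [mark_norm hG hi]
  have oz := mark_orb_of_add_eq hG hi (show 0 + (i + 1 + 1) = _ from zero_add _) g
  have o0 := mark_orb_of_add_eq hG hi (show i + 2 = _ from rfl) g
  have o1 := mark_orb_of_add_eq hG hi (show i + 1 + 1 = _ from rfl) g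
  have pz := mark_orb_of_add_eq hG (Nat.le_of_succ_le hi) (show 0 + (i + 1) = _ from zero_add _)
  have p0 := mark_orb_of_add_eq hG (Nat.le_of_succ_le hi) (show i + 1 = _ from rfl)
  simp only [doubleRel, quarticRel, regularRel, map_sub, map_add, map_mul, map_pow, map_ofNat,
    map_one, oz, o0, o1, pz, p0]
  by_cases h1 : (g : G) ∈ cyc G (i + 1)
  · by_cases h0 : (g : G) ∈ cyc G i
    · by_cases hz : (g : G) ∈ cyc G 0
      · simp [h0, h1, hz]
      · simp [h0, h1, hz]
        ring
    · have hz : (g : G) ∉ cyc G 0 := fun h => h0 (cyc_mono G (Nat.zero_le i) h)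
      simp [h0, h1, hz]
      ring
  · have h0 : (g : G) ∉ cyc G i := fun h => h1 (cyc_mono G (Nat.le_succ i) h)
    have hz : (g : G) ∉ cyc G 0 := fun h => h0 (cyc_mono G (Nat.zero_le i) h)
    have k0 := mul_self_notMem_cyc (Nat.lt_succ_self i) h1
    have kz := mul_self_notMem_cyc (Nat.succ_pos i) h1
    simp [h0, h1, hz, k0, kz]
    ring

/-- The norm of an even multiple of `[C / 1] - 2 ^ (i + 1)`. -/
theorem norm_rankRel (hi : i + 1 + 1 ≤ n) (h : cyc G (i + 1) ≤ cyc G (i + 1 + 1)) (m : ℕ) :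
    burnsideNorm h ((2 * m : ℕ) * rankRel G (i + 1)) =
      m * 2 ^ i * doubleRel G (i + 1) -
        2 * m ^ 2 * 2 ^ (i + 1) * burnsideTr h (rankRel G (i + 1)) := by
  classical
  rw [tr_rankRel hG hi]
  refine ext_mark hG hi fun g => ?_
  rw [mark_norm hG hi]
  have oz := mark_orb_of_add_eq hG hi (show 0 + (i + 1 + 1) = _ from zero_add _) g
  have o1 := mark_orb_of_add_eq hG hi (show i + 1 + 1 = _ from rfl) g
  have pz := mark_orb_of_add_eq hG (Nat.le_of_succ_le hi) (show 0 + (i + 1) = _ from zero_add _)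
  simp only [doubleRel, rankRel, map_sub, map_mul, map_pow, map_ofNat, map_natCast, oz, o1, pz]
  by_cases h1 : (g : G) ∈ cyc G (i + 1)
  · by_cases hz : (g : G) ∈ cyc G 0
    · simp [h1, hz]
      exact Or.inr (by ring)
    · simp [h1, hz]
      ring
  · have hz : (g : G) ∉ cyc G 0 := fun h => h1 (cyc_mono G (Nat.zero_le _) h)
    have kz := mul_self_notMem_cyc (Nat.succ_pos i) h1
    simp [h1, hz, kz]
    ring

/-- A transferred element has a transferred norm. -/
theorem norm_tr (hi : i + 1 + 1 ≤ n) (h : cyc G i ≤ cyc G (i + 1))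
    (h' : cyc G (i + 1) ≤ cyc G (i + 1 + 1)) (a : Burnside (cyc G i)) :
    burnsideNorm h' (burnsideTr h a) = burnsideTr h' (burnsideTr h (a * a)) := by
  classical
  refine ext_mark hG hi fun g => ?_
  rw [mark_norm hG hi, mark_tr hG hi (Nat.le_succ _)]
  split_ifs with h1
  · rw [mark_tr hG (Nat.le_of_succ_le hi) (Nat.le_succ _), mark_tr hG (Nat.le_of_succ_le hi)
      (Nat.le_succ _), Nat.add_sub_cancel_left, Nat.add_sub_cancel_left]
    split_ifs with h0
    · rw [map_mul]; ring
    · ring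
  · rw [mark_tr hG (Nat.le_of_succ_le hi) (Nat.le_succ _),
      dif_neg (mul_self_notMem_cyc (Nat.lt_succ_self i) h1)]

theorem res_quarticRel (hi : i + 1 + 1 ≤ n) (h : cyc G (i + 1) ≤ cyc G (i + 1 + 1)) :
    burnsideRes h (quarticRel G i) = doubleRel G i := by
  rw [quarticRel, map_sub, map_sub, map_ofNat, res_orb_of_le hG hi (by omega) (by omega),
    res_orb_of_ge hG hi le_rfl (by omega), Nat.add_sub_cancel_left, doubleRel]
  ring

theorem res_regularRel (hi : i + 1 ≤ n) (h : cyc G i ≤ cyc G (i + 1)) :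
    burnsideRes h (regularRel G i) = 2 * rankRel G i := by
  rw [regularRel, map_add, map_sub, map_sub, map_ofNat, map_pow, map_ofNat,
    res_orb_of_le hG hi (Nat.zero_le _) (by omega),
    res_orb_of_ge hG hi le_rfl (by omega), Nat.add_sub_cancel_left, rankRel]
  ring

end

end Relations

/-! ### Generators of the kernels of the Dress maps -/

section Levels

variable {F : Type v} {K : Type u} [Field F] [Field K] [Algebra F K]
variable [FiniteDimensional F K] [IsCyclic Gal(K/F)] {n : ℕ} (hG : Nat.card Gal(K/F) = 2 ^ n)
  [NeZero (2 : F)] [IsGalois F K]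
include hG

/-- The order is either infinite or a nontrivial power of `2`, according to whether `δ` is a sum of
squares. -/
theorem traceOrder_eq_zero_or_exists_eq_two_pow (hn : 2 ≤ n) {i : ℕ} (hi1 : 1 ≤ i) (hi : i ≤ n) :
    traceOrder F K i = 0 ∨ ∃ k, 1 ≤ k ∧ traceOrder F K i = 2 ^ k := by
  obtain ⟨P⟩ := nonempty_quarticPresentation hG hn
  by_cases hτ : tau P.δ = 0
  · exact Or.inl (P.traceOrder_eq_zero hG hn hτ hi1 hi)
  obtain ⟨r, hr⟩ := P.exists_traceOrder_dvd hG hn hτ hi1 hi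
  obtain ⟨k, -, hk⟩ := (Nat.dvd_prime_pow Nat.prime_two).1 hr
  refine Or.inr ⟨k, Nat.one_le_iff_ne_zero.2 ?_, hk⟩
  rintro rfl
  exact traceOrder_ne_one hG hi1 hi hk

theorem two_dvd_traceOrder (hn : 2 ≤ n) {i : ℕ} (hi1 : 1 ≤ i) (hi : i ≤ n) :
    2 ∣ traceOrder F K i := by
  rcases traceOrder_eq_zero_or_exists_eq_two_pow hG hn hi1 hi with h | ⟨k, hk, h⟩
  · exact h ▸ dvd_zero 2
  · exact h ▸ dvd_pow_self 2 (by omega)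

theorem dress_quarticRel {i : ℕ} (hi1 : 1 ≤ i) (hi : i + 1 + 1 ≤ n) :
    dress (cyc Gal(K/F) (i + 1 + 1)) (quarticRel _ i) = 0 := by
  have h2 : (2 : Burnside (cyc Gal(K/F) (i + 1 + 1))) = 1 + 1 := by norm_num
  rw [quarticRel, map_sub, map_sub, dress_orb_quartic_eq hG hi1 rfl rfl hi, h2, map_add,
    dress_one hG hi]
  abel

theorem dress_doubleRel {i : ℕ} (hi1 : 1 ≤ i) (hi : i + 1 ≤ n) :
    dress (cyc Gal(K/F) (i + 1)) (doubleRel _ i) = 0 := by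
  obtain ⟨l, rfl⟩ := Nat.exists_eq_add_of_le' hi1
  have h4 : (4 : Burnside (cyc Gal(K/F) (l + 1 + 1))) = 4 • 1 := by
    rw [nsmul_one]; norm_num
  rw [doubleRel, map_sub, two_mul, map_add, ← two_nsmul, two_dress_orb_quadratic hG rfl rfl hi, h4,
    map_nsmul, dress_one hG hi, sub_self]

theorem dress_tr_eq_zero {c i : ℕ} (hi : i ≤ n) (hc : c ≤ i) (h : cyc Gal(K/F) c ≤ cyc Gal(K/F) i)
    {z : Burnside (cyc Gal(K/F) c)} (hz : dress _ z = 0) :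
    dress (cyc Gal(K/F) i) (burnsideTr h z) = 0 := by
  rw [dress_tr hG hi hc, hz, map_zero]

omit [FiniteDimensional F K] [IsCyclic Gal(K/F)] hG [NeZero (2 : F)] [IsGalois F K] in
theorem res_res {G : Type u} [Group G] [Finite G] [IsCyclic G] (hG : Nat.card G = 2 ^ n)
    {b c i : ℕ} (hb : b ≤ n) (h : cyc G b ≤ cyc G c) (h' : cyc G c ≤ cyc G i)
    (h'' : cyc G b ≤ cyc G i) (z : Burnside (cyc G i)) :
    burnsideRes h (burnsideRes h' z) = burnsideRes h'' z :=
  ext_mark hG hb fun g => by rw [mark_res, mark_res, mark_res]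

omit [FiniteDimensional F K] [IsCyclic Gal(K/F)] hG [NeZero (2 : F)] [IsGalois F K] in
theorem res_self {G : Type u} [Group G] [Finite G] [IsCyclic G] (hG : Nat.card G = 2 ^ n)
    {i : ℕ} (hi : i ≤ n) (h : cyc G i ≤ cyc G i) (z : Burnside (cyc G i)) : burnsideRes h z = z :=
  ext_mark hG hi fun g => by rw [mark_res]

theorem dress_res_eq_zero {c i : ℕ} (hi : i ≤ n) (hc : c ≤ i)
    (h : cyc Gal(K/F) c ≤ cyc Gal(K/F) i)
    {z : Burnside (cyc Gal(K/F) i)} (hz : dress _ z = 0) :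
    dress (cyc Gal(K/F) c) (burnsideRes h z) = 0 := by
  induction hc with
  | refl => rwa [res_self hG hi]
  | @step i hc ih =>
    have h1 := dress_res hG hi (cyc_mono _ (Nat.le_succ i)) z
    rw [hz, map_zero] at h1
    have h2 := ih (Nat.le_of_succ_le hi) (cyc_mono _ hc) h1
    rwa [res_res hG (Nat.le_trans hc (Nat.le_of_succ_le hi)) _ _ h] at h2

/-- The kernels of the Dress maps are ideals: multiplication by a transitive set is a restriction
followed by a transfer. -/
theorem dress_mul_eq_zero {i : ℕ} (hi : i ≤ n) (b : Burnside (cyc Gal(K/F) i))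
    {z : Burnside (cyc Gal(K/F) i)} (hz : dress _ z = 0) :
    dress (cyc Gal(K/F) i) (b * z) = 0 := by
  obtain ⟨w, rfl⟩ := exists_eq_sum_orb hG hi b
  refine Finset.sum_induction _ (fun b => dress (cyc Gal(K/F) i) (b * z) = 0)
    (fun a b ha hb => ?_) (by rw [zero_mul, map_zero]) fun c hc => ?_
  · rw [add_mul, map_add, ha, hb, add_zero]
  have hci : c ≤ i := Nat.lt_succ_iff.1 (Finset.mem_range.1 hc)
  have h1 := tr_res_mul hG hi hci (cyc_mono _ hci) z 1
  rw [← orb_self hG (hci.trans hi), tr_orb hG hi le_rfl hci, orb_self hG (hci.trans hi), mul_one,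
    mul_comm] at h1
  rw [smul_mul_assoc, map_zsmul, ← h1,
    dress_tr_eq_zero hG hi hci _ (dress_res_eq_zero hG hi hci _ hz), smul_zero]

variable {i : ℕ} {J : AddSubgroup (Burnside (cyc Gal(K/F) (i + 1)))}

omit [NeZero (2 : F)] [IsGalois F K] in
/-- Modulo the transfers of quartic relations, each transitive set other than the regular one is a
combination of the set with two elements and the one-point set. -/
theorem exists_orb_sub_mem (hi : i + 1 ≤ n)
    (hrel : ∀ d, 1 ≤ d → d + 2 ≤ i + 1 →
      orb Gal(K/F) (i + 1) d - orb _ (i + 1) (d + 1) - 2 * orb _ (i + 1) (d + 2) ∈ J)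
    {d : ℕ} (hd1 : 1 ≤ d) (hd : d ≤ i + 1) :
    ∃ p q : ℤ, orb Gal(K/F) (i + 1) d - (p • orb _ (i + 1) i + q • 1) ∈ J := by
  obtain ⟨e, he⟩ := Nat.exists_eq_add_of_le hd
  induction e using Nat.strong_induction_on generalizing d with
  | _ e ih =>
    rcases e with _ | _ | e
    · obtain rfl : d = i + 1 := by omega
      exact ⟨0, 1, by rw [orb_self hG hi]; simp⟩
    · obtain rfl : d = i := by omega
      exact ⟨1, 0, by simp⟩
    · obtain ⟨p, q, h⟩ := ih (e + 1) (by omega) (d := d + 1) (by omega) (by omega) (by omega)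
      obtain ⟨p', q', h'⟩ := ih e (by omega) (d := d + 2) (by omega) (by omega) (by omega)
      refine ⟨p + 2 * p', q + 2 * q', ?_⟩
      convert J.add_mem (hrel d hd1 (by omega)) (J.add_mem h (J.zsmul_mem h' 2)) using 1
      simp only [add_smul, mul_smul, smul_sub, smul_add, zsmul_eq_mul]
      push_cast
      ring

omit [NeZero (2 : F)] [IsGalois F K] in
/-- Modulo the transfers of quartic relations, every virtual set is a combination of the regular
set, the set with two elements and the one-point set. -/
theorem exists_sub_mem (hi : i + 1 ≤ n)
    (hrel : ∀ d, 1 ≤ d → d + 2 ≤ i + 1 →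
      orb Gal(K/F) (i + 1) d - orb _ (i + 1) (d + 1) - 2 * orb _ (i + 1) (d + 2) ∈ J)
    (z : Burnside (cyc Gal(K/F) (i + 1))) :
    ∃ x p q : ℤ, z - (x • orb _ (i + 1) 0 + p • orb _ (i + 1) i + q • 1) ∈ J := by
  obtain ⟨c, rfl⟩ := exists_eq_sum_orb hG hi z
  refine Finset.sum_induction _ (fun z => ∃ x p q : ℤ,
    z - (x • orb _ (i + 1) 0 + p • orb _ (i + 1) i + q • 1) ∈ J) ?_ ?_ ?_
  · rintro a b ⟨x, p, q, h⟩ ⟨x', p', q', h'⟩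
    refine ⟨x + x', p + p', q + q', ?_⟩
    convert J.add_mem h h' using 1
    simp only [add_smul]
    abel
  · exact ⟨0, 0, 0, by simp⟩
  · intro d hd
    rcases Nat.eq_zero_or_pos d with rfl | hd1
    · exact ⟨c 0, 0, 0, by simp⟩
    · obtain ⟨p, q, h⟩ := exists_orb_sub_mem hG hi hrel hd1
        (Nat.lt_succ_iff.1 (Finset.mem_range.1 hd))
      refine ⟨0, c d * p, c d * q, ?_⟩
      convert J.zsmul_mem h (c d) using 1
      simp only [zero_smul, zero_add, smul_sub, smul_add, mul_smul]

omit hG [IsCyclic Gal(K/F)] in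
theorem zsmul_rankRel_mem
    (hrank : (traceOrder F K (i + 1) : Burnside (cyc Gal(K/F) (i + 1))) *
      rankRel Gal(K/F) (i + 1) ∈ J) {x : ℤ} (hx : (traceOrder F K (i + 1) : ℤ) ∣ x) :
    x • rankRel Gal(K/F) (i + 1) ∈ J := by
  obtain ⟨y, rfl⟩ := hx
  convert J.zsmul_mem hrank y using 1
  simp only [zsmul_eq_mul]
  push_cast
  ring

/-- The kernel of the Dress map is generated, as an additive group, by relations of four shapes.
Modulo the first shape, the rank shows that an element of the kernel has the form
`x ([C / 1] - 2 ^ (i + 1)) + p ([C / C_{2^i}] - 2)`. For even `p` the last summand is a multiple of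
`doubleRel`; for odd `p` the discriminant forces `x` to be
odd, so that the order of the trace form is at most `2` and `regularRel` lies in the kernel. -/
theorem mem_of_dress_eq_zero (hn : 2 ≤ n) (hi : i + 1 ≤ n)
    (hJ : ∀ z ∈ J, dress _ z = 0)
    (hrel : ∀ d, 1 ≤ d → d + 2 ≤ i + 1 →
      orb Gal(K/F) (i + 1) d - orb _ (i + 1) (d + 1) - 2 * orb _ (i + 1) (d + 2) ∈ J)
    (hdouble : 1 ≤ i → doubleRel Gal(K/F) i ∈ J)
    (hreg : 1 ≤ i → dress _ (regularRel Gal(K/F) i) = 0 → regularRel Gal(K/F) i ∈ J)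
    (hrank : (traceOrder F K (i + 1) : Burnside (cyc Gal(K/F) (i + 1))) *
      rankRel Gal(K/F) (i + 1) ∈ J)
    {z : Burnside (cyc Gal(K/F) (i + 1))} (hz : dress _ z = 0) : z ∈ J := by
  have hdvd : ∀ x : ℤ, dress _ (x • rankRel Gal(K/F) (i + 1)) = 0 →
      (traceOrder F K (i + 1) : ℤ) ∣ x := fun x hx => by
    rw [traceOrder_eq hG hi]
    rw [map_zsmul] at hx
    exact addOrderOf_dvd_iff_zsmul_eq_zero.2 hx
  obtain ⟨x, p, q, hxpq⟩ := exists_sub_mem hG hi hrel z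
  have h0 := hJ _ hxpq
  rw [map_sub, hz, zero_sub, neg_eq_zero] at h0
  have h1 : x • orb Gal(K/F) (i + 1) 0 + p • orb _ (i + 1) i + q • 1 ∈ J → z ∈ J := fun h => by
    convert J.add_mem hxpq h using 1
    abel
  refine h1 ?_
  clear h1 hxpq hz
  have hr := congrArg (GW.rank _) h0
  simp only [map_add, map_zsmul, dress_one hG hi, GW.rank_unary,
    rank_dress_orb hG hi (Nat.zero_le _), rank_dress_orb hG hi (Nat.le_succ i), Nat.sub_zero,
    Nat.add_sub_cancel_left, pow_one, map_zero, smul_eq_mul, mul_one] at hr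
  have hq : q = -(x * 2 ^ (i + 1) + p * 2) := by linear_combination hr
  have hw : x • orb Gal(K/F) (i + 1) 0 + p • orb _ (i + 1) i + q • 1 =
      x • rankRel Gal(K/F) (i + 1) + p • (orb _ (i + 1) i - 2) := by
    rw [hq, rankRel]
    simp only [zsmul_eq_mul]
    push_cast
    ring
  rw [hw] at h0 ⊢
  rcases Nat.eq_zero_or_pos i with rfl | hi1
  · have h2 : x • rankRel Gal(K/F) (0 + 1) + p • (orb _ (0 + 1) 0 - 2) =
        (x + p) • rankRel Gal(K/F) (0 + 1) := by
      rw [rankRel]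
      simp only [zsmul_eq_mul]
      push_cast
      ring
    rw [h2] at h0 ⊢
    exact zsmul_rankRel_mem hrank (hdvd _ h0)
  have hd0 := dress_doubleRel hG hi1 hi
  obtain ⟨r, rfl | rfl⟩ := Int.even_or_odd' p
  · have h2 : (2 * r) • (orb Gal(K/F) (i + 1) i - 2) = r • doubleRel Gal(K/F) i := by
      rw [doubleRel]
      simp only [zsmul_eq_mul]
      push_cast
      ring
    rw [h2] at h0 ⊢
    refine J.add_mem (zsmul_rankRel_mem hrank (hdvd _ ?_)) (J.zsmul_mem (hdouble hi1) r)
    rw [map_add, map_zsmul _ r, hd0, smul_zero, add_zero] at h0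
    exact h0
  · have h2 : (2 * r + 1) • (orb Gal(K/F) (i + 1) i - 2) =
        r • doubleRel Gal(K/F) i + (orb Gal(K/F) (i + 1) i - 2) := by
      rw [doubleRel]
      simp only [zsmul_eq_mul]
      push_cast
      ring
    rw [h2] at h0 ⊢
    have h3 : dress _ (x • rankRel Gal(K/F) (i + 1) + (orb Gal(K/F) (i + 1) i - 2)) = 0 := by
      rw [← add_assoc, add_right_comm, map_add, map_zsmul _ r, hd0, smul_zero, add_zero] at h0
      exact h0
    -- The discriminant forces `x` to be odd.
    have hx : Odd x := by
      rw [← Int.not_even_iff_odd]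
      rintro ⟨y, rfl⟩
      obtain ⟨l, rfl⟩ := Nat.exists_eq_add_of_le' hi1
      refine discr_dress_orb_quadratic_ne_zero hG rfl rfl hi ?_
      have h4 := congrArg (GW.discr _) h3
      have h5 : (2 : Burnside (cyc Gal(K/F) (l + 1 + 1))) = 2 • 1 := by
        rw [nsmul_one]; norm_num
      rw [map_add, map_sub, h5, map_nsmul, dress_one hG hi, map_add, map_sub, map_nsmul,
        two_nsmul_squareClasses, sub_zero, add_smul, map_add, map_add, ← two_nsmul,
        two_nsmul_squareClasses, zero_add, map_zero] at h4
      exact h4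
    -- Hence the order of the trace form divides `2`.
    have ha : (traceOrder F K (i + 1) : ℤ) ∣ 2 := by
      have h4 : (traceOrder F K (i + 1) : ℤ) ∣ 2 * x := by
        refine hdvd _ ?_
        have h5 : (2 * x) • rankRel Gal(K/F) (i + 1) =
            2 • (x • rankRel Gal(K/F) (i + 1) + (orb Gal(K/F) (i + 1) i - 2)) -
              doubleRel Gal(K/F) i := by
          rw [doubleRel]
          simp only [zsmul_eq_mul, nsmul_eq_mul]
          push_cast
          ring
        rw [h5, map_sub, map_nsmul, h3, smul_zero, hd0, sub_zero]
      rcases traceOrder_eq_zero_or_exists_eq_two_pow hG hn (Nat.succ_pos i) hi with h5 | ⟨k, -, h5⟩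
      · rw [h5, Nat.cast_zero, zero_dvd_iff] at h4
        obtain ⟨y, rfl⟩ := hx
        omega
      · rw [h5] at h4 ⊢
        push_cast at h4 ⊢
        refine IsCoprime.dvd_of_dvd_mul_right (IsCoprime.pow_left ?_) h4
        obtain ⟨y, rfl⟩ := hx
        exact ⟨-y, 1, by ring⟩
    have h6 : (x + 1) • rankRel Gal(K/F) (i + 1) ∈ J := by
      refine zsmul_rankRel_mem hrank (ha.trans ?_)
      obtain ⟨y, rfl⟩ := hx
      exact ⟨y + 1, by ring⟩
    have h7 : x • rankRel Gal(K/F) (i + 1) + (orb Gal(K/F) (i + 1) i - 2) =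
        (x + 1) • rankRel Gal(K/F) (i + 1) - regularRel Gal(K/F) i := by
      rw [rankRel, regularRel]
      simp only [zsmul_eq_mul]
      push_cast
      ring
    have h8 : regularRel Gal(K/F) i ∈ J := by
      refine hreg hi1 ?_
      rw [h7, map_sub, hJ _ h6, zero_sub, neg_eq_zero] at h3
      exact h3
    convert J.add_mem (J.sub_mem h6 h8) (J.zsmul_mem (hdouble hi1) r) using 1
    rw [← h7]
    abel

end Levels

/-! ### The trace ideal is a Tambara ideal -/

/-- Coinduction along the identity changes nothing. -/
theorem BurnsideSemiring.coind_of_apply_eq {H : Type u} [Group H] [Finite H] {φ : H →* H}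
    (hφ : ∀ l, φ l = l) (x : BurnsideSemiring H) : BurnsideSemiring.coind φ x = x := by
  induction x using Quotient.inductionOn with | _ X
  refine mk_eq (X := FinGSet.coind φ X) (Y := X)
    { toFun := fun f => f.1 1
      invFun := fun x => ⟨fun h => h • x, fun l h => by
        change (φ l * h) • x = l • h • x
        rw [hφ, mul_smul]⟩
      left_inv := fun f => Subtype.ext (funext fun h => ?_)
      right_inv := fun x => one_smul H x } fun k f => ?_
  · have h1 := f.2 h 1
    rw [hφ, mul_one] at h1
    exact h1.symm
  · have h1 := f.2 k 1
    rw [hφ, mul_one] at h1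
    change f.1 (1 * k) = k • f.1 1
    rw [one_mul]
    exact h1

section Levels

variable {F : Type v} {K : Type u} [Field F] [Field K] [Algebra F K]
variable [FiniteDimensional F K] [IsCyclic Gal(K/F)] {n : ℕ} (hG : Nat.card Gal(K/F) = 2 ^ n)
  [NeZero (2 : F)] [IsGalois F K]
include hG

theorem dress_sub_mul {i : ℕ} (hi : i ≤ n) (b c : Burnside (cyc Gal(K/F) i))
    {y z : Burnside (cyc Gal(K/F) i)} (hy : dress _ y = 0) (hz : dress _ z = 0) :
    dress (cyc Gal(K/F) i) (b * y - c * z) = 0 := by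
  rw [map_sub, dress_mul_eq_zero hG hi b hy, dress_mul_eq_zero hG hi c hz, sub_zero]

theorem dress_traceOrder_mul {i : ℕ} (hi : i ≤ n) : dress (cyc Gal(K/F) i)
    ((traceOrder F K i : Burnside (cyc Gal(K/F) i)) * rankRel Gal(K/F) i) = 0 := by
  rw [← nsmul_eq_mul, map_nsmul]
  exact (traceOrder_dvd_iff hG hi _).1 dvd_rfl

theorem dress_orb_sub_orb {d i : ℕ} (hi : i ≤ n) (hd1 : 1 ≤ d) (hd : d + 2 ≤ i) :
    dress (cyc Gal(K/F) i) (orb _ i d - orb _ i (d + 1) - 2 * orb _ i (d + 2)) = 0 := by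
  rw [← tr_quarticRel hG hi hd (cyc_mono _ hd)]
  exact dress_tr_eq_zero hG hi hd _ (dress_quarticRel hG hd1 (hd.trans hi))

/-- For the trivial group the Dress map is injective, by the rank. -/
theorem eq_zero_of_dress_eq_zero {z : Burnside (cyc Gal(K/F) 0)} (hz : dress _ z = 0) : z = 0 := by
  obtain ⟨c, rfl⟩ := exists_eq_sum_orb hG (Nat.zero_le n) z
  rw [Finset.sum_range_one] at hz ⊢
  rw [map_zsmul, orb_self hG (Nat.zero_le n), dress_one hG (Nat.zero_le n)] at hz
  have h1 := congrArg (GW.rank _) hz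
  rw [map_zsmul, GW.rank_unary, map_zero, smul_eq_mul, mul_one] at h1
  rw [h1, zero_smul]

/-- The kernels of the Dress maps are stable under the norms of index `2`. -/
theorem dress_norm_eq_zero (hn : 2 ≤ n) {i : ℕ} (hi : i + 1 ≤ n)
    (h : cyc Gal(K/F) i ≤ cyc Gal(K/F) (i + 1)) {z : Burnside (cyc Gal(K/F) i)}
    (hz : dress _ z = 0) : dress (cyc Gal(K/F) (i + 1)) (burnsideNorm h z) = 0 := by
  rcases i with _ | i
  · rw [eq_zero_of_dress_eq_zero hG hz, norm_zero hG hi, map_zero]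
  have hi' : i + 1 ≤ n := Nat.le_of_succ_le hi
  have htr := fun {z : Burnside (cyc Gal(K/F) (i + 1))} (hz : dress _ z = 0) =>
    dress_tr_eq_zero hG hi (Nat.le_succ _) h hz
  let J : AddSubgroup (Burnside (cyc Gal(K/F) (i + 1))) :=
    { carrier := {z | dress _ z = 0 ∧ dress _ (burnsideNorm h z) = 0}
      zero_mem' := ⟨map_zero _, by rw [norm_zero hG hi, map_zero]⟩
      add_mem' := fun {a b} ha hb => ⟨by rw [map_add, ha.1, hb.1, add_zero], by
        rw [norm_add hG hi, map_add, map_add, ha.2, hb.2, add_zero, zero_add]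
        exact htr (dress_mul_eq_zero hG hi' a hb.1)⟩
      neg_mem' := fun {a} ha => ⟨by rw [map_neg, ha.1, neg_zero], by
        have h1 := norm_add hG hi h a (-a)
        rw [add_neg_cancel, norm_zero hG hi] at h1
        have h2 := congrArg (dress _) h1
        rw [map_add, map_add, ha.2, zero_add, map_zero,
          htr (by rw [mul_comm]; exact dress_mul_eq_zero hG hi' _ ha.1), add_zero] at h2
        exact h2.symm⟩ }
  refine (mem_of_dress_eq_zero hG (J := J) hn hi' (fun z hz => hz.1) (fun d hd1 hd => ?_)
    (fun hi1 => ⟨dress_doubleRel hG hi1 hi', ?_⟩) (fun hi1 hr => ⟨hr, ?_⟩)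
    ⟨dress_traceOrder_mul hG hi', ?_⟩ hz).2
  · refine ⟨dress_orb_sub_orb hG hi' hd1 hd, ?_⟩
    rcases Nat.lt_or_ge (d + 1) i with hlt | hge
    · have hdi : d + 1 + 1 ≤ i := hlt
      have h1 : cyc Gal(K/F) i ≤ cyc Gal(K/F) (i + 1) := cyc_mono _ (Nat.le_succ i)
      have h2 : cyc Gal(K/F) (d + 1 + 1) ≤ cyc Gal(K/F) i := cyc_mono _ hdi
      have h3 : dress _ (burnsideTr h2 (quarticRel Gal(K/F) d)) = 0 :=
        dress_tr_eq_zero hG (by omega) hdi h2 (dress_quarticRel hG hd1 (by omega))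
      rw [← tr_quarticRel hG hi' hd (h2.trans h1), ← tr_tr hG hi' hdi (Nat.le_succ i) h1 h2,
        norm_tr hG hi h1 h]
      exact htr (dress_tr_eq_zero hG hi' (Nat.le_succ i) h1 (dress_mul_eq_zero hG (by omega) _ h3))
    · obtain rfl : i = d + 1 := by omega
      have h2 : orb Gal(K/F) (d + 1 + 1) d - orb _ (d + 1 + 1) (d + 1) -
          2 * orb _ (d + 1 + 1) (d + 2) = quarticRel _ d := by
        rw [orb_self hG hi', mul_one, quarticRel]
      rw [h2, norm_quarticRel hG hi h, ← one_mul (quarticRel Gal(K/F) (d + 1))]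
      exact dress_sub_mul hG hi _ _ (dress_quarticRel hG (by omega) hi)
        (htr (dress_quarticRel hG hd1 hi'))
  · rw [norm_doubleRel hG hi h]
    exact dress_sub_mul hG hi _ _ (dress_doubleRel hG (by omega) hi) (dress_quarticRel hG hi1 hi)
  · rw [norm_regularRel hG hi h]
    exact dress_sub_mul hG hi _ _ (dress_quarticRel hG hi1 hi) (htr hr)
  · obtain ⟨m, hm⟩ := two_dvd_traceOrder hG hn (Nat.succ_pos i) hi'
    have h1 := htr (dress_traceOrder_mul hG hi')
    rw [hm, ← nsmul_eq_mul, map_nsmul, nsmul_eq_mul] at h1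
    rw [hm, norm_rankRel hG hi h]
    have h2 : (2 * m ^ 2 * 2 ^ (i + 1) : Burnside (cyc Gal(K/F) (i + 1 + 1))) *
        burnsideTr h (rankRel Gal(K/F) (i + 1)) =
        (m * 2 ^ (i + 1)) * (((2 * m : ℕ) : Burnside (cyc Gal(K/F) (i + 1 + 1))) *
          burnsideTr h (rankRel Gal(K/F) (i + 1))) := by
      push_cast
      ring
    rw [h2]
    exact dress_sub_mul hG hi _ _ (dress_doubleRel hG (by omega) hi) h1

/-- As the norm of index `2` is quadratic with the transfer of the product as its cross term, it is
well defined modulo the kernels. -/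
theorem dress_norm_sub (hn : 2 ≤ n) {i : ℕ} (hi : i + 1 ≤ n)
    (h : cyc Gal(K/F) i ≤ cyc Gal(K/F) (i + 1)) {a b : Burnside (cyc Gal(K/F) i)}
    (hab : dress _ (a - b) = 0) :
    dress (cyc Gal(K/F) (i + 1)) (burnsideNorm h a - burnsideNorm h b) = 0 := by
  have h5 := norm_add hG hi h b (a - b)
  rw [add_sub_cancel] at h5
  rw [h5, add_assoc, add_sub_cancel_left, map_add, dress_norm_eq_zero hG hn hi h hab, zero_add]
  exact dress_tr_eq_zero hG hi (Nat.le_succ i) h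
    (dress_mul_eq_zero hG (Nat.le_of_succ_le hi) b hab)

/-- Coinduction from any subgroup is well defined modulo the kernels, being a composite of norms of
index `2`. -/
theorem dress_coind_sub (hn : 2 ≤ n) {c i : ℕ} (hi : i ≤ n) (hc : c ≤ i)
    (h : cyc Gal(K/F) c ≤ cyc Gal(K/F) i) (x y : BurnsideSemiring (cyc Gal(K/F) c))
    (hxy : dress _ (GrothendieckAddGroup.of x - GrothendieckAddGroup.of y : Burnside _) = 0) :
    dress (cyc Gal(K/F) i)
      (GrothendieckAddGroup.of (BurnsideSemiring.coind (Subgroup.inclusion h) x) -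
        GrothendieckAddGroup.of (BurnsideSemiring.coind (Subgroup.inclusion h) y) :
          Burnside _) = 0 := by
  induction hc with
  | refl =>
    rw [BurnsideSemiring.coind_of_apply_eq fun _ => rfl,
      BurnsideSemiring.coind_of_apply_eq fun _ => rfl]
    exact hxy
  | @step i hc ih =>
    have h1 : cyc Gal(K/F) i ≤ cyc Gal(K/F) (i + 1) := cyc_mono _ (Nat.le_succ i)
    have h2 : cyc Gal(K/F) c ≤ cyc Gal(K/F) i := cyc_mono _ hc
    have h3 : ∀ x : BurnsideSemiring (cyc Gal(K/F) c),
        (GrothendieckAddGroup.of (BurnsideSemiring.coind (Subgroup.inclusion h) x) :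
          Burnside (cyc Gal(K/F) (i + 1))) = burnsideNorm h1 (GrothendieckAddGroup.of
            (BurnsideSemiring.coind (Subgroup.inclusion h2) x)) := fun x => by
      rw [burnsideNorm, Burnside.coind_of, ← BurnsideSemiring.coind_comp]
      rfl
    refine (congrArg (dress _) (congrArg₂ (· - ·) (h3 x) (h3 y))).trans ?_
    exact dress_norm_sub hG hn hi h1 (ih (Nat.le_of_succ_le hi) h2)

/-- The kernels of the Dress maps form a Tambara ideal. -/
theorem exists_tambaraIdeal_eq_traceIdeal (hn : 2 ≤ n) :
    ∃ T : TambaraIdeal Gal(K/F), ∀ H : Subgroup Gal(K/F), (T.level H : Set (Burnside H)) =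
       traceIdeal F K H := by
  refine ⟨{ level := fun H =>
              { carrier := traceIdeal F K H
                zero_mem' := map_zero (dress H)
                add_mem' := fun {a b} (ha : dress H a = 0) (hb : dress H b = 0) => by
                  change dress H (a + b) = 0
                  rw [map_add, ha, hb, add_zero]
                smul_mem' := fun b z hz => ?_ }
            res_mem := fun {L H} h a ha => ?_
            tr_mem := fun {L H} h a ha => ?_
            norm_mem := fun {L H} h a ha => ?_
            conj_mem := fun g H a ha => ?_ }, fun H => rfl⟩
  · obtain ⟨i, hi, rfl⟩ := exists_eq_cyc hG H
    exact dress_mul_eq_zero hG hi b hz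
  · obtain ⟨i, hi, rfl⟩ := exists_eq_cyc hG H
    obtain ⟨c, hc, rfl⟩ := exists_eq_cyc hG L
    exact dress_res_eq_zero hG hi (le_of_cyc_le hG hc hi h) h ha
  · obtain ⟨i, hi, rfl⟩ := exists_eq_cyc hG H
    obtain ⟨c, hc, rfl⟩ := exists_eq_cyc hG L
    exact dress_tr_eq_zero hG hi (le_of_cyc_le hG hc hi h) h ha
  · obtain ⟨i, hi, rfl⟩ := exists_eq_cyc hG H
    obtain ⟨c, hc, rfl⟩ := exists_eq_cyc hG L
    exact Burnside.coind_sub_mem (Subgroup.inclusion h) (dress _).ker (dress _).ker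
      (fun x y hxy => dress_coind_sub hG hn hi (le_of_cyc_le hG hc hi h) h x y hxy) a ha
  · have h1 : H.map (MulAut.conj g).toMonoidHom ≤ H := by
      rintro _ ⟨k, hk, rfl⟩
      change g * k * g⁻¹ ∈ H
      rwa [mul_comm' g, mul_inv_cancel_right]
    have key : ∀ (M : Subgroup Gal(K/F)) (h : M ≤ H), dress M (burnsideRes h a) = 0 := by
      intro M h
      obtain ⟨i, hi, rfl⟩ := exists_eq_cyc hG H
      obtain ⟨c, hc, rfl⟩ := exists_eq_cyc hG M
      exact dress_res_eq_zero hG hi (le_of_cyc_le hG hc hi h) h ha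
    rw [burnsideConj_eq_res g _ h1]
    exact key _ h1

end Levels

/-! ### Generators of the trace ideal -/

section Levels

variable {F : Type v} {K : Type u} [Field F] [Field K] [Algebra F K]
variable [FiniteDimensional F K] [IsCyclic Gal(K/F)] {n : ℕ} (hG : Nat.card Gal(K/F) = 2 ^ n)
include hG

section Ideal

variable (I : TambaraIdeal Gal(K/F)) (hI : quarticRel Gal(K/F) 1 ∈ I.level (cyc _ (1 + 1 + 1)))
  {i : ℕ}

/-- The norm of zero is zero, so that ideals are stable under norms of index `2`. -/
theorem norm_mem_level (hi : i + 1 ≤ n) (h : cyc Gal(K/F) i ≤ cyc Gal(K/F) (i + 1))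
    {z : Burnside (cyc Gal(K/F) i)} (hz : z ∈ I.level (cyc Gal(K/F) i)) :
    burnsideNorm h z ∈ I.level (cyc Gal(K/F) (i + 1)) := by
  have h1 := I.norm_mem h z hz
  rwa [norm_zero hG hi, sub_zero] at h1

include hI

/-- The first quartic relation yields all others by norms. -/
theorem quarticRel_mem_level (hi1 : 1 ≤ i) (hi : i + 1 + 1 ≤ n) :
    quarticRel Gal(K/F) i ∈ I.level (cyc _ (i + 1 + 1)) := by
  induction hi1 with
  | refl => exact hI
  | @step i hi1 ih =>
    have h := cyc_mono Gal(K/F) (Nat.le_succ (i + 1 + 1))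
    have h1 := ih (Nat.le_of_succ_le hi)
    have h2 := norm_mem_level hG I hi h h1
    rw [norm_quarticRel hG hi h] at h2
    exact (Submodule.sub_mem_iff_left _ (Ideal.mul_mem_left _ _ (I.tr_mem h _ h1))).1 h2

/-- The first relation `doubleRel` is a restriction of the quartic relation, and yields all others
by transfers. -/
theorem doubleRel_mem_level (hn : 3 ≤ n) (hi1 : 1 ≤ i) (hi : i + 1 ≤ n) :
    doubleRel Gal(K/F) i ∈ I.level (cyc _ (i + 1)) := by
  induction hi1 with
  | refl =>
    have h1 := I.res_mem (cyc_mono _ (Nat.le_succ (1 + 1))) _ hI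
    rwa [res_quarticRel hG hn] at h1
  | @step i hi1 ih =>
    have h := cyc_mono Gal(K/F) (Nat.le_succ (i + 1))
    have h1 := I.tr_mem h _ (ih (Nat.le_of_succ_le hi))
    rw [tr_doubleRel hG hi h] at h1
    exact (Submodule.sub_mem_iff_right _
      (Ideal.mul_mem_left _ _ (quarticRel_mem_level hG I hI hi1 hi))).1 h1

/-- Modulo the relations that hold in all cases, the relation between the regular set and its
quotient of order two amounts to one that is visible at the level of `C_4`. -/
theorem regularRel_sub_bottomRel_mem_level (hn : 3 ≤ n) (hi1 : 1 ≤ i) (hi : i + 1 ≤ n) :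
    regularRel Gal(K/F) i - bottomRel Gal(K/F) (i + 1) ∈ I.level (cyc _ (i + 1)) := by
  induction hi1 with
  | refl =>
    have h1 : regularRel Gal(K/F) 1 - bottomRel Gal(K/F) (1 + 1) = 0 := by
      have h2 : orb Gal(K/F) (1 + 1) 2 = 1 := orb_self hG hi
      rw [regularRel, bottomRel, h2]
      ring
    rw [h1]
    exact Submodule.zero_mem _
  | @step i hi1 ih =>
    have h := cyc_mono Gal(K/F) (Nat.le_succ (i + 1))
    have h1 := I.tr_mem h _ (ih (Nat.le_of_succ_le hi))
    rw [map_sub, tr_regularRel hG hi h, tr_bottomRel hG hi (Nat.succ_le_succ hi1) h] at h1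
    convert add_mem h1 (add_mem (quarticRel_mem_level hG I hI hi1 hi) (Ideal.mul_mem_left _
      (2 ^ i - 1) (doubleRel_mem_level hG I hI hn (Nat.succ_pos i) hi))) using 1
    ring

end Ideal

variable [NeZero (2 : F)] [IsGalois F K]

/-- An ideal that contains the first quartic relation, the relations `regularRel` that hold and the
multiples of `rankRel` that vanish contains the trace ideal. -/
theorem mem_level_of_dress_eq_zero (hn : 3 ≤ n) (I : TambaraIdeal Gal(K/F))
    (hI : quarticRel Gal(K/F) 1 ∈ I.level (cyc _ (1 + 1 + 1)))
    (hreg : ∀ i, 1 ≤ i → i + 1 ≤ n → dress _ (regularRel Gal(K/F) i) = 0 →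
      regularRel Gal(K/F) i ∈ I.level (cyc _ (i + 1)))
    (hrank : ∀ i, i + 1 ≤ n → (traceOrder F K (i + 1) : Burnside (cyc Gal(K/F) (i + 1))) *
      rankRel Gal(K/F) (i + 1) ∈ I.level (cyc _ (i + 1)))
    {H : Subgroup Gal(K/F)} {z : Burnside H} (hz : dress H z = 0) : z ∈ I.level H := by
  obtain ⟨i, hi, rfl⟩ := exists_eq_cyc hG H
  rcases i with _ | i
  · rw [eq_zero_of_dress_eq_zero hG hz]
    exact Submodule.zero_mem _
  let J : AddSubgroup (Burnside (cyc Gal(K/F) (i + 1))) :=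
    (I.level (cyc _ (i + 1))).toAddSubgroup ⊓ (dress _).ker
  refine (mem_of_dress_eq_zero hG (J := J) (by omega) hi (fun z hz => hz.2) (fun d hd1 hd =>
    ⟨?_, dress_orb_sub_orb hG hi hd1 hd⟩)
    (fun hi1 => ⟨doubleRel_mem_level hG I hI hn hi1 hi, dress_doubleRel hG hi1 hi⟩)
    (fun hi1 hr => ⟨hreg i hi1 hi hr, hr⟩)
    ⟨hrank i hi, dress_traceOrder_mul hG hi⟩ hz).1
  have h := cyc_mono Gal(K/F) hd
  rw [← tr_quarticRel hG hi hd h]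
  exact I.tr_mem h _ (quarticRel_mem_level hG I hI hd1 (hd.trans hi))

/-- A criterion for generation: the elements of `S` vanish under the Dress maps, and every ideal
containing them contains the elements of `mem_level_of_dress_eq_zero`. -/
theorem traceIdealGeneratedBy_of_forall (hn : 3 ≤ n)
    {S : Set (Σ H : Subgroup Gal(K/F), Burnside H)} (hS : ∀ s ∈ S, dress s.1 s.2 = 0)
    (h : ∀ I : TambaraIdeal Gal(K/F), (∀ s ∈ S, s.2 ∈ I.level s.1) →
      quarticRel Gal(K/F) 1 ∈ I.level (cyc _ (1 + 1 + 1)) ∧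
      (∀ i, 1 ≤ i → i + 1 ≤ n → dress _ (regularRel Gal(K/F) i) = 0 →
        regularRel Gal(K/F) i ∈ I.level (cyc _ (i + 1))) ∧
      ∀ i, i + 1 ≤ n → (traceOrder F K (i + 1) : Burnside (cyc Gal(K/F) (i + 1))) *
        rankRel Gal(K/F) (i + 1) ∈ I.level (cyc _ (i + 1))) :
    TraceIdealGeneratedBy F K S := by
  intro H
  refine Set.Subset.antisymm (fun z hz => ?_) fun z hz => ?_
  · refine (Submodule.mem_iInf _).2 fun I => ?_
    obtain ⟨h1, h2, h3⟩ := h I.1 I.2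
    exact mem_level_of_dress_eq_zero hG hn I.1 h1 h2 h3 hz
  · obtain ⟨T, hT⟩ := exists_tambaraIdeal_eq_traceIdeal hG (show 2 ≤ n by omega)
    rw [← hT]
    refine (Submodule.mem_iInf _).1 hz ⟨T, fun s hs => ?_⟩
    have h1 : s.2 ∈ (T.level s.1 : Set (Burnside s.1)) := by
      rw [hT]
      exact hS s hs
    exact h1

/-- Up to `doubleRel`, twice `regularRel` is twice `rankRel`, so that it can lie in the trace
ideal only if the order of the trace form divides `2`. -/
theorem traceOrder_dvd_two_of_dress_regularRel {i : ℕ} (hi1 : 1 ≤ i) (hi : i + 1 ≤ n)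
    (h : dress _ (regularRel Gal(K/F) i) = 0) : traceOrder F K (i + 1) ∣ 2 := by
  rw [traceOrder_dvd_iff hG hi, ← map_nsmul]
  have h1 : 2 • (orb Gal(K/F) (i + 1) 0 - 2 ^ (i + 1)) =
      2 * regularRel Gal(K/F) i - (-1) * doubleRel Gal(K/F) i := by
    rw [regularRel, doubleRel, nsmul_eq_mul]
    push_cast
    ring
  rw [h1]
  exact dress_sub_mul hG hi _ _ h (dress_doubleRel hG hi1 hi)

/-- Vanishing of the transfer means that `bottomRel` holds, which is the same as `regularRel` by
`regularRel_sub_bottomRel_mem_level`. -/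
theorem QuarticPresentation.transferVanishes_iff_dress_regularRel (hn : 3 ≤ n)
    (P : QuarticPresentation F K) {i : ℕ} (hi1 : 1 ≤ i) (hi : i + 1 ≤ n) :
    P.TransferVanishes (i + 1) ↔ dress _ (regularRel Gal(K/F) i) = 0 := by
  obtain ⟨T, hT⟩ := exists_tambaraIdeal_eq_traceIdeal hG (show 2 ≤ n by omega)
  have hmem : ∀ (H : Subgroup Gal(K/F)) (z : Burnside H), z ∈ T.level H ↔ dress H z = 0 := by
    intro H z
    rw [← SetLike.mem_coe, hT]
    rfl
  have h1 := regularRel_sub_bottomRel_mem_level hG T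
    ((hmem _ _).2 (dress_quarticRel hG le_rfl hn)) hn hi1 hi
  rw [hmem, map_sub, sub_eq_zero] at h1
  rw [h1, P.transferVanishes_iff hG (by omega) (by omega) hi, bottomRel, two_mul, map_sub, map_sub,
    map_add, ← two_nsmul, sub_sub, sub_eq_zero]

theorem dress_regularRel_one_iff (hn : 2 ≤ n) : dress _ (regularRel Gal(K/F) 1) = 0 ↔
    EmbedsInCyclic (levelField F K 2) K 8 := by
  have h1 : regularRel Gal(K/F) 1 = orb Gal(K/F) 2 0 - (orb Gal(K/F) 2 1 + (1 + 1)) := by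
    rw [regularRel]
    ring
  rw [h1, map_sub, map_add, map_add, dress_one hG hn, sub_eq_zero]
  exact dress_orb_quartic_eq_iff hG hn

/-- If `K` embeds into a cyclic octic extension of `K^{C_4}`, then one relation at the level of
`C_4` suffices: its norm is the first quartic relation up to a transfer, its restriction is
`2 ([C_2 / 1] - 2)`, and its transfers yield `2 ([C / 1] - 2 ^ i)` at the other levels. -/
theorem traceIdealGeneratedBy_of_embedsInCyclic (hn : 3 ≤ n)
    (h : EmbedsInCyclic (levelField F K 2) K 8) :
    TraceIdealGeneratedBy F K {⟨cyc _ (1 + 1), regularRel Gal(K/F) 1⟩} := by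
  have hr := (dress_regularRel_one_iff hG (by omega)).2 h
  refine traceIdealGeneratedBy_of_forall hG hn (fun s hs => hs ▸ hr) fun I hI => ?_
  replace hI : regularRel Gal(K/F) 1 ∈ I.level (cyc _ (1 + 1)) := hI _ rfl
  have c12 := cyc_mono Gal(K/F) (Nat.le_succ 1)
  have c23 := cyc_mono Gal(K/F) (Nat.le_succ (1 + 1))
  have hq : quarticRel Gal(K/F) 1 ∈ I.level (cyc _ (1 + 1 + 1)) := by
    have h1 := norm_mem_level hG I hn c23 hI
    rw [norm_regularRel hG hn c23] at h1
    have h2 := (Submodule.sub_mem_iff_left _ (Ideal.mul_mem_left _ _ (I.tr_mem c23 _ hI))).1 h1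
    have h3 : (2 ^ 1 - 1) * quarticRel Gal(K/F) 1 = quarticRel Gal(K/F) 1 := by ring
    rw [h3] at h2
    exact h2
  have hreg : ∀ i, 1 ≤ i → i + 1 ≤ n → regularRel Gal(K/F) i ∈ I.level (cyc _ (i + 1)) := by
    intro i hi1 hi
    induction hi1 with
    | refl => exact hI
    | @step i hi1 ih =>
      have c := cyc_mono Gal(K/F) (Nat.le_succ (i + 1))
      have h1 := I.tr_mem c _ (ih (Nat.le_of_succ_le hi))
      rw [tr_regularRel hG hi c] at h1
      convert add_mem h1 (add_mem (quarticRel_mem_level hG I hq hi1 hi) (Ideal.mul_mem_left _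
        (2 ^ i - 1) (doubleRel_mem_level hG I hq hn (Nat.succ_pos i) hi))) using 1
      ring
  have hrank : ∀ i, i + 1 ≤ n → 2 * rankRel Gal(K/F) (i + 1) ∈ I.level (cyc _ (i + 1)) := by
    intro i hi
    rcases i with _ | i
    · have h1 := I.res_mem c12 _ hI
      rwa [res_regularRel hG (by omega) c12] at h1
    · convert add_mem (Ideal.mul_mem_left _ 2 (hreg (i + 1) (Nat.succ_pos i) hi))
        (doubleRel_mem_level hG I hq hn (Nat.succ_pos i) hi) using 1
      rw [rankRel, regularRel, doubleRel]
      ring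
  refine ⟨hq, fun i hi1 hi _ => hreg i hi1 hi, fun i hi => ?_⟩
  obtain ⟨m, hm⟩ := two_dvd_traceOrder hG (by omega) (Nat.succ_pos i) hi
  rw [hm, mul_comm 2 m, Nat.cast_mul, Nat.cast_ofNat, mul_assoc]
  exact Ideal.mul_mem_left _ _ (hrank i hi)

/-- If `δ` is not a sum of squares, then no nonzero multiple of `rankRel` and no `regularRel` lies
in the trace ideal, and the quartic relation alone suffices. -/
theorem QuarticPresentation.traceIdealGeneratedBy_of_tau_eq_zero (hn : 3 ≤ n)
    (P : QuarticPresentation F K) (hτ : tau P.δ = 0) :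
    TraceIdealGeneratedBy F K {⟨cyc _ (1 + 1 + 1), quarticRel Gal(K/F) 1⟩} := by
  refine traceIdealGeneratedBy_of_forall hG hn (fun s hs => hs ▸ dress_quarticRel hG le_rfl hn)
    fun I hI => ⟨hI _ rfl, fun i hi1 hi hr => ?_, fun i hi => ?_⟩
  · have h1 := traceOrder_dvd_two_of_dress_regularRel hG hi1 hi hr
    rw [P.traceOrder_eq_zero hG (by omega) hτ (Nat.succ_pos i) hi] at h1
    exact absurd (zero_dvd_iff.1 h1) two_ne_zero
  · rw [P.traceOrder_eq_zero hG (by omega) hτ (Nat.succ_pos i) hi, Nat.cast_zero, zero_mul]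
    exact Submodule.zero_mem _

/-- The generators are the quartic relation, the multiples of `rankRel` that lie in the trace ideal
and the first `bottomRel` that does, whose transfers are the later ones. As `K` does not embed into
a cyclic octic extension of `K^{C_4}`, the relation at the level of `C_4` itself does not hold. -/
theorem QuarticPresentation.traceIdealGeneratedBy (hn : 3 ≤ n) (P : QuarticPresentation F K)
    (h : ¬ EmbedsInCyclic (levelField F K 2) K 8) :
    TraceIdealGeneratedBy F K
      ({s | ∃ m, IsLeast {m | 3 ≤ m ∧ m ≤ n ∧ P.TransferVanishes m} m ∧
          s = ⟨cyc _ m, bottomRel Gal(K/F) m⟩} ∪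
        {⟨cyc _ (1 + 1 + 1), quarticRel Gal(K/F) 1⟩} ∪
        {s | ∃ i, 1 ≤ i ∧ i ≤ n ∧
          s = ⟨cyc _ i, (traceOrder F K i : Burnside (cyc Gal(K/F) i)) * rankRel _ i⟩}) := by
  refine traceIdealGeneratedBy_of_forall hG hn ?_ fun I hI => ?_
  · rintro s ((⟨m, ⟨⟨hm3, hmn, hm⟩, -⟩, rfl⟩ | rfl) | ⟨i, hi1, hi, rfl⟩)
    · rw [P.transferVanishes_iff hG (by omega) (by omega) hmn] at hm
      change dress _ (bottomRel _ m) = 0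
      rw [bottomRel, two_mul, map_sub, map_sub, map_add, ← two_nsmul, sub_sub, sub_eq_zero, hm]
    · exact dress_quarticRel hG le_rfl hn
    · exact dress_traceOrder_mul hG hi
  have hq : quarticRel Gal(K/F) 1 ∈ I.level (cyc _ (1 + 1 + 1)) := hI _ (Or.inl (Or.inr rfl))
  refine ⟨hq, fun i hi1 hi hr => ?_, fun i hi => hI _ (Or.inr ⟨i + 1, Nat.succ_pos i, hi, rfl⟩)⟩
  have hi2 : i ≠ 1 := by
    rintro rfl
    exact h ((dress_regularRel_one_iff hG (by omega)).1 hr)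
  have hv := (P.transferVanishes_iff_dress_regularRel hG hn hi1 hi).2 hr
  classical
  have hex : ∃ m, 3 ≤ m ∧ m ≤ n ∧ P.TransferVanishes m := ⟨i + 1, by omega, hi, hv⟩
  have hle : Nat.find hex ≤ i + 1 := Nat.find_min' hex ⟨by omega, hi, hv⟩
  have hmem : ∀ j, Nat.find hex ≤ j → j ≤ n → bottomRel Gal(K/F) j ∈ I.level (cyc _ j) := by
    intro j hj hjn
    induction hj with
    | refl =>
      exact hI _ (Or.inl (Or.inl ⟨_, ⟨Nat.find_spec hex, fun m hm => Nat.find_min' hex hm⟩, rfl⟩))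
    | @step j hj ih =>
      have h3 : 3 ≤ Nat.find hex := (Nat.find_spec hex).1
      have c := cyc_mono Gal(K/F) (Nat.le_succ j)
      have h1 := I.tr_mem c _ (ih (Nat.le_of_succ_le hjn))
      rwa [tr_bottomRel hG hjn (Nat.le_trans (by omega) hj) c] at h1
  convert add_mem (regularRel_sub_bottomRel_mem_level hG I hq hn hi1 hi) (hmem _ hle hi) using 1
  ring

end Levels
end TraceIdeal

theorem mainTheorem3 {F : Type v} {K : Type u} [Field F] [Field K] [Algebra F K]
    [FiniteDimensional F K] [IsGalois F K] [NeZero (2 : F)] [IsCyclic Gal(K/F)]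
    (n : ℕ) (hn : 3 ≤ n) (hcard : Nat.card Gal(K/F) = 2 ^ n) :
    (EmbedsInCyclic (levelField F K 2) K 8 →
      TraceIdealGeneratedBy F K {⟨cyc _ 2, tset 2 2 - tset 2 1 - 2⟩}) ∧
    Nonempty (QuarticPresentation F K) ∧
    ∀ P : QuarticPresentation F K,
      (tau P.δ = 0 → TraceIdealGeneratedBy F K {⟨cyc _ 3, tset 3 2 - tset 3 1 - 2⟩}) ∧
      (¬ EmbedsInCyclic (levelField F K 2) K 8 → tau P.δ ≠ 0 →
        TraceIdealGeneratedBy F K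
          ({s | ∃ m, IsLeast {m | 3 ≤ m ∧ m ≤ n ∧ P.TransferVanishes m} m ∧
              s = ⟨cyc _ m, tset m m - tset m (m - 1) - 2 * tset m (m - 2)⟩} ∪
            {⟨cyc _ 3, tset 3 2 - tset 3 1 - 2⟩} ∪
            {s | ∃ i, 1 ≤ i ∧ i ≤ n ∧
              s = ⟨cyc _ i, (traceOrder F K i : Burnside (cyc Gal(K/F) i)) * (tset i i - 2 ^ i)⟩}) ∧
        (∀ i, 1 ≤ i → i ≤ n → ∃ k, 1 ≤ k ∧ traceOrder F K i = 2 ^ k) ∧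
        (∀ i, 1 ≤ i → i < n →
          traceOrder F K (i + 1) ∣ traceOrder F K i ∧
            traceOrder F K i ∣ 2 * traceOrder F K (i + 1))) := by
  have hn2 : 2 ≤ n := by omega
  have h3 : (tset 3 2 - tset 3 1 - 2 : Burnside (cyc Gal(K/F) 3)) = quarticRel Gal(K/F) 1 := rfl
  refine ⟨fun h => ?_, nonempty_quarticPresentation hcard hn2, fun P => ⟨fun hτ => ?_,
    fun hE hτ => ⟨?_, fun i hi1 hi => ?_, fun i hi1 hi =>
      ⟨traceOrder_succ_dvd hcard hi1 hi, traceOrder_dvd_two_mul hcard hi⟩⟩⟩⟩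
  · have h2 : (tset 2 2 - tset 2 1 - 2 : Burnside (cyc Gal(K/F) 2)) = regularRel Gal(K/F) 1 := by
      rw [regularRel, tset_eq_orb, tset_eq_orb]
      ring
    rw [h2]
    exact traceIdealGeneratedBy_of_embedsInCyclic hcard hn h
  · rw [h3]
    exact P.traceIdealGeneratedBy_of_tau_eq_zero hcard hn hτ
  · have hm : ∀ m, 3 ≤ m → (tset m m - tset m (m - 1) - 2 * tset m (m - 2) :
        Burnside (cyc Gal(K/F) m)) = bottomRel Gal(K/F) m := fun m hm => by
      rw [bottomRel, tset_eq_orb, tset_eq_orb, tset_eq_orb, Nat.sub_self,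
        Nat.sub_sub_self (by omega), Nat.sub_sub_self (by omega)]
    have hi : ∀ i, (tset i i - 2 ^ i : Burnside (cyc Gal(K/F) i)) = rankRel Gal(K/F) i := fun i => by
      rw [rankRel, tset_eq_orb, Nat.sub_self]
    have h1 := P.traceIdealGeneratedBy hcard hn hE
    have e : ∀ s : Σ H : Subgroup Gal(K/F), Burnside H,
        (∃ m, IsLeast {m | 3 ≤ m ∧ m ≤ n ∧ P.TransferVanishes m} m ∧
          s = ⟨cyc _ m, tset m m - tset m (m - 1) - 2 * tset m (m - 2)⟩) ↔
        ∃ m, IsLeast {m | 3 ≤ m ∧ m ≤ n ∧ P.TransferVanishes m} m ∧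
          s = ⟨cyc _ m, bottomRel Gal(K/F) m⟩ := fun s =>
      exists_congr fun m => and_congr_right fun h => by rw [hm m h.1.1]
    simp only [e, hi, h3]
    exact h1
  · refine (traceOrder_eq_zero_or_exists_eq_two_pow hcard hn2 hi1 hi).resolve_left fun h0 => ?_
    obtain ⟨r, hr⟩ := P.exists_traceOrder_dvd hcard hn2 hτ hi1 hi
    rw [h0, zero_dvd_iff] at hr
    exact pow_ne_zero r two_ne_zero hr
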